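/- All graphs are finite and simple; "contains" refers to (not necessarily induced) subgraphs. $I_s$ is the edgeless graph on $s$ vertices, $\vee$ is the join, $T_2(m)$ the balanced complete bipartite graph on $m$ vertices. For a graph or family of graphs $\mathcal L$, $\mathrm{ex}(n,\mathcal L)$ is the maximum number of edges of an $\mathcal L$-free graph on $n$ vertices and $\mathrm{EX}(n,\mathcal L)$ is the set of $\mathcal L$-free graphs on $n$ vertices with $\mathrm{ex}(n,\mathcal L)$ edges (the extremal graphs for $\mathcal{L}$). Let $H$ be a bipartite graph with at least one edge, let $t\ge 5$ be odd, and let $H(t)$ be an odd-ballooning of $H$: each edge $uv$ of $H$ is replaced by an odd cycle of length at least $t$ through $uv$ (the lengths may differ from edge to edge), the new vertices of different cycles being distinct. Let $\mathcal M=\mathcal M_2(H(t))$ be the 2-decomposition family of $H(t)$, that is, the family of graphs $M$ that are minimal under taking subgraphs with the property that, for some $s$, $(M\cup I_s)\vee I_s$ contains a copy of $H(t)$. A covering of a graph is a set of vertices meeting all edges; $\beta(M)$ is the least order of a covering of $M$, and, for bipartite $M$, $\gamma(M)$ is the least order of an independent covering of $M$. Put * $\tilde q=\min\{\gamma(M):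 M\in\mathcal M \text{ bipartite}\}$; * $k$ = the minimum of $d_M(x)$ over all bipartite $M\in\mathcal M$, all independent coverings $S$ of $M$ of order $\tilde q$, and all $x\in S$; * $\tilde{\mathcal B}$ = the set of all graphs $M[C]$ with $M\in\mathcal M$ and $C$ a covering of $M$ with $|C|<\tilde q$; if $\beta(M)\ge\tilde q$ for all $M\in\mathcal M$, then $\tilde{\mathcal B}=\{K_{\tilde q}\}$ instead. Let $f(n,\tilde q)=e(I_{\tilde q-1}\vee T_2(n-\tilde q+1))$, and let $\mathcal F=\mathcal F(n,\tilde q,k-1,\tilde{\mathcal B})$ be the set of graphs obtained from $I_{\tilde q-1}\vee T_2(n-\tilde q+1)$ by putting a member of $\mathrm{EX}(\tilde q-1,\tilde{\mathcal B})$ in $I_{\tilde q-1}$ and a copy of $K_{k-1,k-1}$ in one class of $T_2(n-\tilde q+1)$. Then, for all sufficiently large $n$ (depending on $H(t)$), $$f(n,\tilde q)+\mathrm{ex}(\tilde q-1,\tilde{\mathcal B})\le \mathrm{ex}(n,H(t))\le f(n,\tilde q)+\mathrm{ex}(\tilde q-1,\tilde{\mathcal B})+(k-1)^2 .$$ Moreover,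 if the upper bound is attained for $n$, then the only extremal graphs for $H(t)$ on $n$ vertices are graphs in $\mathcal F$; more precisely, $\mathrm{EX}(n,H(t))$ consists exactly of the $H(t)$-free members of $\mathcal F$. If in addition $k=1$, or $\mathrm{EX}(\tilde q-1,\tilde{\mathcal B})$ consists of a single graph up to isomorphism, then $\mathrm{EX}(n,H(t))=\mathcal F$. -/

import Mathlib

open SimpleGraph

/-- The join `G ∨ H`: disjoint copies of `G` and `H` together with all edges between them. -/
def graphJoin {V W : Type*} (G : SimpleGraph V) (H : SimpleGraph W) : SimpleGraph (V ⊕ W) :=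
  (G ⊕g H) ⊔ completeBipartiteGraph V W

/-- The odd-ballooning of `H` in which the edge `e` is replaced by a cycle of length `ℓ e`:
the edge `e = uv` is kept and `ℓ e - 2` new vertices `(e, 0), …, (e, ℓ e - 3)` form, together
with the ends of `e`, a second path `u, (e, 0), …, (e, ℓ e - 3), v`. The ends `u, v` of `e` are
listed in an arbitrary order, which does not matter up to isomorphism. -/
def oddBallooning {V : Type*} (H : SimpleGraph V) (ℓ : H.edgeSet → ℕ) :
    SimpleGraph (V ⊕ (Σ e : H.edgeSet, Fin (ℓ e - 2))) :=
  SimpleGraph.fromRel fun a b =>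
    match a, b with
    | Sum.inl u, Sum.inl v => H.Adj u v
    | Sum.inl u, Sum.inr ⟨e, i⟩ =>
        (u = (Quot.out e.1).1 ∧ i.val = 0) ∨ (u = (Quot.out e.1).2 ∧ i.val + 3 = ℓ e)
    | Sum.inr ⟨e, i⟩, Sum.inr ⟨e', j⟩ => e = e' ∧ i.val + 1 = j.val
    | Sum.inr _, Sum.inl _ => False

/-- A family of finite graphs, given by representatives on the vertex sets `Fin m`. -/
abbrev GraphFamily : Type := Set (Σ m : ℕ, SimpleGraph (Fin m))

/-- `G` contains no member of `𝓛` as a (not necessarily induced) subgraph. -/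
def FamilyFree {V : Type*} (𝓛 : GraphFamily) (G : SimpleGraph V) : Prop :=
  ∀ L ∈ 𝓛, L.2.Free G

open scoped Classical in
/-- `ex(n, 𝓛)` for a family `𝓛`. -/
noncomputable def exFamily (n : ℕ) (𝓛 : GraphFamily) : ℕ :=
  Finset.sup {G : SimpleGraph (Fin n) | FamilyFree 𝓛 G} fun G => G.edgeSet.ncard

/-- `EX(n, 𝓛)` for a family `𝓛`. -/
def EXFamily (n : ℕ) (𝓛 : GraphFamily) : Set (SimpleGraph (Fin n)) :=
  {G | FamilyFree 𝓛 G ∧ G.edgeSet.ncard = exFamily n 𝓛}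

/-- `EX(n, L)` for a single graph `L`. -/
def EXGraph {W : Type*} (n : ℕ) (L : SimpleGraph W) : Set (SimpleGraph (Fin n)) :=
  {G | L.Free G ∧ G.edgeSet.ncard = extremalNumber n L}

/-- `S` is an independent covering of `G`. -/
def IsIndepCovering {V : Type*} (G : SimpleGraph V) (S : Finset V) : Prop :=
  G.IsIndepSet (S : Set V) ∧ G.IsVertexCover (S : Set V)

/-- `γ(G)`: the least order of an independent covering of a bipartite graph `G`. -/
noncomputable def indepCoveringNum {V : Type*} (G : SimpleGraph V) : ℕ :=
  sInf {s | ∃ S : Finset V, IsIndepCovering G S ∧ S.card = s}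

/-- The independent covering number `q(𝓛)`: the least `γ(L)` over the bipartite `L ∈ 𝓛`. -/
noncomputable def indepCoveringNumber (𝓛 : GraphFamily) : ℕ :=
  sInf {s | ∃ L ∈ 𝓛, L.2.IsBipartite ∧ indepCoveringNum L.2 = s}

/-- The independent covering family `𝓢(𝓛)`: the independent coverings `S` of order `q(𝓛)` of
bipartite members `L` of `𝓛`, each recorded together with its graph `L`. -/
def indepCoveringFamily (𝓛 : GraphFamily) :
    Set (Σ L : (Σ m : ℕ, SimpleGraph (Fin m)), Finset (Fin L.1)) :=
  {p | p.1 ∈ 𝓛 ∧ p.1.2.IsBipartite ∧ IsIndepCovering p.1.2 p.2 ∧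
    p.2.card = indepCoveringNumber 𝓛}

/-- The least degree in `L` of a vertex of `S`, over all coverings `S` of a graph `L` that
belong to `𝓢(𝓛)`. -/
noncomputable def minCoveringDegree (𝓛 : GraphFamily) : ℕ :=
  sInf {d | ∃ p ∈ indepCoveringFamily 𝓛, ∃ x ∈ p.2, (p.1.2.neighborSet x).ncard = d}

open scoped Classical in
/-- The subgraph covering family `𝓑(𝓛)`: the graphs induced by a covering of order less than
`q(𝓛)` of a member of `𝓛`; if all members have covering number at least `q(𝓛)`, it is
`{K_{q(𝓛)}}` by convention. -/
noncomputable def subgraphCoveringFamily (𝓛 : GraphFamily) : GraphFamily :=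
  if ∀ L ∈ 𝓛, (indepCoveringNumber 𝓛 : ℕ∞) ≤ L.2.vertexCoverNum then
    {⟨indepCoveringNumber 𝓛, ⊤⟩}
  else
    {J | ∃ L ∈ 𝓛, ∃ C : Finset (Fin L.1), L.2.IsVertexCover (C : Set (Fin L.1)) ∧
      C.card < indepCoveringNumber 𝓛 ∧
      Nonempty (J.2 ≃g L.2.induce (C : Set (Fin L.1)))}

/-- For some `s`, the graph `(M ∪ I_s) ∨ I_s` contains a copy of `L`. -/
def IsTwoDecomposing {W V : Type*} (L : SimpleGraph W) (M : SimpleGraph V) : Prop :=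
  ∃ s : ℕ, L ⊑ graphJoin (M ⊕g (⊥ : SimpleGraph (Fin s))) (⊥ : SimpleGraph (Fin s))

/-- The 2-decomposition family `𝓜₂(L)`: the minimal graphs `M` (with respect to taking
subgraphs) such that `(M ∪ I_s) ∨ I_s` contains a copy of `L` for some `s`. -/
def twoDecompositionFamily {W : Type*} (L : SimpleGraph W) : GraphFamily :=
  {M | IsTwoDecomposing L M.2 ∧
    ∀ M' : (Σ m : ℕ, SimpleGraph (Fin m)), M'.2 ⊑ M.2 → IsTwoDecomposing L M'.2 →
      Nonempty (M'.2 ≃g M.2)}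

/-- `f(n, q)`: the number of edges of `I_{q-1} ∨ T₂(n-q+1)`. -/
noncomputable def fNum (n q : ℕ) : ℕ :=
  (graphJoin (⊥ : SimpleGraph (Fin (q - 1))) (turanGraph (n - (q - 1)) 2)).edgeSet.ncard

/-- `𝓕(n, q, k, 𝓛)`: the graphs obtained from `I_{q-1} ∨ T₂(n-q+1)` by putting a member `Q` of
`EX(q-1, 𝓛)` in `I_{q-1}` and a copy of `K_{k,k}` in one class of `T₂(n-q+1)`. In `turanGraph m 2`
the two classes are the vertices of the same parity. -/
def FFamily (n q k : ℕ) (𝓛 : GraphFamily) : Set (SimpleGraph (Fin n)) :=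
  {G | ∃ Q ∈ EXFamily (q - 1) 𝓛, ∃ φ : (Fin k ⊕ Fin k) ↪ Fin (n - (q - 1)),
    (∃ i : ℕ, ∀ x, (φ x).val % 2 = i) ∧
    Nonempty (G ≃g graphJoin Q
      (turanGraph (n - (q - 1)) 2 ⊔ (completeBipartiteGraph (Fin k) (Fin k)).map φ))}

/-- `q̃`, the independent covering number of the 2-decomposition family of `L`. -/
noncomputable def qTilde {W : Type*} (L : SimpleGraph W) : ℕ :=
  indepCoveringNumber (twoDecompositionFamily L)

/-- `𝓑̃`, the subgraph covering family of the 2-decomposition family of `L`. -/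
noncomputable def BTilde {W : Type*} (L : SimpleGraph W) : GraphFamily :=
  subgraphCoveringFamily (twoDecompositionFamily L)

/-- `k`, the least degree of a vertex in a minimum independent covering of a member of the
2-decomposition family of `L`. -/
noncomputable def kParam {W : Type*} (L : SimpleGraph W) : ℕ :=
  minCoveringDegree (twoDecompositionFamily L)

/-! Every edge of `H` becomes an odd cycle, so a copy of the ballooning in a nearly complete
bipartite graph with classes `A`, `B` needs one defect on each cycle: a vertex outside both classes,
or an edge inside a class. A vertex outside the classes can be an old vertex and serve all cycles
through it, or a new vertex and serve one; `qTilde` such vertices suffice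
(`exists_cover_structure`). With one fewer, the cycles left without a defect share a vertex and,
unless there is only one, number at most `k` (`exists_star_structure`): delete a vertex of degree
`k` from a minimum independent covering.

Lower bound: the join of a member of `EXFamily` for `BTilde` with a Turán graph is free
(`free_graphJoin`). Removing one colour class from a copy of the ballooning leaves a graph
containing a member of the decomposition family, and its vertices outside the Turán part form a
covering of order less than `q`.

Upper bound: deleting vertices of low degree (`ncard_le_add`) reduces the problem to graphs in which
all degrees are about half the order or more. A large biclique, averaging and greedy embedding then
split all but boundedly many vertices into two independent sets (`exists_stability`). The number of
edges forces exactly `q - 1` further vertices, each adjacent to all but boundedly many of the others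
in the classes (`nearStructure_aux`), since one more would complete the ballooning
(`isContained_of_extra_hub`). In this `NearStructure`, stars and matchings inside the classes with
at least `k` edges in total would supply the missing defects (`NearStructure.starCond`,
`NearStructure.matchCond`), and the graph on the further vertices is free of `BTilde`
(`NearStructure.familyFree`). The extremal statement `core` turns the first two facts into the bound
`(k - 1) ^ 2` for the number of edges inside the classes minus the number of missing edges between
them, with equality only for a `K_{k-1,k-1}` in one class and no missing edges. Adding up gives the
bound, and equality throughout gives the shape (`NearStructure.ncard_le`).

In the case of equality, whether a member of the family is free depends only on the graph placed in
`I_{q-1}`, as the Turán part is large and symmetric (`isContained_transfer`). If that graph is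
unique, one free member makes all free; if `k = 1`, `free_graphJoin` applies directly. -/

namespace Ballooning

/-! ### Counting neighbours and non-neighbours in a finite set -/

section Degrees

variable {V : Type*} {G : SimpleGraph V}

open scoped Classical in
/-- The number of neighbours of `x` in the finite set `T`. -/
noncomputable def degIn (G : SimpleGraph V) (x : V) (T : Finset V) : ℕ :=
  (T.filter fun y => G.Adj x y).card

open scoped Classical in
/-- The number of vertices of the finite set `T` that are not adjacent to `x`. -/
noncomputable def missIn (G : SimpleGraph V) (x : V) (T : Finset V) : ℕ :=
  (T.filter fun y => ¬ G.Adj x y).card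

lemma degIn_add_missIn (x : V) (T : Finset V) : degIn G x T + missIn G x T = T.card := by
  classical
  unfold degIn missIn
  exact Finset.card_filter_add_card_filter_not _

lemma degIn_mono (x : V) {S T : Finset V} (h : S ⊆ T) : degIn G x S ≤ degIn G x T := by
  classical
  exact Finset.card_le_card (Finset.filter_subset_filter _ h)

lemma missIn_mono (x : V) {S T : Finset V} (h : S ⊆ T) : missIn G x S ≤ missIn G x T := by
  classical
  exact Finset.card_le_card (Finset.filter_subset_filter _ h)

lemma degIn_le_card (x : V) (T : Finset V) : degIn G x T ≤ T.card := by
  classical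
  exact Finset.card_filter_le _ _

lemma missIn_le_card (x : V) (T : Finset V) : missIn G x T ≤ T.card := by
  classical
  exact Finset.card_filter_le _ _

lemma degIn_union [DecidableEq V] (x : V) {S T : Finset V} (h : Disjoint S T) :
    degIn G x (S ∪ T) = degIn G x S + degIn G x T := by
  classical
  unfold degIn
  rw [Finset.filter_union]
  convert Finset.card_union_of_disjoint (Finset.disjoint_filter_filter h)

lemma degIn_union_le [DecidableEq V] (x : V) (S T : Finset V) :
    degIn G x (S ∪ T) ≤ degIn G x S + degIn G x T := by
  classical
  unfold degIn
  rw [Finset.filter_union]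
  convert Finset.card_union_le _ _

lemma missIn_union [DecidableEq V] (x : V) {S T : Finset V} (h : Disjoint S T) :
    missIn G x (S ∪ T) = missIn G x S + missIn G x T := by
  classical
  unfold missIn
  rw [Finset.filter_union]
  convert Finset.card_union_of_disjoint (Finset.disjoint_filter_filter h)

lemma degIn_pos {x y : V} {T : Finset V} (hy : y ∈ T) (h : G.Adj x y) : 0 < degIn G x T := by
  classical
  exact Finset.card_pos.2 ⟨y, by simp [hy, h]⟩

lemma degIn_eq_zero {x : V} {T : Finset V} : degIn G x T = 0 ↔ ∀ y ∈ T, ¬ G.Adj x y := by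
  classical
  simp [degIn, Finset.filter_eq_empty_iff]

lemma missIn_eq_zero {x : V} {T : Finset V} : missIn G x T = 0 ↔ ∀ y ∈ T, G.Adj x y := by
  classical
  simp [missIn, Finset.filter_eq_empty_iff]

lemma sum_degIn_comm (S T : Finset V) :
    ∑ x ∈ S, degIn G x T = ∑ y ∈ T, degIn G y S := by
  classical
  have := Finset.sum_card_bipartiteAbove_eq_sum_card_bipartiteBelow (s := S) (t := T)
    (fun x y => G.Adj x y)
  unfold Finset.bipartiteAbove Finset.bipartiteBelow at this
  unfold degIn
  simp only [G.adj_comm] at this ⊢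
  convert this using 4

lemma sum_missIn_comm (S T : Finset V) :
    ∑ x ∈ S, missIn G x T = ∑ y ∈ T, missIn G y S := by
  classical
  have := Finset.sum_card_bipartiteAbove_eq_sum_card_bipartiteBelow (s := S) (t := T)
    (fun x y => ¬ G.Adj x y)
  unfold Finset.bipartiteAbove Finset.bipartiteBelow at this
  unfold missIn
  convert this using 5
  exact G.adj_comm _ _

/-- Every edge inside `A` meets `T`, so the degrees of the vertices of `T` count it once, or twice
if both ends lie in `T`; the second sum on the left corrects for the latter. -/
lemma sum_degIn_add_sum_of_cover {A T : Finset V} (hT : T ⊆ A)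
    (h : ∀ y ∈ A, ∀ z ∈ A, G.Adj y z → y ∈ T ∨ z ∈ T) :
    ∑ u ∈ A, degIn G u A + ∑ t ∈ T, degIn G t T = 2 * ∑ t ∈ T, degIn G t A := by
  classical
  have h1 : ∑ u ∈ A, degIn G u A = ∑ u ∈ A \ T, degIn G u A + ∑ u ∈ T, degIn G u A :=
    (Finset.sum_sdiff hT).symm
  have h2 : ∑ u ∈ A \ T, degIn G u A = ∑ u ∈ A \ T, degIn G u T := by
    refine Finset.sum_congr rfl fun u hu => ?_
    rw [Finset.mem_sdiff] at hu
    refine le_antisymm (Finset.card_le_card fun z hz => ?_) (degIn_mono u hT)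
    rw [Finset.mem_filter] at hz ⊢
    exact ⟨(h u hu.1 z hz.1 hz.2).resolve_left hu.2, hz.2⟩
  have h3 : ∑ t ∈ T, degIn G t A = ∑ t ∈ T, degIn G t (A \ T) + ∑ t ∈ T, degIn G t T := by
    rw [← Finset.sum_add_distrib]
    refine Finset.sum_congr rfl fun t _ => ?_
    rw [← degIn_union t Finset.sdiff_disjoint, Finset.sdiff_union_of_subset hT]
  have h4 := sum_degIn_comm (G := G) (A \ T) T
  omega

end Degrees

/-! ### Matchings as sets of oriented edges -/

section Matchings

variable {V : Type*} {G : SimpleGraph V}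

/-- `M` is a matching of `G` (a set of disjoint edges, each with an orientation) inside `S`. -/
structure MatchIn (G : SimpleGraph V) (M : Finset (V × V)) (S : Finset V) : Prop where
  adj : ∀ e ∈ M, G.Adj e.1 e.2
  disj : ∀ e ∈ M, ∀ f ∈ M, e ≠ f → e.1 ≠ f.1 ∧ e.1 ≠ f.2 ∧ e.2 ≠ f.1 ∧ e.2 ≠ f.2
  mem : ∀ e ∈ M, e.1 ∈ S ∧ e.2 ∈ S

open scoped Classical in
/-- The vertices covered by a set of oriented edges. -/
noncomputable def msupp (M : Finset (V × V)) : Finset V := M.image Prod.fst ∪ M.image Prod.snd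

lemma mem_msupp {M : Finset (V × V)} {v : V} : v ∈ msupp M ↔ ∃ e ∈ M, v = e.1 ∨ v = e.2 := by
  classical
  simp only [msupp, Finset.mem_union, Finset.mem_image]
  constructor
  · rintro (⟨e, he, rfl⟩ | ⟨e, he, rfl⟩)
    exacts [⟨e, he, .inl rfl⟩, ⟨e, he, .inr rfl⟩]
  · rintro ⟨e, he, rfl | rfl⟩
    exacts [.inl ⟨e, he, rfl⟩, .inr ⟨e, he, rfl⟩]

lemma msupp_card_le (M : Finset (V × V)) : (msupp M).card ≤ 2 * M.card := by
  classical
  have h1 := Finset.card_union_le (M.image Prod.fst) (M.image Prod.snd)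
  have h2 := Finset.card_image_le (s := M) (f := Prod.fst)
  have h3 := Finset.card_image_le (s := M) (f := Prod.snd)
  unfold msupp
  omega

lemma MatchIn.card_msupp {M : Finset (V × V)} {S : Finset V} (h : MatchIn G M S) :
    (msupp M).card = 2 * M.card := by
  classical
  unfold msupp
  rw [Finset.card_union_of_disjoint, Finset.card_image_of_injOn, Finset.card_image_of_injOn]
  · omega
  · intro e he f hf hef
    by_contra hne
    exact (h.disj e he f hf hne).2.2.2 hef
  · intro e he f hf hef
    by_contra hne
    exact (h.disj e he f hf hne).1 hef
  · rw [Finset.disjoint_left]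
    intro v hv hv'
    rw [Finset.mem_image] at hv hv'
    obtain ⟨e, he, rfl⟩ := hv
    obtain ⟨f, hf, hfe⟩ := hv'
    by_cases hne : e = f
    · subst hne; exact (h.adj e he).ne hfe.symm
    · exact (h.disj e he f hf hne).2.1 hfe.symm

lemma MatchIn.msupp_subset {M : Finset (V × V)} {S : Finset V} (h : MatchIn G M S) :
    msupp M ⊆ S := by
  intro v hv
  obtain ⟨e, he, rfl | rfl⟩ := mem_msupp.1 hv
  exacts [(h.mem e he).1, (h.mem e he).2]

lemma MatchIn.subset {M M' : Finset (V × V)} {S : Finset V} (h : MatchIn G M S) (hM : M' ⊆ M) :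
    MatchIn G M' S :=
  ⟨fun e he => h.adj e (hM he), fun e he f hf => h.disj e (hM he) f (hM hf),
    fun e he => h.mem e (hM he)⟩

lemma MatchIn.mono {M : Finset (V × V)} {S T : Finset V} (h : MatchIn G M S) (hS : S ⊆ T) :
    MatchIn G M T :=
  ⟨h.adj, h.disj, fun e he => ⟨hS (h.mem e he).1, hS (h.mem e he).2⟩⟩

lemma matchIn_empty (S : Finset V) : MatchIn G ∅ S := ⟨by simp, by simp, by simp⟩

lemma MatchIn.insert [DecidableEq V] {M : Finset (V × V)} {S : Finset V} (h : MatchIn G M S)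
    {y z : V}
    (hy : y ∈ S) (hz : z ∈ S) (hyz : G.Adj y z) (hy' : y ∉ msupp M) (hz' : z ∉ msupp M) :
    MatchIn G (insert (y, z) M) S ∧ (insert (y, z) M).card = M.card + 1 := by
  have hy2 : ∀ e ∈ M, y ≠ e.1 ∧ y ≠ e.2 := fun e he =>
    ⟨fun h => hy' (mem_msupp.2 ⟨e, he, .inl h⟩), fun h => hy' (mem_msupp.2 ⟨e, he, .inr h⟩)⟩
  have hz2 : ∀ e ∈ M, z ≠ e.1 ∧ z ≠ e.2 := fun e he =>
    ⟨fun h => hz' (mem_msupp.2 ⟨e, he, .inl h⟩), fun h => hz' (mem_msupp.2 ⟨e, he, .inr h⟩)⟩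
  refine ⟨⟨?_, ?_, ?_⟩, ?_⟩
  · intro e he
    rcases Finset.mem_insert.1 he with rfl | he
    exacts [hyz, h.adj e he]
  · intro e he f hf hef
    rcases Finset.mem_insert.1 he with rfl | he <;> rcases Finset.mem_insert.1 hf with rfl | hf
    · exact absurd rfl hef
    · exact ⟨(hy2 f hf).1, (hy2 f hf).2, (hz2 f hf).1, (hz2 f hf).2⟩
    · exact ⟨(hy2 e he).1.symm, (hz2 e he).1.symm, (hy2 e he).2.symm, (hz2 e he).2.symm⟩
    · exact h.disj e he f hf hef
  · intro e he
    rcases Finset.mem_insert.1 he with rfl | he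
    exacts [⟨hy, hz⟩, h.mem e he]
  · rw [Finset.card_insert_of_notMem]
    intro hM
    exact (hy2 _ hM).1 rfl

lemma exists_max_matchIn (G : SimpleGraph V) (S : Finset V) :
    ∃ M, MatchIn G M S ∧ (∀ M', MatchIn G M' S → M'.card ≤ M.card) ∧
      ∀ y ∈ S, ∀ z ∈ S, G.Adj y z → y ∈ msupp M ∨ z ∈ msupp M := by
  classical
  have hsub : ∀ M, MatchIn G M S → M ∈ (S ×ˢ S).powerset := fun M hM => by
    rw [Finset.mem_powerset]
    intro e he
    exact Finset.mem_product.2 (hM.mem e he)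
  obtain ⟨M, hM, hmax⟩ := Finset.exists_max_image ((S ×ˢ S).powerset.filter fun M => MatchIn G M S)
    Finset.card ⟨∅, by simp [matchIn_empty]⟩
  rw [Finset.mem_filter] at hM
  have hmax' : ∀ M', MatchIn G M' S → M'.card ≤ M.card := fun M' hM' =>
    hmax M' (Finset.mem_filter.2 ⟨hsub M' hM', hM'⟩)
  refine ⟨M, hM.2, hmax', fun y hy z hz hyz => ?_⟩
  by_contra! hcon
  obtain ⟨h1, h2⟩ := hM.2.insert hy hz hyz hcon.1 hcon.2
  have := hmax' _ h1
  omega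

/-- A set without a matching of size `h` becomes independent after removing `2 h` vertices. -/
lemma exists_indep_of_no_matching {S : Finset V} {h : ℕ}
    (hS : ∀ M, MatchIn G M S → M.card < h) :
    ∃ S' ⊆ S, (∀ y ∈ S', ∀ z ∈ S', ¬ G.Adj y z) ∧ S.card ≤ S'.card + 2 * h := by
  classical
  obtain ⟨M, hM, -, hcov⟩ := exists_max_matchIn G S
  refine ⟨S \ msupp M, Finset.sdiff_subset, fun y hy z hz hyz => ?_, ?_⟩
  · rw [Finset.mem_sdiff] at hy hz
    rcases hcov y hy.1 z hz.1 hyz with h | h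
    exacts [hy.2 h, hz.2 h]
  · have h1 := Finset.le_card_sdiff (msupp M) S
    have h2 := msupp_card_le M
    have h3 := hS M hM
    omega

end Matchings

/-! ### Edge bounds from stars and matchings -/

section StarBound

variable {V : Type*} {G : SimpleGraph V}

/-- The neighbours of `v` in `A`. -/
noncomputable def nbrIn (G : SimpleGraph V) (v : V) (A : Finset V) : Finset V := by
  classical exact A.filter fun y => G.Adj v y

lemma mem_nbrIn {v y : V} {A : Finset V} : y ∈ nbrIn G v A ↔ y ∈ A ∧ G.Adj v y := by
  classical
  simp [nbrIn]

lemma card_nbrIn (v : V) (A : Finset V) : (nbrIn G v A).card = degIn G v A := rfl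

open scoped Classical in
/-- The vertices of `A` different from `v` and not adjacent to it. -/
noncomputable def farIn (G : SimpleGraph V) (v : V) (A : Finset V) : Finset V :=
  A.filter fun y => y ≠ v ∧ ¬ G.Adj v y

lemma mem_farIn {v y : V} {A : Finset V} :
    y ∈ farIn G v A ↔ y ∈ A ∧ y ≠ v ∧ ¬ G.Adj v y := by
  classical
  simp [farIn]

/-- An edge that avoids the neighbourhood of `v` cannot contain `v` either, so it lies in `farIn G v
A`, where the vertices of a maximum matching cover it. -/
lemma exists_star_cover {A : Finset V} {v : V} :
    ∃ M, MatchIn G M (farIn G v A) ∧ ∃ T ⊆ A, nbrIn G v A ⊆ T ∧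
      T.card ≤ degIn G v A + 2 * M.card ∧ (M = ∅ → T = nbrIn G v A) ∧
      ∀ y ∈ A, ∀ z ∈ A, G.Adj y z → y ∈ T ∨ z ∈ T := by
  classical
  obtain ⟨M, hM, -, hcov⟩ := exists_max_matchIn G (farIn G v A)
  refine ⟨M, hM, nbrIn G v A ∪ msupp M, ?_, Finset.subset_union_left, ?_, ?_, ?_⟩
  · refine Finset.union_subset (fun y hy => (mem_nbrIn.1 hy).1) ?_
    exact hM.msupp_subset.trans fun y hy => (mem_farIn.1 hy).1
  · have h1 := Finset.card_union_le (nbrIn G v A) (msupp M)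
    have h2 := msupp_card_le M
    rw [card_nbrIn] at h1
    omega
  · rintro rfl
    simp [msupp]
  · intro y hy z hz hyz
    by_cases h1 : y ∈ nbrIn G v A
    · exact .inl (Finset.mem_union_left _ h1)
    by_cases h2 : z ∈ nbrIn G v A
    · exact .inr (Finset.mem_union_left _ h2)
    rw [mem_nbrIn] at h1 h2
    have hyv : y ≠ v := by rintro rfl; exact h2 ⟨hz, hyz⟩
    have hzv : z ≠ v := by rintro rfl; exact h1 ⟨hy, hyz.symm⟩
    rcases hcov y (mem_farIn.2 ⟨hy, hyv, fun h => h1 ⟨hy, h⟩⟩) z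
      (mem_farIn.2 ⟨hz, hzv, fun h => h2 ⟨hz, h⟩⟩) hyz with h | h
    exacts [.inl (Finset.mem_union_right _ h), .inr (Finset.mem_union_right _ h)]

/-- Let `v` maximise `P = degree - x`. The cover of `exists_star_cover` at `v` has order at most `2
* M - P`, and each of its vertices `t` has degree at most `P + x t`. It therefore meets at most `(2
* M - P) * P + ∑ x ≤ M ^ 2 + ∑ x` edges. -/
theorem sum_degIn_le_of_star {A : Finset V} {x : V → ℕ} {M : ℕ}
    (h : ∀ u ∈ A, ∀ Mt, MatchIn G Mt (farIn G u A) →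
      2 * degIn G u A + 2 * Mt.card ≤ 2 * M + x u) :
    ∑ u ∈ A, degIn G u A ≤ 2 * M ^ 2 + 2 * ∑ u ∈ A, x u := by
  classical
  rcases A.eq_empty_or_nonempty with rfl | hA
  · simp
  obtain ⟨v, hv, hmax⟩ := Finset.exists_max_image A (fun u => (degIn G u A : ℤ) - x u) hA
  set P : ℤ := (degIn G v A : ℤ) - x v with hP
  obtain ⟨Mt, hMt, T, hTA, -, hTcard, -, hcov⟩ := exists_star_cover (G := G) (A := A) (v := v)
  have hkey := h v hv Mt hMt
  by_cases hP0 : P ≤ 0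
  · have : ∑ u ∈ A, degIn G u A ≤ ∑ u ∈ A, x u := by
      refine Finset.sum_le_sum fun u hu => ?_
      have := hmax u hu
      omega
    omega
  push Not at hP0
  have h1 := sum_degIn_add_sum_of_cover hTA hcov
  have h2 : (∑ t ∈ T, degIn G t A : ℤ) ≤ T.card * P + ∑ u ∈ A, (x u : ℤ) := by
    calc (∑ t ∈ T, degIn G t A : ℤ) ≤ ∑ t ∈ T, (P + x t) :=
          Finset.sum_le_sum fun t ht => by have := hmax t (hTA ht); omega
      _ = T.card * P + ∑ t ∈ T, (x t : ℤ) := by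
          rw [Finset.sum_add_distrib, Finset.sum_const, nsmul_eq_mul]
      _ ≤ _ := by
          gcongr
  have h3 : (T.card : ℤ) ≤ 2 * M - P := by omega
  have h4 : (T.card : ℤ) * P ≤ (2 * M - P) * P := mul_le_mul_of_nonneg_right h3 hP0.le
  have h5 : (2 * M - P) * P ≤ (M : ℤ) ^ 2 := by nlinarith [sq_nonneg ((M : ℤ) - P)]
  zify
  zify at h1
  have h6 : (0 : ℤ) ≤ ∑ t ∈ T, (degIn G t T : ℤ) := Finset.sum_nonneg fun _ _ => by positivity
  linarith

/-- The equality case of `sum_degIn_le_of_star` without missing edges: a complete bipartite graph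
and isolated vertices. -/
theorem exists_complete_of_star_eq {A : Finset V} {m : ℕ}
    (h : ∀ u ∈ A, ∀ Mt, MatchIn G Mt (farIn G u A) → degIn G u A + Mt.card ≤ m)
    (heq : 2 * m ^ 2 ≤ ∑ u ∈ A, degIn G u A) :
    ∃ S T : Finset V, S ⊆ A ∧ T ⊆ A ∧ Disjoint S T ∧ S.card = m ∧ T.card = m ∧
      ∀ y ∈ A, ∀ z ∈ A, G.Adj y z ↔ (y ∈ S ∧ z ∈ T) ∨ (y ∈ T ∧ z ∈ S) := by
  classical
  rcases Nat.eq_zero_or_pos m with rfl | hm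
  · refine ⟨∅, ∅, by simp, by simp, by simp, rfl, rfl, fun y hy z hz => ?_⟩
    have h1 := h y hy ∅ (matchIn_empty _)
    have h2 : degIn G y A = 0 := by omega
    simpa using degIn_eq_zero.1 h2 z hz
  have hdeg : ∀ u ∈ A, degIn G u A ≤ m := fun u hu => by
    simpa using h u hu ∅ (matchIn_empty _)
  have hA : A.Nonempty := by
    rw [Finset.nonempty_iff_ne_empty]
    rintro rfl
    simp at heq
    omega
  obtain ⟨v₀, hv₀, hmax⟩ := Finset.exists_max_image A (fun u => degIn G u A) hA
  -- For a vertex of maximum degree `d = m - r`, the cover gives `m ^ 2 ≤ (d + 2 * r) * d = m ^ 2 -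
  -- r ^ 2`. So `r = 0`, the matching is empty, and the neighbourhood is an independent covering by
  -- vertices of degree `m`.
  have hkey : ∀ v ∈ A, degIn G v A = degIn G v₀ A → degIn G v A = m ∧
      (∀ y ∈ A, ∀ z ∈ A, G.Adj y z → y ∈ nbrIn G v A ∨ z ∈ nbrIn G v A) ∧
      (∀ t ∈ nbrIn G v A, degIn G t A = m) ∧
      (∀ t ∈ nbrIn G v A, ∀ t' ∈ nbrIn G v A, ¬ G.Adj t t') := by
    intro v hv hvv
    obtain ⟨Mt, hMt, T, hTA, -, hTcard, hT0, hcov⟩ := exists_star_cover (G := G) (A := A) (v := v)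
    have hk := h v hv Mt hMt
    have h1 := sum_degIn_add_sum_of_cover hTA hcov
    have hle : ∑ t ∈ T, degIn G t A ≤ T.card * degIn G v A := by
      rw [← smul_eq_mul]
      exact Finset.sum_le_card_nsmul _ _ _ fun t ht => hvv ▸ hmax t (hTA ht)
    have h2 : m ^ 2 ≤ T.card * degIn G v A := by omega
    obtain ⟨r, hr⟩ : ∃ r, m = degIn G v A + r := ⟨m - degIn G v A, by have := hdeg v hv; omega⟩
    have h3 : T.card * degIn G v A ≤ (degIn G v A + 2 * r) * degIn G v A :=
      Nat.mul_le_mul_right _ (by omega)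
    have hr0 : r = 0 := by
      rw [hr] at h2
      nlinarith
    have hdm : degIn G v A = m := by omega
    have hMt0 : Mt = ∅ := by rw [← Finset.card_eq_zero]; omega
    have hTN := hT0 hMt0
    subst hTN
    have hcard : (nbrIn G v A).card = m := by rw [card_nbrIn, hdm]
    have hsum : ∑ t ∈ nbrIn G v A, degIn G t A ≤ m * m := by
      rw [hcard, hdm] at hle
      exact hle
    have hz : ∑ t ∈ nbrIn G v A, degIn G t (nbrIn G v A) = 0 := by
      rw [pow_two] at heq
      omega
    have hs : ∑ t ∈ nbrIn G v A, degIn G t A = ∑ t ∈ nbrIn G v A, m := by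
      rw [Finset.sum_const, hcard, smul_eq_mul]
      rw [pow_two] at heq
      omega
    refine ⟨hdm, hcov, ?_, ?_⟩
    · exact (Finset.sum_eq_sum_iff_of_le fun t ht => hdeg t (hTA ht)).1 hs
    · intro t ht t' ht'
      exact degIn_eq_zero.1 (Finset.sum_eq_zero_iff.1 hz t ht) t' ht'
  obtain ⟨hd0, hc0, hn0, hi0⟩ := hkey v₀ hv₀ rfl
  obtain ⟨t, ht⟩ : (nbrIn G v₀ A).Nonempty := by
    rw [← Finset.card_pos, card_nbrIn]; omega
  have htA := (mem_nbrIn.1 ht).1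
  obtain ⟨hd1, hc1, hn1, hi1⟩ := hkey t htA (by rw [hn0 t ht, hd0])
  have hdisj : Disjoint (nbrIn G v₀ A) (nbrIn G t A) := by
    rw [Finset.disjoint_left]
    intro y hy hy'
    exact hi0 t ht y hy (mem_nbrIn.1 hy').2
  -- The edges at `a` are covered by the neighbourhood of `t`, which does not contain `a`; both
  -- neighbourhoods have `m` elements.
  have hsub : ∀ a ∈ nbrIn G v₀ A, nbrIn G a A = nbrIn G t A := by
    intro a ha
    refine Finset.eq_of_subset_of_card_le (fun b hb => ?_) ?_
    · have hb' := mem_nbrIn.1 hb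
      exact (hc1 a (mem_nbrIn.1 ha).1 b hb'.1 hb'.2).resolve_left
        (Finset.disjoint_left.1 hdisj ha)
    · rw [card_nbrIn, card_nbrIn, hd1, hn0 a ha]
  refine ⟨nbrIn G v₀ A, nbrIn G t A, fun y hy => (mem_nbrIn.1 hy).1,
    fun y hy => (mem_nbrIn.1 hy).1, hdisj, by rw [card_nbrIn, hd0], by rw [card_nbrIn, hd1], ?_⟩
  intro y hy z hz
  constructor
  · intro hyz
    rcases hc0 y hy z hz hyz with h | h
    · exact .inl ⟨h, hsub y h ▸ mem_nbrIn.2 ⟨hz, hyz⟩⟩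
    · exact .inr ⟨hsub z h ▸ mem_nbrIn.2 ⟨hy, hyz.symm⟩, h⟩
  · rintro (⟨h1, h2⟩ | ⟨h1, h2⟩)
    · rw [← hsub y h1] at h2
      exact (mem_nbrIn.1 h2).2
    · rw [← hsub z h2] at h1
      exact (mem_nbrIn.1 h1).2.symm

/-- Induction on `b`: delete both ends of an edge `yz` with `y` of degree at most `2 * (b + 1)`.
This lowers the matching number and removes at most `D + 2 * (b + 1) - 1` edges, which is the
increment of `b * (D + b)`. Such an edge exists because a vertex missed by a maximum matching has
all its neighbours covered by it; if no missed vertex has a neighbour, all edges lie within the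
covered vertices. -/
theorem sum_degIn_le_of_matching {D : ℕ} (b : ℕ) : ∀ B : Finset V,
    (∀ u ∈ B, degIn G u B ≤ D) → (∀ M, MatchIn G M B → M.card ≤ b) →
      ∑ u ∈ B, degIn G u B ≤ 2 * (b * (D + b)) := by
  classical
  induction b with
  | zero =>
    intro B _ hM
    obtain ⟨M, hM1, -, hcov⟩ := exists_max_matchIn G B
    have : M = ∅ := by rw [← Finset.card_eq_zero]; have := hM M hM1; omega
    subst this
    rw [zero_mul, mul_zero, Nat.le_zero, Finset.sum_eq_zero_iff]
    intro u hu
    rw [degIn_eq_zero]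
    intro y hy huy
    simpa [msupp] using hcov u hu y hy huy
  | succ b ih =>
    intro B hD hM
    by_cases hE : ∃ y ∈ B, ∃ z ∈ B, G.Adj y z
    swap
    · push Not at hE
      rw [Finset.sum_eq_zero fun u hu => degIn_eq_zero.2 (hE u hu)]
      exact Nat.zero_le _
    obtain ⟨y, hy, z, hz, hyz, hdy⟩ : ∃ y ∈ B, ∃ z ∈ B, G.Adj y z ∧
        degIn G y B ≤ 2 * (b + 1) := by
      obtain ⟨M, hM1, -, hcov⟩ := exists_max_matchIn G B
      have hc := hM M hM1
      have hs := msupp_card_le M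
      obtain ⟨y, hy, z, hz, hyz⟩ := hE
      by_cases hex : ∃ y ∈ B \ msupp M, ∃ z ∈ B, G.Adj y z
      · obtain ⟨y, hy, z, hz, hyz⟩ := hex
        rw [Finset.mem_sdiff] at hy
        refine ⟨y, hy.1, z, hz, hyz, ?_⟩
        have : degIn G y B ≤ (msupp M).card := by
          refine Finset.card_le_card fun w hw => ?_
          rw [Finset.mem_filter] at hw
          exact (hcov y hy.1 w hw.1 hw.2).resolve_left hy.2
        omega
      · push Not at hex
        refine ⟨y, hy, z, hz, hyz, ?_⟩
        have : degIn G y B ≤ (msupp M).card := by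
          refine Finset.card_le_card fun w hw => ?_
          rw [Finset.mem_filter] at hw
          by_contra hwM
          exact hex w (Finset.mem_sdiff.2 ⟨hw.1, hwM⟩) y hy hw.2.symm
        omega
    have hyz' := hyz.ne
    set T : Finset V := {y, z} with hT
    have hTB : T ⊆ B := by
      intro w hw
      rw [hT, Finset.mem_insert, Finset.mem_singleton] at hw
      rcases hw with rfl | rfl <;> assumption
    have hIH := ih (B \ T) (fun u hu => (degIn_mono u Finset.sdiff_subset).trans
      (hD u (Finset.mem_sdiff.1 hu).1)) fun M hM1 => by
        have hns : ∀ w ∈ T, w ∉ msupp M := fun w hw hw' =>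
          (Finset.mem_sdiff.1 (hM1.msupp_subset hw')).2 hw
        obtain ⟨h1, h2⟩ := (hM1.mono Finset.sdiff_subset).insert hy hz hyz
          (hns y (by simp [hT])) (hns z (by simp [hT]))
        have := hM _ h1
        omega
    have e1 : ∑ u ∈ B, degIn G u B = ∑ u ∈ B \ T, degIn G u B + ∑ u ∈ T, degIn G u B :=
      (Finset.sum_sdiff hTB).symm
    have e2 : ∀ u, degIn G u B = degIn G u (B \ T) + degIn G u T := fun u => by
      rw [← degIn_union u Finset.sdiff_disjoint, Finset.sdiff_union_of_subset hTB]
    have e3 : ∑ u ∈ B \ T, degIn G u B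
        = ∑ u ∈ B \ T, degIn G u (B \ T) + ∑ u ∈ T, degIn G u (B \ T) := by
      rw [sum_degIn_comm T, ← Finset.sum_add_distrib]
      exact Finset.sum_congr rfl fun u _ => e2 u
    have e4 : ∀ f : V → ℕ, ∑ u ∈ T, f u = f y + f z := fun f => by
      rw [hT, Finset.sum_pair hyz']
    rw [e4] at e1 e3
    have hyT : 0 < degIn G y T := degIn_pos (by simp [hT]) hyz
    have hzT : 0 < degIn G z T := degIn_pos (by simp [hT]) hyz.symm
    have := e2 y
    have := e2 z
    have := hD z hz
    nlinarith

end StarBound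

end Ballooning

namespace Ballooning

/-! ### The extremal problem inside the two classes -/

section Core

variable {V : Type*} {G : SimpleGraph V}

/-- A star in `A` with a disjoint matching in `A` and a matching in `B` whose edges touch the
neighbourhood of the centre have at most `m` edges altogether. -/
def StarCond (G : SimpleGraph V) (m : ℕ) (A B : Finset V) : Prop :=
  ∀ v ∈ A, ∀ M₁ M₂, MatchIn G M₁ (farIn G v A) → MatchIn G M₂ B →
    (∀ e ∈ M₂, G.Adj v e.1 ∨ G.Adj v e.2) → degIn G v A + M₁.card + M₂.card ≤ m

/-- Two matchings, in `A` and in `B`, have at most `m` edges together. -/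
def MatchCond (G : SimpleGraph V) (m : ℕ) (A B : Finset V) : Prop :=
  ∀ M₁ M₂, MatchIn G M₁ A → MatchIn G M₂ B → M₁.card + M₂.card ≤ m

/-- The graph induced on `A` is a `K_{m,m}` and isolated vertices. -/
def IsBalancedBiclique (G : SimpleGraph V) (m : ℕ) (A : Finset V) : Prop :=
  ∃ S T : Finset V, S ⊆ A ∧ T ⊆ A ∧ Disjoint S T ∧ S.card = m ∧ T.card = m ∧
    ∀ y ∈ A, ∀ z ∈ A, G.Adj y z ↔ (y ∈ S ∧ z ∈ T) ∨ (y ∈ T ∧ z ∈ S)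

lemma MatchCond.symm {m : ℕ} {A B : Finset V} (h : MatchCond G m A B) : MatchCond G m B A :=
  fun M₁ M₂ h₁ h₂ => by have := h M₂ M₁ h₂ h₁; omega

/-- The edges of `MB` that touch the neighbourhood of `u` are allowed in `StarCond`; each of the
others accounts for two vertices of `B` missed by `u`. -/
lemma two_mul_card_matching_le {A B : Finset V} {m : ℕ} {MB : Finset (V × V)}
    (hs : StarCond G m A B) (hMB : MatchIn G MB B) {u : V} (hu : u ∈ A) {Mt : Finset (V × V)}
    (hMt : MatchIn G Mt (farIn G u A)) :
    2 * degIn G u A + 2 * Mt.card + 2 * MB.card ≤ 2 * m + missIn G u B := by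
  classical
  have h1 := hs u hu Mt (MB.filter fun e => G.Adj u e.1 ∨ G.Adj u e.2) hMt
    (hMB.subset (Finset.filter_subset _ _)) fun e he => (Finset.mem_filter.1 he).2
  have h2 := Finset.card_filter_add_card_filter_not (s := MB)
    (fun e => G.Adj u e.1 ∨ G.Adj u e.2)
  have h3 := (hMB.subset (Finset.filter_subset
    (fun e => ¬ (G.Adj u e.1 ∨ G.Adj u e.2)) MB)).card_msupp
  have h4 : (msupp (MB.filter fun e => ¬ (G.Adj u e.1 ∨ G.Adj u e.2))).card ≤ missIn G u B := by
    refine Finset.card_le_card fun w hw => ?_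
    obtain ⟨e, he, hwe⟩ := mem_msupp.1 hw
    rw [Finset.mem_filter] at he ⊢
    push Not at he
    rcases hwe with rfl | rfl
    exacts [⟨(hMB.mem e he.1).1, he.2.1⟩, ⟨(hMB.mem e he.1).2, he.2.2⟩]
  omega

/-- The saving `2 * MA.card` comes from the matching edges themselves, which have both ends in the
cover and are counted twice there. It makes the balanced case of `core_of_le` strict. -/
lemma sum_degIn_le_of_cover_matching {A : Finset V} {x : V → ℕ} {c : ℕ} {MA : Finset (V × V)}
    (hMA : MatchIn G MA A)
    (hcov : ∀ y ∈ A, ∀ z ∈ A, G.Adj y z → y ∈ msupp MA ∨ z ∈ msupp MA)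
    (h : ∀ u ∈ A, 2 * degIn G u A ≤ 2 * c + x u) :
    ∑ u ∈ A, degIn G u A + 2 * MA.card ≤ 4 * MA.card * c + ∑ u ∈ A, x u := by
  classical
  have h1 := sum_degIn_add_sum_of_cover hMA.msupp_subset hcov
  have h2 : (msupp MA).card ≤ ∑ t ∈ msupp MA, degIn G t (msupp MA) := by
    rw [Finset.card_eq_sum_ones]
    refine Finset.sum_le_sum fun t ht => ?_
    obtain ⟨e, he, rfl | rfl⟩ := mem_msupp.1 ht
    · exact degIn_pos (mem_msupp.2 ⟨e, he, .inr rfl⟩) (hMA.adj e he)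
    · exact degIn_pos (mem_msupp.2 ⟨e, he, .inl rfl⟩) (hMA.adj e he).symm
  have h3 : 2 * ∑ t ∈ msupp MA, degIn G t A ≤ (msupp MA).card * (2 * c) + ∑ u ∈ A, x u := by
    calc 2 * ∑ t ∈ msupp MA, degIn G t A = ∑ t ∈ msupp MA, 2 * degIn G t A := by
          rw [Finset.mul_sum]
      _ ≤ ∑ t ∈ msupp MA, (2 * c + x t) :=
          Finset.sum_le_sum fun t ht => h t (hMA.msupp_subset ht)
      _ = (msupp MA).card * (2 * c) + ∑ t ∈ msupp MA, x t := by
          rw [Finset.sum_add_distrib, Finset.sum_const, smul_eq_mul]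
      _ ≤ _ := Nat.add_le_add_left (Finset.sum_le_sum_of_subset hMA.msupp_subset) _
  rw [hMA.card_msupp] at h2 h3
  have h4 : 2 * MA.card * (2 * c) = 4 * MA.card * c := by ring
  omega

/-- Let `b = MB.card`. If `b = 0`, the star bound and its equality case for `A` settle everything.
If `0 < 2 * b < m`, the matching `MB` lowers the star bound in `A` to `(m - b) ^ 2`, while `B` has
at most `b * (m + b)` edges, and `(m - b) ^ 2 + b * (m + b) < m ^ 2`. Otherwise both matchings have
exactly `m / 2` edges, and covering each side by its matching gives a strict inequality. -/
lemma core_of_le {A B : Finset V} {m : ℕ} (hA : StarCond G m A B) (hB : StarCond G m B A)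
    (hM : MatchCond G m A B) {MA MB : Finset (V × V)} (hMA : MatchIn G MA A)
    (hMB : MatchIn G MB B) (hMBmax : ∀ M, MatchIn G M B → M.card ≤ MB.card)
    (hcovA : ∀ y ∈ A, ∀ z ∈ A, G.Adj y z → y ∈ msupp MA ∨ z ∈ msupp MA)
    (hcovB : ∀ y ∈ B, ∀ z ∈ B, G.Adj y z → y ∈ msupp MB ∨ z ∈ msupp MB)
    (hle : MB.card ≤ MA.card) :
    ∑ u ∈ A, degIn G u A + ∑ u ∈ B, degIn G u B ≤ 2 * ∑ u ∈ A, missIn G u B + 2 * m ^ 2 ∧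
    (2 * ∑ u ∈ A, missIn G u B + 2 * m ^ 2 ≤ ∑ u ∈ A, degIn G u A + ∑ u ∈ B, degIn G u B →
      ∑ u ∈ A, missIn G u B = 0 ∧ (∀ y ∈ B, ∀ z ∈ B, ¬ G.Adj y z) ∧
        IsBalancedBiclique G m A) := by
  classical
  have hab := hM MA MB hMA hMB
  rcases Nat.eq_zero_or_pos MB.card with h0 | hpos
  · have hMB0 : MB = ∅ := Finset.card_eq_zero.1 h0
    have hBe : ∀ y ∈ B, ∀ z ∈ B, ¬ G.Adj y z := fun y hy z hz hyz => by
      have := hcovB y hy z hz hyz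
      simp [hMB0, msupp] at this
    have hB0 : ∑ u ∈ B, degIn G u B = 0 :=
      Finset.sum_eq_zero fun u hu => degIn_eq_zero.2 (hBe u hu)
    have hstar : ∀ u ∈ A, ∀ Mt, MatchIn G Mt (farIn G u A) → degIn G u A + Mt.card ≤ m :=
      fun u hu Mt hMt => by simpa using hA u hu Mt ∅ hMt (matchIn_empty _) (by simp)
    have h1 : ∑ u ∈ A, degIn G u A ≤ 2 * m ^ 2 + 2 * ∑ u ∈ A, 0 :=
      sum_degIn_le_of_star (x := fun _ => 0) fun u hu Mt hMt => by
        have := hstar u hu Mt hMt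
        omega
    rw [Finset.sum_const_zero] at h1
    refine ⟨by omega, fun heq => ⟨by omega, hBe, ?_⟩⟩
    exact exists_complete_of_star_eq hstar (by omega)
  · have hcommon : ∑ u ∈ A, missIn G u B = ∑ u ∈ B, missIn G u A := sum_missIn_comm A B
    by_cases hlt : 2 * MB.card < m
    · have h1 : ∑ u ∈ A, degIn G u A
          ≤ 2 * (m - MB.card) ^ 2 + 2 * ∑ u ∈ A, missIn G u B :=
        sum_degIn_le_of_star fun u hu Mt hMt => by
          have := two_mul_card_matching_le hA hMB hu hMt
          omega
      have h2 : ∑ u ∈ B, degIn G u B ≤ 2 * (MB.card * (m + MB.card)) :=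
        sum_degIn_le_of_matching _ B (fun u hu => by
          simpa using hB u hu ∅ ∅ (matchIn_empty _) (matchIn_empty _) (by simp)) hMBmax
      obtain ⟨r, hr⟩ : ∃ r, m = MB.card + r := ⟨m - MB.card, by omega⟩
      have h3 : m - MB.card = r := by omega
      rw [h3] at h1
      have h4 : r ^ 2 + MB.card * (m + MB.card) < m ^ 2 := by
        rw [hr]
        nlinarith
      exact ⟨by omega, fun h => by omega⟩
    · have hbm : m = 2 * MB.card := by omega
      have ham : MA.card = MB.card := by omega
      have h1 := sum_degIn_le_of_cover_matching (x := fun u => missIn G u B) (c := MB.card)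
        hMA hcovA fun u hu => by
          have := two_mul_card_matching_le hA hMB hu (matchIn_empty _)
          simp only [Finset.card_empty] at this
          omega
      have h2 := sum_degIn_le_of_cover_matching (x := fun u => missIn G u A) (c := MB.card)
        hMB hcovB fun u hu => by
          have := two_mul_card_matching_le hB hMA hu (matchIn_empty _)
          simp only [Finset.card_empty] at this
          omega
      rw [ham] at h1
      have h4 : 2 * m ^ 2 = 4 * MB.card * MB.card + 4 * MB.card * MB.card := by
        rw [hbm]; ring
      exact ⟨by omega, fun h => by omega⟩

theorem core {A B : Finset V} {m : ℕ} (hA : StarCond G m A B) (hB : StarCond G m B A)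
    (hM : MatchCond G m A B) :
    ∑ u ∈ A, degIn G u A + ∑ u ∈ B, degIn G u B ≤ 2 * ∑ u ∈ A, missIn G u B + 2 * m ^ 2 ∧
    (2 * ∑ u ∈ A, missIn G u B + 2 * m ^ 2 ≤ ∑ u ∈ A, degIn G u A + ∑ u ∈ B, degIn G u B →
      ∑ u ∈ A, missIn G u B = 0 ∧
        (((∀ y ∈ B, ∀ z ∈ B, ¬ G.Adj y z) ∧ IsBalancedBiclique G m A) ∨
          ((∀ y ∈ A, ∀ z ∈ A, ¬ G.Adj y z) ∧ IsBalancedBiclique G m B))) := by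
  obtain ⟨MA, hMA, hmaxA, hcovA⟩ := exists_max_matchIn G A
  obtain ⟨MB, hMB, hmaxB, hcovB⟩ := exists_max_matchIn G B
  rcases le_total MB.card MA.card with hle | hle
  · obtain ⟨h1, h2⟩ := core_of_le hA hB hM hMA hMB hmaxB hcovA hcovB hle
    exact ⟨h1, fun h => ⟨(h2 h).1, .inl (h2 h).2⟩⟩
  · obtain ⟨h1, h2⟩ := core_of_le hB hA hM.symm hMB hMA hmaxA hcovB hcovA hle
    rw [sum_missIn_comm B A, add_comm (∑ u ∈ B, degIn G u B)] at h1 h2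
    exact ⟨h1, fun h => ⟨(h2 h).1, .inr (h2 h).2⟩⟩

end Core

/-! ### Greedy embedding with prescribed images and candidate lists -/

section Greedy

variable {T V : Type*}

/-- The condition on an ordered pair `a, b` of related vertices of a graph that is being embedded
greedily into `G`: `f` is the partial embedding, `c` the colouring and `Y` the list of candidates
of the vertices that have no image yet. -/
def PairOK (G : SimpleGraph V) (C : ℕ) (f : T → Option V) (c : T → Bool) (Y : T → Finset V)
    (a b : T) : Prop :=
  (∀ u v, f a = some u → f b = some v → G.Adj u v) ∧
  (f a = none → f b = none → c a ≠ c b) ∧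
  (∀ u, f a = some u → f b = none → missIn G u (Y b) ≤ C) ∧
  (∀ v, f a = none → f b = some v → missIn G v (Y a) ≤ C)

lemma PairOK.symm {G : SimpleGraph V} {C : ℕ} {f : T → Option V} {c : T → Bool}
    {Y : T → Finset V} {a b : T} (h : PairOK G C f c Y a b) : PairOK G C f c Y b a :=
  ⟨fun u v hu hv => (h.1 v u hv hu).symm, fun hb ha => (h.2.1 ha hb).symm,
    fun u hb ha => h.2.2.2 u ha hb, fun v hb ha => h.2.2.1 v ha hb⟩

/-- Greedy embedding into a graph with two almost completely joined classes `X true`,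
`X false`. -/
theorem isContained_of_greedy [Fintype T] (L : SimpleGraph T) (G : SimpleGraph V) (X : Bool → Finset V)
    (C : ℕ) (hX : ∀ b, ∀ v ∈ X b, missIn G v (X (!b)) ≤ C) (c : T → Bool) (Y : T → Finset V)
    (f : T → Option V) (hinj : ∀ a b v, f a = some v → f b = some v → a = b)
    (hY : ∀ z, f z = none → Y z ⊆ X (c z))
    (hcard : ∀ z, f z = none → (C + 1) * Fintype.card T ≤ (Y z).card)
    (hpair : ∀ a b, L.Adj a b → PairOK G C f c Y a b) : L ⊑ G := by
  classical
  induction hk : (Finset.univ.filter fun z => f z = none).card generalizing f with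
  | zero =>
    have hsome : ∀ z, ∃ v, f z = some v := fun z => by
      rw [← Option.ne_none_iff_exists']
      intro hz
      rw [Finset.card_eq_zero] at hk
      have : z ∈ (Finset.univ.filter fun z => f z = none) := by simp [hz]
      simp [hk] at this
    choose g hg using hsome
    exact ⟨⟨⟨g, fun {a b} hab => (hpair a b hab).1 _ _ (hg a) (hg b)⟩,
      fun a b hab => hinj a b (g a) (hg a) (by rw [hg b]; exact congrArg _ hab.symm)⟩⟩
  | succ k ih =>
    obtain ⟨z, hz⟩ : ∃ z, f z = none := by
      have : 0 < (Finset.univ.filter fun z => f z = none).card := by omega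
      obtain ⟨z, hz⟩ := Finset.card_pos.1 this
      exact ⟨z, by simpa using hz⟩
    -- Each vertex `p` already placed forbids its own image and, if it is a neighbour of `z`, at
    -- most `C` candidates not adjacent to that image. Since `z` itself is not placed, this is less
    -- than `(C + 1) * Fintype.card T` in total.
    set bad : T → Finset V := fun p => match f p with
      | none => ∅
      | some v => insert v (if L.Adj z p then (Y z).filter fun y => ¬ G.Adj v y else ∅) with hbad
    have hbadcard : ∀ p, (bad p).card ≤ C + 1 := by
      intro p
      rcases hp : f p with _ | v
      · simp [hbad, hp]
      · simp only [hbad, hp]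
        refine (Finset.card_insert_le _ _).trans ?_
        split_ifs with h
        · have := (hpair z p h).2.2.2 v hz hp
          unfold missIn at this
          convert Nat.add_le_add_right this 1
        · simp
    have hlt : ((Finset.univ.erase z).biUnion bad).card < (Y z).card := by
      calc ((Finset.univ.erase z).biUnion bad).card ≤ (Finset.univ.erase z).card * (C + 1) :=
            Finset.card_biUnion_le_card_mul _ _ _ fun p _ => hbadcard p
        _ < Fintype.card T * (C + 1) :=
            Nat.mul_lt_mul_of_pos_right
              (by rw [← Finset.card_univ]; exact Finset.card_erase_lt_of_mem (Finset.mem_univ z))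
              (Nat.succ_pos _)
        _ ≤ (Y z).card := by rw [mul_comm]; exact hcard z hz
    obtain ⟨y, hy, hyb⟩ := Finset.exists_mem_notMem_of_card_lt_card hlt
    have hgood : ∀ p v, f p = some v → y ≠ v ∧ (L.Adj z p → G.Adj v y) := by
      intro p v hp
      have hpz : p ≠ z := by rintro rfl; rw [hz] at hp; cases hp
      have : y ∉ bad p := fun h =>
        hyb (Finset.mem_biUnion.2 ⟨p, Finset.mem_erase.2 ⟨hpz, Finset.mem_univ p⟩, h⟩)
      simp only [hbad, hp, Finset.mem_insert, not_or] at this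
      refine ⟨this.1, fun hL => ?_⟩
      have h2 := this.2
      rw [if_pos hL, Finset.mem_filter, not_and_not_right] at h2
      exact h2 hy
    have hup : ∀ p, p ≠ z → Function.update f z (some y) p = f p := fun p hp =>
      Function.update_of_ne hp _ _
    have hself : Function.update f z (some y) z = some y := Function.update_self _ _ _
    have hne : ∀ p, Function.update f z (some y) p = none → p ≠ z ∧ f p = none := by
      intro p hp
      have hpz : p ≠ z := by rintro rfl; rw [hself] at hp; cases hp
      exact ⟨hpz, hup p hpz ▸ hp⟩
    have hzpair : ∀ b, L.Adj z b → PairOK G C (Function.update f z (some y)) c Y z b := by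
      intro b hb
      have hbz : b ≠ z := hb.ne'
      refine ⟨fun u v hu hv => ?_, fun h => ?_, fun u hu hbn => ?_, fun v h => ?_⟩
      · rw [hself] at hu
        rw [hup b hbz] at hv
        cases hu
        exact ((hgood b v hv).2 hb).symm
      · rw [hself] at h; cases h
      · rw [hself] at hu
        rw [hup b hbz] at hbn
        cases hu
        -- An unplaced neighbour of `z` has the other colour, so its candidates lie in the class
        -- opposite to that of the new image `y`, and `y` misses at most `C` of them.
        have hcz := (hpair z b hb).2.1 hz hbn
        refine (missIn_mono y (hY b hbn)).trans ?_
        have : c b = !c z := by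
          cases h1 : c z <;> cases h2 : c b <;> simp_all
        rw [this]
        exact hX _ y (hY z hz hy)
      · rw [hself] at h; cases h
    refine ih (Function.update f z (some y)) ?_ (fun p hp => hY p (hne p hp).2)
      (fun p hp => hcard p (hne p hp).2) ?_ ?_
    · intro a b v ha hb
      by_cases haz : a = z <;> by_cases hbz : b = z
      · rw [haz, hbz]
      · subst haz
        rw [hself] at ha
        rw [hup b hbz] at hb
        cases ha
        exact absurd rfl (hgood b _ hb).1
      · subst hbz
        rw [hself] at hb
        rw [hup a haz] at ha
        cases hb
        exact absurd rfl (hgood a _ ha).1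
      · rw [hup a haz] at ha
        rw [hup b hbz] at hb
        exact hinj a b v ha hb
    · intro a b hab
      by_cases haz : a = z
      · subst haz
        exact hzpair b hab
      by_cases hbz : b = z
      · subst hbz
        exact (hzpair a hab.symm).symm
      have h := hpair a b hab
      unfold PairOK at h ⊢
      rwa [hup a haz, hup b hbz]
    · have : (Finset.univ.filter fun p => Function.update f z (some y) p = none)
          = (Finset.univ.filter fun p => f p = none).erase z := by
        ext p
        simp only [Finset.mem_filter, Finset.mem_univ, true_and, Finset.mem_erase]
        refine ⟨hne p, fun ⟨h1, h2⟩ => by rw [hup p h1]; exact h2⟩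
      rw [this, Finset.card_erase_of_mem (by simp [hz])]
      omega

end Greedy

end Ballooning

namespace Ballooning

/-! ### Walking along the cycles of an odd-ballooning -/

section Orientation

variable {W : Type*} {H : SimpleGraph W} {ℓ : H.edgeSet → ℕ}

/-- The vertex set of an odd-ballooning. -/
abbrev BVert (H : SimpleGraph W) (ℓ : H.edgeSet → ℕ) : Type _ :=
  W ⊕ (Σ e : H.edgeSet, Fin (ℓ e - 2))

/-- A choice of an order of the two ends of each edge. -/
structure EdgeOrientation (H : SimpleGraph W) where
  src : H.edgeSet → W
  dst : H.edgeSet → W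
  mk_eq : ∀ e, s(src e, dst e) = e.1

lemma EdgeOrientation.adj (o : EdgeOrientation H) (e : H.edgeSet) : H.Adj (o.src e) (o.dst e) := by
  have := e.2
  rw [← o.mk_eq e] at this
  exact this

open scoped Classical in
/-- The distance from the source, minus one, of the `i`-th new vertex of the edge `e`. -/
noncomputable def EdgeOrientation.pos (o : EdgeOrientation H) (e : H.edgeSet)
    (i : Fin (ℓ e - 2)) : ℕ :=
  if o.src e = (Quot.out e.1).1 then i.val else ℓ e - 3 - i.val

lemma EdgeOrientation.out_cases (o : EdgeOrientation H) (e : H.edgeSet) :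
    (o.src e = (Quot.out e.1).1 ∧ o.dst e = (Quot.out e.1).2) ∨
    (o.src e ≠ (Quot.out e.1).1 ∧ o.src e = (Quot.out e.1).2 ∧ o.dst e = (Quot.out e.1).1) := by
  have h1 : s((Quot.out e.1).1, (Quot.out e.1).2) = e.1 := Quot.out_eq e.1
  rw [← o.mk_eq e, Sym2.eq_iff] at h1
  have h2 := (o.adj e).ne
  rcases h1 with ⟨h, h'⟩ | ⟨h, h'⟩
  · rw [o.mk_eq e] at h h'
    exact .inl ⟨h.symm, h'.symm⟩
  · rw [o.mk_eq e] at h h'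
    refine .inr ⟨fun h3 => h2 (h3.trans h), h'.symm, h.symm⟩

lemma EdgeOrientation.pos_lt (o : EdgeOrientation H) (e : H.edgeSet) (i : Fin (ℓ e - 2)) :
    o.pos e i + 2 < ℓ e := by
  have := i.2
  unfold pos
  split_ifs <;> omega

lemma EdgeOrientation.pos_inj (o : EdgeOrientation H) (e : H.edgeSet) {i j : Fin (ℓ e - 2)}
    (h : o.pos e i = o.pos e j) : i = j := by
  have := i.2
  have := j.2
  unfold pos at h
  ext
  split_ifs at h <;> omega

/-- The new vertex of `e` at position `j`, counted from the source. -/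
lemma EdgeOrientation.exists_pos (o : EdgeOrientation H) (e : H.edgeSet) {j : ℕ}
    (hj : j + 2 < ℓ e) : ∃ i : Fin (ℓ e - 2), o.pos e i = j := by
  by_cases h : o.src e = (Quot.out e.1).1
  · exact ⟨⟨j, by omega⟩, by simp [pos, h]⟩
  · refine ⟨⟨ℓ e - 3 - j, by omega⟩, ?_⟩
    simp only [pos, h, if_false]
    omega

lemma ballooning_adj_inl {u v : W} :
    (oddBallooning H ℓ).Adj (.inl u) (.inl v) ↔ H.Adj u v := by
  simp only [oddBallooning, fromRel_adj, ne_eq, Sum.inl.injEq]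
  constructor
  · rintro ⟨-, h | h⟩
    exacts [h, h.symm]
  · exact fun h => ⟨h.ne, .inl h⟩

lemma ballooning_adj_inl_inr (o : EdgeOrientation H) {u : W} {e : H.edgeSet}
    {i : Fin (ℓ e - 2)} :
    (oddBallooning H ℓ).Adj (.inl u) (.inr ⟨e, i⟩) ↔
      (u = o.src e ∧ o.pos e i = 0) ∨ (u = o.dst e ∧ o.pos e i + 3 = ℓ e) := by
  have hi := i.2
  simp only [oddBallooning, fromRel_adj, ne_eq, reduceCtorEq, not_false_eq_true, true_and,
    or_false]
  rcases o.out_cases e with ⟨h1, h2⟩ | ⟨h1, h2, h3⟩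
  · simp [EdgeOrientation.pos, h1, h2]
  · simp only [EdgeOrientation.pos, if_neg h1]
    rw [h2, h3]
    constructor
    · rintro (⟨rfl, h⟩ | ⟨rfl, h⟩)
      · exact .inr ⟨rfl, by omega⟩
      · exact .inl ⟨rfl, by omega⟩
    · rintro (⟨rfl, h⟩ | ⟨rfl, h⟩)
      · exact .inr ⟨rfl, by omega⟩
      · exact .inl ⟨rfl, by omega⟩

lemma ballooning_adj_inr (o : EdgeOrientation H) {e e' : H.edgeSet}
    {i : Fin (ℓ e - 2)} {j : Fin (ℓ e' - 2)} :
    (oddBallooning H ℓ).Adj (.inr ⟨e, i⟩) (.inr ⟨e', j⟩) ↔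
      e = e' ∧ (o.pos e i + 1 = o.pos e' j ∨ o.pos e' j + 1 = o.pos e i) := by
  have hi := i.2
  have hj := j.2
  simp only [oddBallooning, fromRel_adj, ne_eq, Sum.inr.injEq]
  constructor
  · rintro ⟨-, ⟨rfl, h⟩ | ⟨rfl, h⟩⟩
    all_goals
      refine ⟨rfl, ?_⟩
      unfold EdgeOrientation.pos
      split_ifs <;> omega
  · rintro ⟨rfl, h⟩
    refine ⟨?_, ?_⟩
    · intro h'
      cases h'
      omega
    · simp only [true_and]
      unfold EdgeOrientation.pos at h
      split_ifs at h <;> omega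

/-- To check a symmetric relation on the edges of an odd-ballooning, it suffices to walk along the
cycles in the directions given by an orientation. -/
lemma ballooning_adj_rec (o : EdgeOrientation H) {P : BVert H ℓ → BVert H ℓ → Prop}
    (hsymm : ∀ a b, P a b → P b a)
    (h1 : ∀ e, P (.inl (o.src e)) (.inl (o.dst e)))
    (h2 : ∀ e i, o.pos e i = 0 → P (.inl (o.src e)) (.inr ⟨e, i⟩))
    (h3 : ∀ e i, o.pos e i + 3 = ℓ e → P (.inl (o.dst e)) (.inr ⟨e, i⟩))
    (h4 : ∀ e i j, o.pos e i + 1 = o.pos e j → P (.inr ⟨e, i⟩) (.inr ⟨e, j⟩)) :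
    ∀ a b, (oddBallooning H ℓ).Adj a b → P a b := by
  have key : ∀ u e i, (oddBallooning H ℓ).Adj (.inl u) (.inr ⟨e, i⟩) →
      P (.inl u) (.inr ⟨e, i⟩) := by
    intro u e i h
    rw [ballooning_adj_inl_inr o] at h
    rcases h with ⟨rfl, h⟩ | ⟨rfl, h⟩
    exacts [h2 e i h, h3 e i h]
  rintro (u | ⟨e, i⟩) (v | ⟨e', j⟩) h
  · rw [ballooning_adj_inl] at h
    have h' := h1 ⟨s(u, v), h⟩
    have h'' := o.mk_eq ⟨s(u, v), h⟩
    rw [Sym2.eq_iff] at h''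
    rcases h'' with ⟨h3, h4⟩ | ⟨h3, h4⟩ <;> rw [h3, h4] at h'
    exacts [h', hsymm _ _ h']
  · exact key _ _ _ h
  · exact hsymm _ _ (key _ _ _ h.symm)
  · rw [ballooning_adj_inr o] at h
    obtain ⟨rfl, h | h⟩ := h
    exacts [h4 e i j h, hsymm _ _ (h4 e j i h)]

/-- Along a properly 2-coloured cycle path: the colour at position `j`. -/
lemma coloring_pos (o : EdgeOrientation H) {e : H.edgeSet} (hℓ : Odd (ℓ e))
    {c : BVert H ℓ → Bool}
    (hc : ∀ i j : Fin (ℓ e - 2),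
      (oddBallooning H ℓ).Adj (.inr ⟨e, i⟩) (.inr ⟨e, j⟩) →
        c (.inr ⟨e, i⟩) ≠ c (.inr ⟨e, j⟩))
    {i₀ i₁ : Fin (ℓ e - 2)} (h0 : o.pos e i₀ = 0) (h1 : o.pos e i₁ + 3 = ℓ e) :
    c (.inr ⟨e, i₀⟩) = c (.inr ⟨e, i₁⟩) := by
  have key : ∀ n, ∀ i : Fin (ℓ e - 2), o.pos e i = n →
      c (.inr ⟨e, i⟩) = (c (.inr ⟨e, i₀⟩) ^^ decide (n % 2 = 1)) := by
    intro n
    induction n with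
    | zero =>
      intro i hi
      rw [o.pos_inj e (hi.trans h0.symm)]
      simp
    | succ n ih =>
      intro i hi
      have hlt := o.pos_lt e i
      obtain ⟨j, hj⟩ := o.exists_pos (ℓ := ℓ) e (j := n) (by omega)
      have h2 := ih j hj
      have h4 := hc j i ((ballooning_adj_inr o).2 ⟨rfl, .inl (by omega)⟩)
      rcases Nat.mod_two_eq_zero_or_one n with h5 | h5
      · have h6 : (n + 1) % 2 = 1 := by omega
        rw [h5] at h2
        rw [h6]
        cases h7 : c (.inr ⟨e, i⟩) <;> cases h8 : c (.inr ⟨e, j⟩) <;> simp_all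
      · have h6 : (n + 1) % 2 = 0 := by omega
        rw [h5] at h2
        rw [h6]
        cases h7 : c (.inr ⟨e, i⟩) <;> cases h8 : c (.inr ⟨e, j⟩) <;> simp_all
  have h4 := key _ i₁ rfl
  obtain ⟨k, hk⟩ := hℓ
  -- The new vertices form a path of odd order `ℓ e - 2`, so the last position is even, like the
  -- first.
  have h5 : o.pos e i₁ % 2 = 0 := by omega
  rw [h4, h5]
  simp

end Orientation

/-! ### Embeddings described cycle by cycle -/

section Assignment

variable {W V : Type*} {H : SimpleGraph W} {ℓ : H.edgeSet → ℕ}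

/-- The data attached to a vertex that is to be embedded: its image if already fixed, its colour,
and its list of candidates. -/
abbrev Cell (V : Type*) : Type _ := Option V × Bool × Finset V

/-- `PairOK` for two cells. -/
abbrev CellOK (G : SimpleGraph V) (C : ℕ) (x y : Cell V) : Prop :=
  PairOK G C (fun z : Cell V => z.1) (fun z => z.2.1) (fun z => z.2.2) x y

/-- The new vertices are addressed by their positions from the source, so only consecutive cells
have to be compared. The conditions are asked at all natural numbers; cells beyond the end of a
cycle are never used. -/
theorem isContained_of_cells [Finite W] (o : EdgeOrientation H) (G : SimpleGraph V)
    (X : Bool → Finset V) (C : ℕ) (hX : ∀ b, ∀ v ∈ X b, missIn G v (X (!b)) ≤ C)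
    (κ : W → Cell V) (κe : H.edgeSet → ℕ → Cell V)
    (hinj : ∀ a b v, (κ a).1 = some v → (κ b).1 = some v → a = b)
    (hinj' : ∀ a e j v, (κ a).1 = some v → (κe e j).1 ≠ some v)
    (hinj'' : ∀ e e' j j' v, (κe e j).1 = some v → (κe e' j').1 = some v → e = e' ∧ j = j')
    (hY : ∀ z, (κ z).1 = none → (κ z).2.2 ⊆ X (κ z).2.1 ∧
      (C + 1) * Nat.card (BVert H ℓ) ≤ ((κ z).2.2).card)
    (hY' : ∀ e j, (κe e j).1 = none → (κe e j).2.2 ⊆ X (κe e j).2.1 ∧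
      (C + 1) * Nat.card (BVert H ℓ) ≤ ((κe e j).2.2).card)
    (h1 : ∀ e, CellOK G C (κ (o.src e)) (κ (o.dst e)))
    (h2 : ∀ e, CellOK G C (κ (o.src e)) (κe e 0))
    (h3 : ∀ e, CellOK G C (κ (o.dst e)) (κe e (ℓ e - 3)))
    (h4 : ∀ e j, CellOK G C (κe e j) (κe e (j + 1))) : oddBallooning H ℓ ⊑ G := by
  classical
  have := Fintype.ofFinite (BVert H ℓ)
  let K : BVert H ℓ → Cell V := Sum.elim κ fun p => κe p.1 (o.pos p.1 p.2)
  have hK : ∀ a b, (oddBallooning H ℓ).Adj a b → CellOK G C (K a) (K b) := by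
    refine ballooning_adj_rec o (fun a b h => h.symm) h1 (fun e i hi => ?_) (fun e i hi => ?_)
      fun e i j hij => ?_
    · show CellOK G C (κ _) (κe e (o.pos e i))
      rw [hi]; exact h2 e
    · show CellOK G C (κ _) (κe e (o.pos e i))
      rw [show o.pos e i = ℓ e - 3 by omega]; exact h3 e
    · show CellOK G C (κe e (o.pos e i)) (κe e (o.pos e j))
      rw [← hij]; exact h4 e _
  refine isContained_of_greedy (oddBallooning H ℓ) G X C hX (fun a => (K a).2.1)
    (fun a => (K a).2.2) (fun a => (K a).1) ?_ ?_ ?_ hK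
  · rintro (a | ⟨e, i⟩) (b | ⟨e', j⟩) v ha hb
    · exact congrArg _ (hinj a b v ha hb)
    · exact absurd hb (hinj' a _ _ v ha)
    · exact absurd ha (hinj' b _ _ v hb)
    · obtain ⟨rfl, h⟩ := hinj'' _ _ _ _ v ha hb
      have hij := o.pos_inj _ h
      dsimp only at hij
      rw [hij]
  · rintro (a | ⟨e, i⟩) h
    exacts [(hY a h).1, (hY' _ _ h).1]
  · rw [← Nat.card_eq_fintype_card]
    rintro (a | ⟨e, i⟩) h
    exacts [(hY a h).2, (hY' _ _ h).2]

/-- How the cycle of an edge is embedded: its ends lie in the classes `true` and `false`, and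
the new vertices alternate, except for a prescribed defect.
* `leaf a`: the first new vertex is `a`, in the class of the source;
* `aa a a'`: the second and third new vertices are `a`, `a'`, in the class `true`;
* `bb b b'`: the first two new vertices are `b`, `b'`, in the class `false`;
* `hub w`: the second new vertex is `w`, outside the classes;
* `covS`, `covD`: the source or the target lies outside the classes. -/
inductive Kind (V : Type*) where
  | leaf (a : V)
  | aa (a a' : V)
  | bb (b b' : V)
  | hub (w : V)
  | covS
  | covD

/-- The prescribed vertices. -/
def Kind.verts {V : Type*} : Kind V → Set V
  | .leaf a => {a}
  | .aa a a' => {a, a'}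
  | .bb b b' => {b, b'}
  | .hub w => {w}
  | .covS => ∅
  | .covD => ∅

/-- The cell at a position that is not prescribed. -/
def baseCell {V : Type*} (YA YB : Finset V) (b : Bool) : Cell V := (none, b, if b then YA else YB)

/-- The cells of the new vertices of an edge. -/
def Kind.cell {V : Type*} (YA YB Z : Finset V) : Kind V → ℕ → Cell V
  -- The colours alternate away from the defect so that the last position `ℓ e - 3`, which is even,
  -- has a colour opposite to that of the target; only for `covD`, whose target is outside the
  -- classes, does it have the colour `false`. The colour and the list at a prescribed position play
  -- no role.
  | .leaf a, 0 => (some a, true, YA)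
  | .aa _ _, 0 => (none, false, Z)
  | .aa a _, 1 => (some a, true, YA)
  | .aa _ a', 2 => (some a', true, YA)
  | .bb b _, 0 => (some b, false, YB)
  | .bb _ b', 1 => (some b', false, YB)
  | .hub _, 0 => (none, false, Z)
  | .hub w, 1 => (some w, true, YA)
  | .covD, j => baseCell YA YB (decide (j % 2 = 1))
  | .covS, j => baseCell YA YB (decide (j % 2 = 0))
  | .leaf _, j + 1 => baseCell YA YB (decide (j % 2 = 1))
  | .aa _ _, j + 3 => baseCell YA YB (decide (j % 2 = 1))
  | .bb _ _, j + 2 => baseCell YA YB (decide (j % 2 = 0))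
  | .hub _, j + 2 => baseCell YA YB (decide (j % 2 = 0))

/-- The conditions on the prescribed vertices of the cycle of an edge, where `p` and `p'` are the
prescribed images of its source and target. -/
def Kind.Good {V : Type*} (G : SimpleGraph V) (C : ℕ) (YA YB Z : Finset V) (p p' : Option V) :
    Kind V → Prop
  | .leaf a => p' = none ∧ missIn G a YB ≤ C ∧ ∃ v, p = some v ∧ G.Adj v a ∧ missIn G v YB ≤ C
  | .aa a a' => p' = none ∧ G.Adj a a' ∧ missIn G a Z ≤ C ∧ missIn G a' YB ≤ C ∧
      ∀ v, p = some v → missIn G v YB ≤ C ∧ missIn G v Z ≤ C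
  | .bb b b' => p' = none ∧ G.Adj b b' ∧ missIn G b YA ≤ C ∧ missIn G b' YA ≤ C ∧
      ∀ v, p = some v → G.Adj v b ∧ missIn G v YB ≤ C
  | .hub w => p' = none ∧ missIn G w YA ≤ C ∧ missIn G w Z ≤ C ∧
      ∀ v, p = some v → missIn G v YB ≤ C ∧ missIn G v Z ≤ C
  | .covS => p' = none ∧ ∃ w, p = some w ∧ missIn G w YA ≤ C ∧ missIn G w YB ≤ C
  | .covD => p = none ∧ ∃ w, p' = some w ∧ missIn G w YA ≤ C ∧ missIn G w YB ≤ C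

lemma cellOK_none {G : SimpleGraph V} {C : ℕ} {b b' : Bool} {Y Y' : Finset V} (h : b ≠ b') :
    CellOK G C (none, b, Y) (none, b', Y') :=
  ⟨fun _ _ h => by simp at h, fun _ _ => h, fun _ h => by simp at h, fun _ _ h => by simp at h⟩

lemma cellOK_some_none {G : SimpleGraph V} {C : ℕ} {b b' : Bool} {Y Y' : Finset V} {v : V}
    (h : missIn G v Y' ≤ C) : CellOK G C (some v, b, Y) (none, b', Y') :=
  ⟨fun _ _ _ h => by simp at h, fun h => by simp at h, fun u hu _ => by cases hu; exact h,
    fun _ h => by simp at h⟩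

lemma cellOK_some_some {G : SimpleGraph V} {C : ℕ} {b b' : Bool} {Y Y' : Finset V} {v v' : V}
    (h : G.Adj v v') : CellOK G C (some v, b, Y) (some v', b', Y') :=
  ⟨fun u u' hu hu' => by cases hu; cases hu'; exact h, fun h => by simp at h,
    fun _ _ h => by simp at h, fun _ h => by simp at h⟩

lemma cellOK_base {G : SimpleGraph V} {C : ℕ} {YA YB : Finset V} {b b' : Bool} (h : b ≠ b') :
    CellOK G C (baseCell YA YB b) (baseCell YA YB b') := cellOK_none h

lemma Kind.cell_some_mem {YA YB Z : Finset V} {k : Kind V} {j : ℕ} {v : V}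
    (h : (k.cell YA YB Z j).1 = some v) : v ∈ k.verts := by
  unfold Kind.cell at h
  split at h <;> simp_all [Kind.verts, baseCell]

lemma Kind.cell_inj {G : SimpleGraph V} {C : ℕ} {YA YB Z : Finset V} {p p' : Option V}
    {k : Kind V} (hk : k.Good G C YA YB Z p p') {j j' : ℕ} {v : V}
    (h : (k.cell YA YB Z j).1 = some v) (h' : (k.cell YA YB Z j').1 = some v) : j = j' := by
  have hne : ∀ a a' : V, G.Adj a a' → a ≠ a' := fun a a' h => h.ne
  rcases k with a | ⟨a, a'⟩ | ⟨a, a'⟩ | a | _ | _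
  · rcases j with _ | j <;> rcases j' with _ | j' <;> simp_all [Kind.cell, baseCell]
  · have := hk.2.1.ne
    rcases j with _ | _ | _ | j <;> rcases j' with _ | _ | _ | j' <;>
      simp_all [Kind.cell, baseCell]
  · have := hk.2.1.ne
    rcases j with _ | _ | j <;> rcases j' with _ | _ | j' <;>
      simp_all [Kind.cell, baseCell]
  · rcases j with _ | _ | j <;> rcases j' with _ | _ | j' <;>
      simp_all [Kind.cell, baseCell]
  · simp [Kind.cell, baseCell] at h
  · simp [Kind.cell, baseCell] at h

lemma Kind.cell_cand {YA YB Z : Finset V} {X : Bool → Finset V} {D : ℕ} (hA : YA ⊆ X true)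
    (hB : YB ⊆ X false) (hZ : Z ⊆ X false) (hAc : D ≤ YA.card) (hBc : D ≤ YB.card)
    (hZc : D ≤ Z.card) (k : Kind V) (j : ℕ) (h : (k.cell YA YB Z j).1 = none) :
    (k.cell YA YB Z j).2.2 ⊆ X (k.cell YA YB Z j).2.1 ∧ D ≤ (k.cell YA YB Z j).2.2.card := by
  have hb : ∀ b, (baseCell YA YB b).2.2 ⊆ X (baseCell YA YB b).2.1 ∧
      D ≤ (baseCell YA YB b).2.2.card := by
    rintro (_ | _)
    exacts [⟨hB, hBc⟩, ⟨hA, hAc⟩]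
  unfold Kind.cell at h ⊢
  split <;> first | exact hb _ | exact ⟨hZ, hZc⟩

lemma decide_mod_ne (j : ℕ) (a : ℕ) (ha : a < 2) :
    decide (j % 2 = a) ≠ decide ((j + 1) % 2 = a) := by
  intro h
  rw [decide_eq_decide] at h
  omega

lemma Kind.cell_succ {G : SimpleGraph V} {C : ℕ} {YA YB Z : Finset V} {p p' : Option V}
    {k : Kind V} (hk : k.Good G C YA YB Z p p') (j : ℕ) :
    CellOK G C (k.cell YA YB Z j) (k.cell YA YB Z (j + 1)) := by
  rcases k with a | ⟨a, a'⟩ | ⟨b, b'⟩ | w | _ | _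
  · rcases j with _ | j
    · exact cellOK_some_none hk.2.1
    · exact cellOK_base (decide_mod_ne j 1 (by norm_num))
  · obtain ⟨-, h1, h2, h3, -⟩ := hk
    rcases j with _ | _ | _ | j
    · exact (cellOK_some_none h2).symm
    · exact cellOK_some_some h1
    · exact cellOK_some_none h3
    · exact cellOK_base (decide_mod_ne j 1 (by norm_num))
  · obtain ⟨-, h1, h2, h3, -⟩ := hk
    rcases j with _ | _ | j
    · exact cellOK_some_some h1
    · exact cellOK_some_none h3
    · exact cellOK_base (decide_mod_ne j 0 (by norm_num))
  · obtain ⟨-, h1, h2, -⟩ := hk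
    rcases j with _ | _ | j
    · exact (cellOK_some_none h2).symm
    · exact cellOK_some_none h1
    · exact cellOK_base (decide_mod_ne j 0 (by norm_num))
  · exact cellOK_base (decide_mod_ne j 0 (by norm_num))
  · exact cellOK_base (decide_mod_ne j 1 (by norm_num))

lemma Kind.cell_src {G : SimpleGraph V} {C : ℕ} {YA YB Z : Finset V} {p p' : Option V}
    {k : Kind V} (hk : k.Good G C YA YB Z p p') :
    CellOK G C (p, true, YA) (k.cell YA YB Z 0) := by
  rcases k with a | ⟨a, a'⟩ | ⟨b, b'⟩ | w | _ | _
  · obtain ⟨-, -, v, rfl, h, -⟩ := hk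
    exact cellOK_some_some h
  · obtain ⟨-, -, -, -, h⟩ := hk
    rcases p with _ | v
    exacts [cellOK_none (by decide), cellOK_some_none (h v rfl).2]
  · obtain ⟨-, -, h2, -, h⟩ := hk
    rcases p with _ | v
    exacts [(cellOK_some_none h2).symm, cellOK_some_some (h v rfl).1]
  · obtain ⟨-, -, -, h⟩ := hk
    rcases p with _ | v
    exacts [cellOK_none (by decide), cellOK_some_none (h v rfl).2]
  · obtain ⟨-, w, rfl, h, -⟩ := hk
    exact cellOK_some_none h
  · obtain ⟨rfl, -⟩ := hk
    exact cellOK_none (by decide)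

/-- Length at least five is used here: the last position is then at least two, so it lies beyond the
prescribed vertices, except that for length five the second vertex of `aa` is itself the last new
vertex. -/
lemma Kind.cell_dst {G : SimpleGraph V} {C : ℕ} {YA YB Z : Finset V} {p p' : Option V}
    {k : Kind V} (hk : k.Good G C YA YB Z p p') {n : ℕ} (hn : Odd n) (h5 : 5 ≤ n) :
    CellOK G C (p', false, YB) (k.cell YA YB Z (n - 3)) := by
  obtain ⟨r, hr⟩ := hn
  obtain ⟨j, hj⟩ : ∃ j, n - 3 = 2 * j + 2 := ⟨r - 2, by omega⟩
  rw [hj]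
  have e0 : (2 * j) % 2 = 0 := by omega
  have e1 : (2 * j + 1) % 2 = 1 := by omega
  have e2 : (2 * j + 2) % 2 = 0 := by omega
  rcases k with a | ⟨a, a'⟩ | ⟨b, b'⟩ | w | _ | _
  · obtain ⟨rfl, -⟩ := hk
    show CellOK G C _ (baseCell YA YB (decide ((2 * j + 1) % 2 = 1)))
    rw [e1]
    exact cellOK_none (by decide)
  · obtain ⟨rfl, h1, h2, h3, -⟩ := hk
    rcases j with _ | j
    · exact (cellOK_some_none h3).symm
    · rw [show 2 * (j + 1) + 2 = (2 * j + 1) + 3 by ring]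
      show CellOK G C _ (baseCell YA YB (decide ((2 * j + 1) % 2 = 1)))
      rw [show (2 * j + 1) % 2 = 1 by omega]
      exact cellOK_none (by decide)
  · obtain ⟨rfl, -⟩ := hk
    show CellOK G C _ (baseCell YA YB (decide ((2 * j) % 2 = 0)))
    rw [e0]
    exact cellOK_none (by decide)
  · obtain ⟨rfl, -⟩ := hk
    show CellOK G C _ (baseCell YA YB (decide ((2 * j) % 2 = 0)))
    rw [e0]
    exact cellOK_none (by decide)
  · obtain ⟨rfl, -⟩ := hk
    show CellOK G C _ (baseCell YA YB (decide ((2 * j + 2) % 2 = 0)))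
    rw [e2]
    exact cellOK_none (by decide)
  · obtain ⟨-, w, rfl, -, h⟩ := hk
    show CellOK G C _ (baseCell YA YB (decide ((2 * j + 2) % 2 = 1)))
    rw [e2]
    exact cellOK_some_none h

lemma Kind.cell_ends {G : SimpleGraph V} {C : ℕ} {YA YB Z : Finset V} {p p' : Option V}
    {k : Kind V} (hk : k.Good G C YA YB Z p p') :
    CellOK G C (p, true, YA) (p', false, YB) := by
  have key : p' = none → (∀ v, p = some v → missIn G v YB ≤ C) →
      CellOK G C (p, true, YA) (p', false, YB) := by
    rintro rfl h
    rcases p with _ | v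
    exacts [cellOK_none (by decide), cellOK_some_none (h v rfl)]
  rcases k with a | ⟨a, a'⟩ | ⟨b, b'⟩ | w | _ | _
  · obtain ⟨h, -, v, rfl, -, h'⟩ := hk
    exact key h fun u hu => by cases hu; exact h'
  · exact key hk.1 fun v hv => (hk.2.2.2.2 v hv).1
  · exact key hk.1 fun v hv => (hk.2.2.2.2 v hv).2
  · exact key hk.1 fun v hv => (hk.2.2.2 v hv).1
  · obtain ⟨h, v, rfl, -, h'⟩ := hk
    exact key h fun u hu => by cases hu; exact h'
  · obtain ⟨rfl, v, rfl, h', -⟩ := hk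
    exact (cellOK_some_none h').symm

/-- Embedding an odd-ballooning with prescribed images `g` of some old vertices and prescribed
defects `k` on the cycles. -/
theorem isContained_of_kinds [Finite W] (o : EdgeOrientation H) (hℓ : ∀ e, Odd (ℓ e) ∧ 5 ≤ ℓ e)
    (G : SimpleGraph V) (X : Bool → Finset V) (C : ℕ)
    (hX : ∀ b, ∀ v ∈ X b, missIn G v (X (!b)) ≤ C)
    (c : W → Bool) (hsrc : ∀ e, c (o.src e) = true) (hdst : ∀ e, c (o.dst e) = false)
    (YA YB : Finset V) (Z : H.edgeSet → Finset V) (hA : YA ⊆ X true) (hB : YB ⊆ X false)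
    (hZ : ∀ e, Z e ⊆ X false)
    (hAc : (C + 1) * Nat.card (BVert H ℓ) ≤ YA.card)
    (hBc : (C + 1) * Nat.card (BVert H ℓ) ≤ YB.card)
    (hZc : ∀ e, (C + 1) * Nat.card (BVert H ℓ) ≤ (Z e).card)
    (g : W → Option V) (k : H.edgeSet → Kind V)
    (hg : ∀ a b v, g a = some v → g b = some v → a = b)
    (hgk : ∀ a v e, g a = some v → v ∉ (k e).verts)
    (hkk : ∀ e e' v, v ∈ (k e).verts → v ∈ (k e').verts → e = e')
    (hk : ∀ e, (k e).Good G C YA YB (Z e) (g (o.src e)) (g (o.dst e))) :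
    oddBallooning H ℓ ⊑ G := by
  refine isContained_of_cells o G X C hX (fun u => (g u, c u, if c u then YA else YB))
    (fun e j => (k e).cell YA YB (Z e) j) hg ?_ ?_ ?_ ?_ ?_ ?_ ?_ ?_
  · intro a e j v ha he
    exact hgk a v e ha (Kind.cell_some_mem he)
  · intro e e' j j' v h h'
    obtain rfl := hkk e e' v (Kind.cell_some_mem h) (Kind.cell_some_mem h')
    exact ⟨rfl, Kind.cell_inj (hk e) h h'⟩
  · intro z _
    dsimp only
    cases c z
    exacts [⟨hB, hBc⟩, ⟨hA, hAc⟩]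
  · exact fun e j h => Kind.cell_cand hA hB (hZ e) hAc hBc (hZc e) (k e) j h
  · intro e
    simp only [hsrc e, hdst e, if_true]
    exact Kind.cell_ends (hk e)
  · intro e
    simp only [hsrc e, if_true]
    exact Kind.cell_src (hk e)
  · intro e
    simp only [hdst e]
    exact Kind.cell_dst (hk e) (hℓ e).1 (hℓ e).2
  · exact fun e j => Kind.cell_succ (hk e) j

end Assignment

end Ballooning

namespace Ballooning

/-! ### Members of the 2-decomposition family -/

section Decomposition

variable {T U U' : Type*} {L : SimpleGraph T}

lemma graphJoin_adj_inl {V W : Type*} {G : SimpleGraph V} {H : SimpleGraph W} {a b : V} :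
    (graphJoin G H).Adj (.inl a) (.inl b) ↔ G.Adj a b := by
  simp [graphJoin]

lemma graphJoin_adj_inr {V W : Type*} {G : SimpleGraph V} {H : SimpleGraph W} {a b : W} :
    (graphJoin G H).Adj (.inr a) (.inr b) ↔ H.Adj a b := by
  simp [graphJoin]

lemma graphJoin_adj_inl_inr {V W : Type*} {G : SimpleGraph V} {H : SimpleGraph W} (a : V) (b : W) :
    (graphJoin G H).Adj (.inl a) (.inr b) := by
  simp [graphJoin]

lemma isTwoDecomposing_mono {M : SimpleGraph U} {M' : SimpleGraph U'}
    (h : IsTwoDecomposing L M) (hM : M ⊑ M') : IsTwoDecomposing L M' := by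
  obtain ⟨s, hs⟩ := h
  obtain ⟨g⟩ := hM
  refine ⟨s, hs.trans ⟨⟨⟨Sum.map (Sum.map g id) id, ?_⟩, ?_⟩⟩⟩
  · rintro ((a | a) | a) ((b | b) | b) hab
    · rw [graphJoin_adj_inl] at hab
      exact graphJoin_adj_inl.2 (g.toHom.map_adj hab)
    all_goals simp_all [graphJoin]
  · exact Function.Injective.sumMap (Function.Injective.sumMap g.injective fun _ _ h => h)
      fun _ _ h => h

lemma nonempty_iso_of_copy {m m' : ℕ} {A : SimpleGraph (Fin m)} {B : SimpleGraph (Fin m')}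
    (f : Copy A B) (hm : m' ≤ m) (he : B.edgeSet.ncard ≤ A.edgeSet.ncard) :
    Nonempty (A ≃g B) := by
  have hle : m ≤ m' := by simpa using Fintype.card_le_of_injective f f.injective
  obtain rfl : m = m' := le_antisymm hle hm
  let e : Fin m ≃ Fin m := Equiv.ofBijective f (Finite.injective_iff_bijective.1 f.injective)
  have hmap : A.map e ≤ B := by
    intro u v huv
    obtain ⟨-, a, b, hab, rfl, rfl⟩ := huv
    exact f.toHom.map_adj hab
  have hE : (A.map e).edgeSet = B.edgeSet := by
    refine Set.eq_of_subset_of_ncard_le (edgeSet_subset_edgeSet.2 hmap) ?_ (Set.toFinite _)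
    refine he.trans ?_
    rw [← Nat.card_coe_set_eq, ← Nat.card_coe_set_eq]
    exact (Nat.card_congr (Iso.map e A).mapEdgeSet).le
  rw [edgeSet_inj] at hE
  exact ⟨hE ▸ Iso.map e A⟩

/-- A decomposing subgraph with the least number of vertices plus edges is minimal: a copy of
another one inside it has no fewer vertices and no fewer edges, hence is the whole graph. -/
lemma exists_mem_twoDecompositionFamily [Finite U] {M₀ : SimpleGraph U}
    (h : IsTwoDecomposing L M₀) : ∃ M ∈ twoDecompositionFamily L, M.2 ⊑ M₀ := by
  classical
  have := Fintype.ofFinite U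
  let s : Set (Σ m : ℕ, SimpleGraph (Fin m)) := {M | M.2 ⊑ M₀ ∧ IsTwoDecomposing L M.2}
  have hs : s.Nonempty := by
    let e := Fintype.equivFin U
    refine ⟨⟨Fintype.card U, M₀.map e⟩, ?_, isTwoDecomposing_mono h ?_⟩
    · exact (Iso.map e M₀).symm.isContained
    · exact (Iso.map e M₀).isContained
  obtain ⟨M, hM, hmin⟩ := WellFounded.has_min
    (measure fun M : (Σ m : ℕ, SimpleGraph (Fin m)) => M.1 + M.2.edgeSet.ncard).wf s hs
  refine ⟨M, ⟨hM.2, fun M' hM' hd => ?_⟩, hM.1⟩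
  have h1 := hmin M' ⟨hM'.trans hM.1, hd⟩
  obtain ⟨f⟩ := hM'
  have h2 : M'.1 ≤ M.1 := by simpa using Fintype.card_le_of_injective f f.injective
  have h3 : M'.2.edgeSet.ncard ≤ M.2.edgeSet.ncard := by
    rw [← Nat.card_coe_set_eq, ← Nat.card_coe_set_eq]
    exact Nat.card_le_card_of_injective _ f.mapEdgeSet.injective
  have h4 : ¬ M'.1 + M'.2.edgeSet.ncard < M.1 + M.2.edgeSet.ncard := h1
  exact nonempty_iso_of_copy f (by omega) (by omega)

/-- The independent set `B` is placed in the edgeless side of the join, and all other vertices in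
the copy of `M`. -/
lemma isTwoDecomposing_induce_compl [Finite T] {B : Set T}
    (hB : ∀ a ∈ B, ∀ b ∈ B, ¬ L.Adj a b) : IsTwoDecomposing L (L.induce Bᶜ) := by
  classical
  have := Fintype.ofFinite T
  let e := Fintype.equivFin T
  let f : T → ((Bᶜ : Set T) ⊕ Fin (Fintype.card T)) ⊕ Fin (Fintype.card T) := fun z =>
    if h : z ∈ B then .inr (e z) else .inl (.inl ⟨z, h⟩)
  refine ⟨Fintype.card T, ⟨⟨⟨f, ?_⟩, ?_⟩⟩⟩
  · intro a b hab
    by_cases ha : a ∈ B <;> by_cases hb : b ∈ B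
    · exact absurd hab (hB a ha b hb)
    · simp only [f, ha, hb, dif_pos, dif_neg, not_false_iff]
      exact (graphJoin_adj_inl_inr _ _).symm
    · simp only [f, ha, hb, dif_pos, dif_neg, not_false_iff]
      exact graphJoin_adj_inl_inr _ _
    · simp only [f, ha, hb, dif_neg, not_false_iff]
      exact graphJoin_adj_inl.2 (by simpa using hab)
  · intro a b hab
    change f a = f b at hab
    by_cases ha : a ∈ B <;> by_cases hb : b ∈ B <;> simp_all [f]

end Decomposition

/-! ### The lower-bound construction is free -/

section Free

variable {T R : Type*} {L : SimpleGraph T}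

/-- A graph without members of the subgraph covering family, joined to a bipartite graph, does not
contain `L`. -/
theorem free_graphJoin [Finite T] (hq : 1 ≤ qTilde L) {Q : SimpleGraph (Fin (qTilde L - 1))}
    (hQ : FamilyFree (BTilde L) Q) {R' : SimpleGraph R} {c : R → Bool}
    (hc : ∀ a b, R'.Adj a b → c a ≠ c b) : L.Free (graphJoin Q R') := by
  classical
  rintro ⟨f⟩
  have hadj : ∀ {a b}, L.Adj a b → (graphJoin Q R').Adj (f a) (f b) := fun h => f.toHom.map_adj h
  -- Removing the vertices in one colour class leaves a decomposing graph, hence a member `M` of the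
  -- family. Its vertices in `R'` all lie in the other colour class, so those in `Q` cover `M`, and
  -- there are fewer than `qTilde L` of them.
  let B : Set T := {z | ∃ r, f z = .inr r ∧ c r = false}
  have hB : ∀ a ∈ B, ∀ b ∈ B, ¬ L.Adj a b := by
    rintro a ⟨r, hr, hcr⟩ b ⟨r', hr', hcr'⟩ hab
    have := hadj hab
    rw [hr, hr', graphJoin_adj_inr] at this
    exact hc _ _ this (hcr.trans hcr'.symm)
  obtain ⟨M, hM, ⟨g⟩⟩ := exists_mem_twoDecompositionFamily (isTwoDecomposing_induce_compl hB)
  let C : Finset (Fin M.1) := Finset.univ.filter fun y => ∃ p, f (g y) = .inl p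
  have hCmem : ∀ y : (C : Set (Fin M.1)), ∃ p, f (g y) = .inl p := fun y => by
    have := y.2
    simpa [C] using this
  choose φ hφ using hCmem
  have hφinj : Function.Injective φ := by
    intro y y' h
    have h1 : f (g y) = f (g y') := by rw [hφ, hφ, h]
    exact Subtype.ext (g.injective (Subtype.ext (f.injective h1)))
  have hcov : M.2.IsVertexCover (C : Set (Fin M.1)) := by
    intro y y' hyy'
    by_contra! hcon
    simp only [C, Finset.coe_filter, Finset.mem_univ, true_and, Set.mem_ofPred_eq,
      not_exists] at hcon
    have hL : L.Adj (g y).1 (g y').1 := by simpa using g.toHom.map_adj hyy'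
    have h1 := hadj hL
    rcases h2 : f (g y).1 with p | r
    · exact hcon.1 p h2
    rcases h3 : f (g y').1 with p | r'
    · exact hcon.2 p h3
    rw [h2, h3, graphJoin_adj_inr] at h1
    have hb : ∀ {y r}, f (g y).1 = .inr r → c r = true := by
      intro y r h
      by_contra hcr
      exact (g y).2 ⟨r, h, by simpa using hcr⟩
    exact hc _ _ h1 ((hb h2).trans (hb h3).symm)
  have hCcard : C.card < qTilde L := by
    have h1 := Fintype.card_le_of_injective φ hφinj
    simp only [Fintype.card_fin, Finset.coe_sort_coe, Fintype.card_coe] at h1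
    omega
  -- The covering just found shows that the convention `{K_q}` is not in force.
  have hnot : ¬ ∀ L' ∈ twoDecompositionFamily L,
      (indepCoveringNumber (twoDecompositionFamily L) : ℕ∞) ≤ L'.2.vertexCoverNum := by
    intro hall
    have h1 := (hall M hM).trans hcov.vertexCoverNum_le
    rw [Set.encard_coe_eq_coe_finsetCard] at h1
    have h2 : qTilde L ≤ C.card := by exact_mod_cast h1
    omega
  let e : (C : Set (Fin M.1)) ≃ Fin C.card := C.equivFin
  refine hQ ⟨C.card, (M.2.induce (C : Set (Fin M.1))).map e⟩ ?_ ?_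
  · unfold BTilde subgraphCoveringFamily
    rw [if_neg hnot]
    exact ⟨M, hM, C, hcov, hCcard, ⟨(Iso.map e _).symm⟩⟩
  · refine (Iso.map e (M.2.induce (C : Set (Fin M.1)))).symm.isContained.trans ?_
    refine ⟨⟨⟨φ, ?_⟩, hφinj⟩⟩
    intro y y' h
    have h0 : M.2.Adj y y' := h
    have hL : L.Adj (g y).1 (g y').1 := by simpa using g.toHom.map_adj h0
    have h1 := hadj hL
    rwa [hφ, hφ, graphJoin_adj_inl] at h1

end Free

/-! ### What independent coverings say about the graph `H` -/

section Structure

variable {W : Type*} {H : SimpleGraph W} {ℓ : H.edgeSet → ℕ}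

lemma exists_orientation {Q : H.edgeSet → W → W → Prop}
    (h : ∀ e : H.edgeSet, ∃ a b, s(a, b) = e.1 ∧ Q e a b) :
    ∃ o : EdgeOrientation H, ∀ e, Q e (o.src e) (o.dst e) := by
  choose a b h1 h2 using h
  exact ⟨⟨a, b, h1⟩, h2⟩

lemma exists_orientation_of_coloring {c : W → Bool} (hc : ∀ a b, H.Adj a b → c a ≠ c b) :
    ∃ o : EdgeOrientation H, ∀ e, c (o.src e) = true ∧ c (o.dst e) = false := by
  refine exists_orientation (Q := fun _ a b => c a = true ∧ c b = false) fun ⟨e, he⟩ => ?_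
  induction e with
  | _ a b =>
    have := hc a b he
    cases ha : c a <;> cases hb : c b
    · simp_all
    · exact ⟨b, a, Sym2.eq_swap, hb, ha⟩
    · exact ⟨a, b, rfl, ha, hb⟩
    · simp_all

lemma exists_orientation_of_mem (P : W → Prop) :
    ∃ o : EdgeOrientation H, ∀ e, (∃ u ∈ e.1, P u) → P (o.src e) := by
  refine exists_orientation (Q := fun e a _ => (∃ u ∈ e.1, P u) → P a) fun ⟨e, he⟩ => ?_
  induction e with
  | _ a b =>
    by_cases ha : P a
    · exact ⟨a, b, rfl, fun _ => ha⟩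
    · refine ⟨b, a, Sym2.eq_swap, ?_⟩
      rintro ⟨u, hu, hPu⟩
      rcases Sym2.mem_iff.1 hu with rfl | rfl
      exacts [absurd hPu ha, hPu]

lemma EdgeOrientation.mem_iff (o : EdgeOrientation H) {e : H.edgeSet} {u : W} :
    u ∈ e.1 ↔ u = o.src e ∨ u = o.dst e := by
  rw [← o.mk_eq e, Sym2.mem_iff]

/-- Every vertex set that leaves a bipartite graph meets every cycle that replaces an edge. -/
lemma exists_mem_cycle (o : EdgeOrientation H) {e : H.edgeSet} (hℓ : Odd (ℓ e)) (h5 : 5 ≤ ℓ e)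
    {S : Set (BVert H ℓ)} {c : BVert H ℓ → Bool}
    (hc : ∀ a b, (oddBallooning H ℓ).Adj a b → a ∉ S → b ∉ S → c a ≠ c b)
    (hi : ∀ i, (.inr ⟨e, i⟩ : BVert H ℓ) ∉ S) :
    ∃ i, (oddBallooning H ℓ).Adj (.inl (o.src e)) (.inr ⟨e, i⟩) ∧
      (.inl (o.dst e) ∉ S → c (.inl (o.dst e)) ≠ c (.inr ⟨e, i⟩)) ∧
      (.inl (o.src e) ∉ S → c (.inl (o.src e)) ≠ c (.inr ⟨e, i⟩)) := by
  obtain ⟨i₀, h0⟩ := o.exists_pos (ℓ := ℓ) e (j := 0) (by omega)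
  obtain ⟨i₁, h1⟩ := o.exists_pos (ℓ := ℓ) e (j := ℓ e - 3) (by omega)
  have h1' : o.pos e i₁ + 3 = ℓ e := by omega
  have h2 := coloring_pos o hℓ (c := c) (fun i j h => hc _ _ h (hi i) (hi j)) h0 h1'
  have hadj : (oddBallooning H ℓ).Adj (.inl (o.src e)) (.inr ⟨e, i₀⟩) :=
    (ballooning_adj_inl_inr o).2 (.inl ⟨rfl, h0⟩)
  refine ⟨i₀, hadj, fun h => ?_, fun h => hc _ _ hadj h (hi _)⟩
  rw [h2]
  exact hc _ _ ((ballooning_adj_inl_inr o).2 (.inr ⟨rfl, h1'⟩)) h (hi _)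

/-- For colouring purposes the cycle is a triangle: the two ends of `e` are adjacent, and the colour
shared by the first and last new vertices would have to differ from both of theirs. -/
lemma exists_mem_cycle' (o : EdgeOrientation H) {e : H.edgeSet} (hℓ : Odd (ℓ e)) (h5 : 5 ≤ ℓ e)
    {S : Set (BVert H ℓ)} {c : BVert H ℓ → Bool}
    (hc : ∀ a b, (oddBallooning H ℓ).Adj a b → a ∉ S → b ∉ S → c a ≠ c b) :
    (∃ i, (.inr ⟨e, i⟩ : BVert H ℓ) ∈ S) ∨ ∃ u ∈ e.1, (.inl u : BVert H ℓ) ∈ S := by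
  by_contra! hcon
  obtain ⟨hi, hu⟩ := hcon
  have hs := hu (o.src e) (o.mem_iff.2 (.inl rfl))
  have hd := hu (o.dst e) (o.mem_iff.2 (.inr rfl))
  obtain ⟨i, -, h1, h2⟩ := exists_mem_cycle o hℓ h5 hc hi
  have h3 := hc _ _ (ballooning_adj_inl.2 (o.adj e)) hs hd
  have h4 := h1 hd
  have h5 := h2 hs
  cases h6 : c (.inl (o.src e)) <;> cases h7 : c (.inl (o.dst e)) <;>
    cases h8 : c (.inr ⟨e, i⟩) <;> simp_all

/-- The old vertices in `S`, and the edges that contain none of these but whose cycle has a new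
vertex in `S`. -/
lemma card_old_add_card_new_le [Finite W] (S : Finset (BVert H ℓ)) :
    ∃ (I : Finset W) (F : Finset H.edgeSet), (∀ u, u ∈ I ↔ (.inl u : BVert H ℓ) ∈ S) ∧
      (∀ e, e ∈ F ↔ (∀ u ∈ I, u ∉ e.1) ∧ ∃ i, (.inr ⟨e, i⟩ : BVert H ℓ) ∈ S) ∧
      I.card + F.card ≤ S.card := by
  classical
  have := Fintype.ofFinite W
  let I : Finset W := Finset.univ.filter fun u => (.inl u : BVert H ℓ) ∈ S
  let F : Finset H.edgeSet := Finset.univ.filter fun e =>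
    (∀ u ∈ I, u ∉ e.1) ∧ ∃ i, (.inr ⟨e, i⟩ : BVert H ℓ) ∈ S
  refine ⟨I, F, by simp [I], by simp [F], ?_⟩
  have hF : ∀ e : F, ∃ i, (.inr ⟨e.1, i⟩ : BVert H ℓ) ∈ S := fun e =>
    (Finset.mem_filter.1 e.2).2.2
  choose i hi using hF
  let φ : I ⊕ F → S := Sum.elim (fun u => ⟨.inl u.1, (Finset.mem_filter.1 u.2).2⟩)
    fun e => ⟨.inr ⟨e.1, i e⟩, hi e⟩
  have hφ : Function.Injective φ := by
    rintro (a | a) (b | b) h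
    · simp only [φ, Sum.elim_inl, Subtype.mk.injEq, Sum.inl.injEq] at h
      rw [Subtype.ext h]
    · simp [φ] at h
    · simp [φ] at h
    · simp only [φ, Sum.elim_inr, Subtype.mk.injEq, Sum.inr.injEq, Sigma.mk.injEq] at h
      rw [Subtype.ext h.1]
  simpa using Fintype.card_le_of_injective φ hφ

/-- The targets together with the new vertices at odd positions form an independent set. Without it
only the edges from sources to the vertices at position zero remain. -/
lemma exists_bipartite_mem [Finite W] (hH : H.IsBipartite) (hℓ : ∀ e, Odd (ℓ e) ∧ 5 ≤ ℓ e) :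
    ∃ M ∈ twoDecompositionFamily (oddBallooning H ℓ), M.2.IsBipartite := by
  classical
  obtain ⟨C⟩ := hH
  let c : W → Bool := fun u => decide (C u = 0)
  have hc : ∀ a b, H.Adj a b → c a ≠ c b := by
    intro a b hab h
    have := C.valid hab
    simp only [c, decide_eq_decide] at h
    omega
  obtain ⟨o, ho⟩ := exists_orientation_of_coloring hc
  let β : BVert H ℓ → Bool := Sum.elim (fun u => !c u) fun p => decide (o.pos p.1 p.2 % 2 = 1)
  let col : BVert H ℓ → Fin 2 := Sum.elim (fun _ => 0)
    fun p => if o.pos p.1 p.2 = 0 then 1 else 0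
  have key : ∀ a b, (oddBallooning H ℓ).Adj a b →
      (β a = true → β b = true → False) ∧ (β a = false → β b = false → col a ≠ col b) := by
    refine ballooning_adj_rec o (fun a b h => ⟨fun h1 h2 => h.1 h2 h1,
      fun h1 h2 => (h.2 h2 h1).symm⟩) ?_ ?_ ?_ ?_
    · intro e
      simp [β, (ho e).1, (ho e).2]
    · intro e i hi
      simp [β, col, (ho e).1, hi]
    · intro e i hi
      have := (hℓ e).1
      have h2 : o.pos e i % 2 = 0 := by
        obtain ⟨r, hr⟩ := this
        omega
      simp [β, (ho e).2, h2]
    · intro e i j hij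
      simp only [β, Sum.elim_inr, decide_eq_true_eq, decide_eq_false_iff_not]
      exact ⟨fun h1 h2 => by omega, fun h1 h2 => by omega⟩
  obtain ⟨M, hM, hle⟩ := exists_mem_twoDecompositionFamily
    (isTwoDecomposing_induce_compl (L := oddBallooning H ℓ) (B := {z | β z = true})
      fun a ha b hb hab => (key a b hab).1 ha hb)
  obtain ⟨g⟩ := hle
  refine ⟨M, hM, ⟨Coloring.mk (fun y => col (g y)) fun {y y'} h => ?_⟩⟩
  have h1 : (oddBallooning H ℓ).Adj (g y).1 (g y').1 := by simpa using g.toHom.map_adj h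
  exact (key _ _ h1).2 (Bool.eq_false_iff.2 (g y).2) (Bool.eq_false_iff.2 (g y').2)

lemma IsBipartite.exists_isIndepCovering {m : ℕ} {M : SimpleGraph (Fin m)} (h : M.IsBipartite) :
    ∃ S : Finset (Fin m), IsIndepCovering M S := by
  classical
  obtain ⟨C⟩ := h
  refine ⟨Finset.univ.filter fun y => C y = 0, ?_, ?_⟩
  · intro a ha b hb _ hab
    have := C.valid hab
    simp at ha hb
    exact this (ha.trans hb.symm)
  · intro a b hab
    have := C.valid hab
    simp only [Finset.coe_filter, Finset.mem_univ, true_and, Set.mem_ofPred_eq]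
    omega

lemma exists_mem_indepCoveringFamily [Finite W] (hH : H.IsBipartite)
    (hℓ : ∀ e, Odd (ℓ e) ∧ 5 ≤ ℓ e) :
    ∃ p, p ∈ indepCoveringFamily (twoDecompositionFamily (oddBallooning H ℓ)) := by
  obtain ⟨M₀, hM₀, hb₀⟩ := exists_bipartite_mem hH hℓ
  obtain ⟨M, hM, hb, hγ⟩ := Nat.sInf_mem (s := {s | ∃ L ∈ twoDecompositionFamily
    (oddBallooning H ℓ), L.2.IsBipartite ∧ indepCoveringNum L.2 = s}) ⟨_, M₀, hM₀, hb₀, rfl⟩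
  obtain ⟨S₀, hS₀⟩ := IsBipartite.exists_isIndepCovering hb
  obtain ⟨S, hS, hcard⟩ := Nat.sInf_mem (s := {s | ∃ S : Finset (Fin M.1),
    IsIndepCovering M.2 S ∧ S.card = s}) ⟨_, S₀, hS₀, rfl⟩
  exact ⟨⟨M, S⟩, hM, hb, hS, hcard.trans hγ⟩

/-- The preimage of a subset of `M` under an embedding into `(M ∪ I_s) ∨ I_s`. -/
lemma exists_preimage [Finite W] {m s : ℕ} {M : SimpleGraph (Fin m)}
    (f : Copy (oddBallooning H ℓ)
      (graphJoin (M ⊕g (⊥ : SimpleGraph (Fin s))) (⊥ : SimpleGraph (Fin s))))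
    (S : Finset (Fin m)) : ∃ S' : Finset (BVert H ℓ),
      (∀ z, z ∈ S' ↔ ∃ y ∈ S, f z = .inl (.inl y)) ∧ S'.card ≤ S.card := by
  classical
  have := Fintype.ofFinite (BVert H ℓ)
  refine ⟨Finset.univ.filter fun z => ∃ y ∈ S, f z = .inl (.inl y), by simp, ?_⟩
  have h1 : ((Finset.univ.filter fun z => ∃ y ∈ S, f z = .inl (.inl y)).image f)
      ⊆ S.image fun y => .inl (.inl y) := by
    intro z hz
    simp only [Finset.mem_image, Finset.mem_filter, Finset.mem_univ, true_and] at hz ⊢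
    obtain ⟨z, ⟨y, hy, hzy⟩, rfl⟩ := hz
    exact ⟨y, hy, hzy.symm⟩
  rw [← Finset.card_image_of_injective _ f.injective]
  exact (Finset.card_le_card h1).trans Finset.card_image_le

/-- Once the edges of `M` are destroyed, `(M ∪ I_s) ∨ I_s` is bipartite with the two sides of the
join as colour classes. -/
lemma coloring_of_cover {m s : ℕ} {M : SimpleGraph (Fin m)}
    (f : Copy (oddBallooning H ℓ)
      (graphJoin (M ⊕g (⊥ : SimpleGraph (Fin s))) (⊥ : SimpleGraph (Fin s))))
    {S : Finset (Fin m)} (hS : M.IsVertexCover (S : Set (Fin m))) {S' : Finset (BVert H ℓ)}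
    (hS' : ∀ z, z ∈ S' ↔ ∃ y ∈ S, f z = .inl (.inl y)) :
    ∀ a b, (oddBallooning H ℓ).Adj a b → a ∉ (S' : Set (BVert H ℓ)) →
      b ∉ (S' : Set (BVert H ℓ)) → (f a).isLeft ≠ (f b).isLeft := by
  intro a b hab ha hb
  have h := f.toHom.map_adj hab
  simp only [Finset.mem_coe, hS', not_exists, not_and] at ha hb
  change (graphJoin _ _).Adj (f a) (f b) at h
  rcases hfa : f a with (y | i) | i <;> rcases hfb : f b with (y' | j) | j <;>
    rw [hfa, hfb] at h
  · rw [graphJoin_adj_inl] at h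
    rcases hS (show M.Adj y y' by simpa using h) with h1 | h1
    exacts [absurd hfa (ha y h1), absurd hfb (hb y' h1)]
  all_goals simp_all [graphJoin]

/-- The preimage of a minimum independent covering meets every odd cycle. Its old vertices form `I`;
the edges not meeting `I` whose cycles are met in new vertices form `F`. -/
theorem exists_cover_structure [Finite W] (hH : H.IsBipartite)
    (hℓ : ∀ e, Odd (ℓ e) ∧ 5 ≤ ℓ e) :
    ∃ (I : Finset W) (F : Finset H.edgeSet), (∀ u ∈ I, ∀ v ∈ I, ¬ H.Adj u v) ∧
      (∀ e, e ∉ F → ∃ u ∈ I, u ∈ e.1) ∧ (∀ e ∈ F, ∀ u ∈ I, u ∉ e.1) ∧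
      I.card + F.card ≤ qTilde (oddBallooning H ℓ) := by
  classical
  obtain ⟨⟨M, S⟩, hM, -, ⟨hSi, hSc⟩, hcard⟩ := exists_mem_indepCoveringFamily hH hℓ
  obtain ⟨s, ⟨f⟩⟩ := hM.1
  obtain ⟨S', hS', hS'c⟩ := exists_preimage f S
  obtain ⟨I, F, hI, hF, hIF⟩ := card_old_add_card_new_le S'
  refine ⟨I, F, fun u hu v hv huv => ?_, fun e he => ?_, fun e he => ((hF e).1 he).1, ?_⟩
  · obtain ⟨y, hy, hfy⟩ := (hS' _).1 ((hI u).1 hu)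
    obtain ⟨y', hy', hfy'⟩ := (hS' _).1 ((hI v).1 hv)
    have h := f.toHom.map_adj (ballooning_adj_inl.2 huv)
    change (graphJoin _ _).Adj (f _) (f _) at h
    rw [hfy, hfy', graphJoin_adj_inl] at h
    have h' : M.2.Adj y y' := by simpa using h
    exact hSi hy hy' h'.ne h'
  · obtain ⟨o, -⟩ := exists_orientation_of_mem (H := H) fun _ => True
    rcases exists_mem_cycle' o (hℓ e).1 (hℓ e).2 (coloring_of_cover f hSc hS') with h | h
    · by_contra! hcon
      exact he ((hF e).2 ⟨hcon, h⟩)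
    · obtain ⟨u, hu, huS⟩ := h
      exact ⟨u, (hI u).2 huS, hu⟩
  · have : qTilde (oddBallooning H ℓ) = S.card := hcard.symm
    omega

lemma one_le_qTilde [Finite W] (hH : H.IsBipartite) (hne : H ≠ ⊥)
    (hℓ : ∀ e, Odd (ℓ e) ∧ 5 ≤ ℓ e) : 1 ≤ qTilde (oddBallooning H ℓ) := by
  obtain ⟨I, F, -, h1, -, h2⟩ := exists_cover_structure hH hℓ
  by_contra hcon
  have hI : I = ∅ := by rw [← Finset.card_eq_zero]; omega
  have hF : F = ∅ := by rw [← Finset.card_eq_zero]; omega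
  obtain ⟨a, b, hab⟩ := ne_bot_iff_exists_adj.1 hne
  obtain ⟨u, hu, -⟩ := h1 ⟨s(a, b), hab⟩ (by simp [hF])
  simp [hI] at hu

/-- Remove from a minimum independent covering the vertex `x` of least degree `k`. The cycles of `U`
are no longer met, so each contains the preimage of `x`. If that is a new vertex, there is only one
such cycle. If it is an old vertex `y₀`, each cycle of `U` without `y₀` is a path of even order that
alternates between the sides of the join, so one of its two ends lands on the side of `x` and hence
on a neighbour of `x` in `M`. These neighbours are distinct, so there are at most `k` cycles. The
bound is written `k - 1 + 1` because a single cycle satisfies it whatever `k` is. -/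
theorem exists_star_structure [Finite W] (hH : H.IsBipartite) (hne : H ≠ ⊥)
    (hℓ : ∀ e, Odd (ℓ e) ∧ 5 ≤ ℓ e) :
    ∃ (I : Finset W) (F U : Finset H.edgeSet) (y₀ : W), (∀ u ∈ I, ∀ v ∈ I, ¬ H.Adj u v) ∧
      (∀ e, e ∉ F → e ∉ U → ∃ u ∈ I, u ∈ e.1) ∧ (∀ e ∈ F, ∀ u ∈ I, u ∉ e.1) ∧
      (∀ e ∈ U, ∀ u ∈ I, u ∉ e.1) ∧ Disjoint F U ∧ (∀ e ∈ U, y₀ ∈ e.1) ∧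
      I.card + F.card + 1 ≤ qTilde (oddBallooning H ℓ) ∧
      U.card ≤ kParam (oddBallooning H ℓ) - 1 + 1 ∧
      (U.card ≤ 1 ∨ ∀ u ∈ I, ¬ H.Adj y₀ u) := by
  classical
  have := Fintype.ofFinite W
  have hq := one_le_qTilde hH hne hℓ
  obtain ⟨p₀, hp₀⟩ := exists_mem_indepCoveringFamily hH hℓ
  obtain ⟨x₀, hx₀⟩ : p₀.2.Nonempty := by
    rw [← Finset.card_pos]
    have h1 := hp₀.2.2.2
    have : qTilde (oddBallooning H ℓ) = p₀.2.card := h1.symm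
    omega
  obtain ⟨⟨M, S⟩, ⟨hM, -, ⟨hSi, hSc⟩, hcard⟩, x, hx, hk⟩ := Nat.sInf_mem
    (s := {d | ∃ p ∈ indepCoveringFamily (twoDecompositionFamily (oddBallooning H ℓ)),
      ∃ x ∈ p.2, (p.1.2.neighborSet x).ncard = d}) ⟨_, p₀, hp₀, x₀, hx₀, rfl⟩
  change (M.2.neighborSet x).ncard = kParam (oddBallooning H ℓ) at hk
  change S.card = qTilde (oddBallooning H ℓ) at hcard
  change x ∈ S at hx
  obtain ⟨s, ⟨f⟩⟩ := hM.1
  obtain ⟨S', hS', hS'c⟩ := exists_preimage f S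
  obtain ⟨S'', hS'', hS''c⟩ := exists_preimage f (S.erase x)
  obtain ⟨I, F, hI, hF, hIF⟩ := card_old_add_card_new_le S''
  have hsub : ∀ z, z ∈ S' → z ∈ S'' ∨ f z = .inl (.inl x) := by
    intro z hz
    obtain ⟨y, hy, hzy⟩ := (hS' z).1 hz
    by_cases hyx : y = x
    · exact .inr (hyx ▸ hzy)
    · exact .inl ((hS'' z).2 ⟨y, Finset.mem_erase.2 ⟨hyx, hy⟩, hzy⟩)
  have hsub' : ∀ z, z ∈ S'' → z ∈ S' := by
    intro z hz
    obtain ⟨y, hy, hzy⟩ := (hS'' z).1 hz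
    exact (hS' z).2 ⟨y, Finset.mem_of_mem_erase hy, hzy⟩
  have hind : ∀ a ∈ S', ∀ b ∈ S', ¬ (oddBallooning H ℓ).Adj a b := by
    intro a ha b hb hab
    obtain ⟨y, hy, hfy⟩ := (hS' _).1 ha
    obtain ⟨y', hy', hfy'⟩ := (hS' _).1 hb
    have h := f.toHom.map_adj hab
    change (graphJoin _ _).Adj (f _) (f _) at h
    rw [hfy, hfy', graphJoin_adj_inl] at h
    have h' : M.2.Adj y y' := by simpa using h
    exact hSi hy hy' h'.ne h'
  have hcol := coloring_of_cover f hSc hS'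
  let U : Finset H.edgeSet := Finset.univ.filter fun e =>
    (∀ u ∈ I, u ∉ e.1) ∧ ∀ i, (.inr ⟨e, i⟩ : BVert H ℓ) ∉ S''
  have hU : ∀ e, e ∈ U ↔ (∀ u ∈ I, u ∉ e.1) ∧ ∀ i, (.inr ⟨e, i⟩ : BVert H ℓ) ∉ S'' := by
    simp [U]
  have hcardI : I.card + F.card + 1 ≤ qTilde (oddBallooning H ℓ) := by
    rw [Finset.card_erase_of_mem hx] at hS''c
    omega
  suffices h : ∃ y₀ : W, (∀ e ∈ U, y₀ ∈ e.1) ∧ U.card ≤ kParam (oddBallooning H ℓ) - 1 + 1 ∧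
      (U.card ≤ 1 ∨ ∀ u ∈ I, ¬ H.Adj y₀ u) by
    obtain ⟨y₀, h1, h2, h3⟩ := h
    refine ⟨I, F, U, y₀, fun u hu v hv huv => ?_, fun e he he' => ?_,
      fun e he => ((hF e).1 he).1, fun e he => ((hU e).1 he).1, ?_, h1, hcardI, h2, h3⟩
    · exact hind _ (hsub' _ ((hI u).1 hu)) _ (hsub' _ ((hI v).1 hv)) (ballooning_adj_inl.2 huv)
    · by_contra! hcon
      rw [hU] at he'
      push Not at he'
      exact he ((hF e).2 ⟨hcon, he' hcon⟩)
    · rw [Finset.disjoint_left]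
      intro e he he'
      obtain ⟨i, hi⟩ := ((hF e).1 he).2
      exact ((hU e).1 he').2 i hi
  rcases U.eq_empty_or_nonempty with hU0 | ⟨e₀, he₀⟩
  · obtain ⟨a, -, -⟩ := ne_bot_iff_exists_adj.1 hne
    exact ⟨a, by simp [hU0], by simp [hU0], by simp [hU0]⟩
  have huniq : ∀ a b, f a = .inl (.inl x) → f b = .inl (.inl x) → a = b :=
    fun a b ha hb => f.injective (ha.trans hb.symm)
  obtain ⟨o₁, -⟩ := exists_orientation_of_mem (H := H) fun _ => True
  have hhit : ∀ e ∈ U, (∃ i, f (.inr ⟨e, i⟩) = .inl (.inl x)) ∨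
      ∃ u ∈ e.1, f (.inl u) = .inl (.inl x) := by
    intro e he
    obtain ⟨h1, h2⟩ := (hU e).1 he
    rcases exists_mem_cycle' o₁ (hℓ e).1 (hℓ e).2 hcol with ⟨i, hi⟩ | ⟨u, hu, huS⟩
    · exact .inl ⟨i, (hsub _ hi).resolve_left (h2 i)⟩
    · exact .inr ⟨u, hu, (hsub _ huS).resolve_left fun h => h1 u ((hI u).2 h) hu⟩
  rcases hhit e₀ he₀ with ⟨i, hi⟩ | ⟨y₀, hy₀, hfy₀⟩
  · have hone : ∀ e ∈ U, e = e₀ := by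
      intro e he
      rcases hhit e he with ⟨j, hj⟩ | ⟨u, -, hu⟩
      · have := huniq _ _ hj hi
        simp only [Sum.inr.injEq, Sigma.mk.injEq] at this
        exact this.1
      · exact absurd (huniq _ _ hu hi) (by simp)
    have hUc : U.card ≤ 1 := Finset.card_le_one.2 fun a ha b hb => (hone a ha).trans (hone b hb).symm
    refine ⟨o₁.src e₀, fun e he => ?_, by omega, .inl hUc⟩
    rw [hone e he]
    exact o₁.mem_iff.2 (.inl rfl)
  · have hmem : ∀ e ∈ U, y₀ ∈ e.1 := by
      intro e he
      rcases hhit e he with ⟨j, hj⟩ | ⟨u, hu, hu'⟩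
      · exact absurd (huniq _ _ hj hfy₀) (by simp)
      · have := huniq _ _ hu' hfy₀
        simp only [Sum.inl.injEq] at this
        exact this ▸ hu
    have hy₀S : (.inl y₀ : BVert H ℓ) ∈ S' := (hS' _).2 ⟨x, hx, hfy₀⟩
    refine ⟨y₀, hmem, ?_, .inr fun u hu huv => ?_⟩
    swap
    · exact hind _ hy₀S _ (hsub' _ ((hI u).1 hu)) (ballooning_adj_inl.2 huv)
    obtain ⟨o, ho⟩ := exists_orientation_of_mem (H := H) fun u => u = y₀
    have hsrc : ∀ e ∈ U, o.src e = y₀ := fun e he => ho e ⟨y₀, hmem e he, rfl⟩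
    have hex : ∀ e : U, ∃ z, (oddBallooning H ℓ).Adj (.inl y₀) z ∧ (f z).isLeft = true ∧
        (z = .inl (o.dst e.1) ∨ ∃ i, z = .inr ⟨e.1, i⟩) := by
      rintro ⟨e, he⟩
      have h1 : ∀ i, (.inr ⟨e, i⟩ : BVert H ℓ) ∉ (S' : Set (BVert H ℓ)) := by
        intro i hi
        rcases hsub _ hi with h | h
        · exact ((hU e).1 he).2 i h
        · exact absurd (huniq _ _ h hfy₀) (by simp)
      have h2 : (.inl (o.dst e) : BVert H ℓ) ∉ (S' : Set (BVert H ℓ)) := fun h =>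
        hind _ hy₀S _ h (ballooning_adj_inl.2 (hsrc e he ▸ o.adj e))
      obtain ⟨i, h3, h4, -⟩ := exists_mem_cycle o (hℓ e).1 (hℓ e).2 hcol h1
      rw [hsrc e he] at h3
      have h5 := h4 h2
      by_cases h6 : (f (.inl (o.dst e))).isLeft = true
      · exact ⟨_, ballooning_adj_inl.2 (hsrc e he ▸ o.adj e), h6, .inl rfl⟩
      · refine ⟨_, h3, ?_, .inr ⟨i, rfl⟩⟩
        by_contra h7
        rw [Bool.not_eq_true] at h6 h7
        exact h5 (h6.trans h7.symm)
    choose z hz1 hz2 hz3 using hex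
    have hzinj : Function.Injective z := by
      intro e e' h
      rcases hz3 e with h1 | ⟨i, h1⟩ <;> rcases hz3 e' with h2 | ⟨j, h2⟩
      · have h3 : o.dst e.1 = o.dst e'.1 := Sum.inl_injective ((h1.symm.trans h).trans h2)
        refine Subtype.ext (Subtype.ext ?_)
        rw [← o.mk_eq e.1, ← o.mk_eq e'.1, h3, hsrc _ e.2, hsrc _ e'.2]
      · exact absurd ((h1.symm.trans h).trans h2) (by exact Sum.inl_ne_inr)
      · exact absurd ((h1.symm.trans h).trans h2) (by exact Sum.inr_ne_inl)
      · have h3 := (h1.symm.trans h).trans h2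
        simp only [Sum.inr.injEq, Sigma.mk.injEq] at h3
        exact Subtype.ext h3.1
    have hy : ∀ e, ∃ y : M.2.neighborSet x, f (z e) = .inl (.inl y.1) := by
      intro e
      have h1 := f.toHom.map_adj (hz1 e)
      change (graphJoin _ _).Adj (f _) (f _) at h1
      have h2 := hz2 e
      rw [hfy₀] at h1
      rcases h3 : f (z e) with (y | j) | j
      · rw [h3, graphJoin_adj_inl] at h1
        exact ⟨⟨y, by simpa using h1⟩, rfl⟩
      · rw [h3, graphJoin_adj_inl] at h1
        simp at h1
      · rw [h3] at h2
        simp at h2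
    choose y hy using hy
    have hyinj : Function.Injective y := by
      intro e e' h
      exact hzinj (f.injective ((hy e).trans (h ▸ (hy e').symm)))
    have := Nat.card_le_card_of_injective y hyinj
    rw [Nat.card_coe_set_eq, hk, Nat.card_eq_fintype_card, Fintype.card_coe] at this
    omega

end Structure

end Ballooning

namespace Ballooning

/-! ### Common neighbourhoods and large bicliques -/

section Pigeonhole

variable {V : Type*} {G : SimpleGraph V}

lemma exists_large_fiber {α : Type*} {s : Finset α} (hs : s.Nonempty) {U : Finset V}
    [DecidableEq (Finset V)] {f : α → Finset V} (hf : ∀ a ∈ s, f a ⊆ U) :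
    ∃ a₀ ∈ s, s.card ≤ 2 ^ U.card * (s.filter fun a => f a = f a₀).card := by
  obtain ⟨a₀, ha₀, hmax⟩ := Finset.exists_max_image s
    (fun a₀ => (s.filter fun a => f a = f a₀).card) hs
  refine ⟨a₀, ha₀, ?_⟩
  have h1 := Finset.card_le_mul_card_image_of_maps_to (s := s) (t := s.image f) (f := f)
    (fun a ha => Finset.mem_image_of_mem f ha) (s.filter fun a => f a = f a₀).card (by
      intro b hb
      obtain ⟨a, ha, rfl⟩ := Finset.mem_image.1 hb
      exact hmax a ha)
  have h2 : (s.image f).card ≤ 2 ^ U.card := by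
    rw [← Finset.card_powerset]
    refine Finset.card_le_card fun b hb => ?_
    obtain ⟨a, ha, rfl⟩ := Finset.mem_image.1 hb
    exact Finset.mem_powerset.2 (hf a ha)
  calc s.card ≤ _ := h1
    _ ≤ _ := by rw [mul_comm]; exact Nat.mul_le_mul_right _ h2

open scoped Classical in
/-- The vertices of `X` adjacent to all vertices of `Q`. -/
noncomputable def commonIn (G : SimpleGraph V) (Q X : Finset V) : Finset V :=
  X.filter fun x => ∀ v ∈ Q, G.Adj v x

lemma mem_commonIn {Q X : Finset V} {x : V} :
    x ∈ commonIn G Q X ↔ x ∈ X ∧ ∀ v ∈ Q, G.Adj v x := by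
  classical
  simp [commonIn]

lemma commonIn_subset (Q X : Finset V) : commonIn G Q X ⊆ X := fun _ h => (mem_commonIn.1 h).1

lemma missIn_commonIn {Q X : Finset V} {v : V} (hv : v ∈ Q) : missIn G v (commonIn G Q X) = 0 :=
  missIn_eq_zero.2 fun _ hy => (mem_commonIn.1 hy).2 v hv

/-- Fix `2 * h * κ ^ 2` vertices of `S`. A pair in `X ×ˢ Y` is joined to at least `2 * h` of them on
average, so a proportion of at least `1 / (2 * κ ^ 2)` of the pairs is joined to `h` or more. The
most frequent trace of such pairs is `Q`; all pairs with this trace lie in the product of the two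
common neighbourhoods. -/
theorem exists_commonIn {κ h : ℕ} (hκ : 0 < κ) (hh : 0 < h) {S X Y : Finset V}
    (hS : 2 * h * κ ^ 2 ≤ S.card) (hX : X.Nonempty) (hY : Y.Nonempty)
    (hSX : ∀ v ∈ S, X.card ≤ κ * degIn G v X) (hSY : ∀ v ∈ S, Y.card ≤ κ * degIn G v Y) :
    ∃ Q ⊆ S, h ≤ Q.card ∧
      X.card ≤ 2 * κ ^ 2 * 2 ^ (2 * h * κ ^ 2) * (commonIn G Q X).card ∧
      Y.card ≤ 2 * κ ^ 2 * 2 ^ (2 * h * κ ^ 2) * (commonIn G Q Y).card := by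
  classical
  obtain ⟨S', hS', hcard⟩ := Finset.exists_subset_card_eq hS
  set N := 2 * h * κ ^ 2 with hN
  let pat : V × V → Finset V := fun p => S'.filter fun v => G.Adj v p.1 ∧ G.Adj v p.2
  have hpatcard : ∀ p, (pat p).card ≤ N := fun p => hcard ▸ Finset.card_filter_le _ _
  have hdc : ∑ p ∈ X ×ˢ Y, (pat p).card = ∑ v ∈ S', degIn G v X * degIn G v Y := by
    have := Finset.sum_card_bipartiteAbove_eq_sum_card_bipartiteBelow (s := X ×ˢ Y) (t := S')
      (fun p v => G.Adj v p.1 ∧ G.Adj v p.2)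
    unfold Finset.bipartiteAbove Finset.bipartiteBelow at this
    rw [this]
    refine Finset.sum_congr rfl fun v _ => ?_
    unfold degIn
    rw [← Finset.card_product, Finset.filter_product]
  have h1 : N * (X.card * Y.card) ≤ κ ^ 2 * ∑ p ∈ X ×ˢ Y, (pat p).card := by
    rw [hdc, Finset.mul_sum, ← hcard, ← smul_eq_mul]
    refine Finset.card_nsmul_le_sum _ _ _ fun v hv => ?_
    calc X.card * Y.card ≤ (κ * degIn G v X) * (κ * degIn G v Y) :=
          Nat.mul_le_mul (hSX v (hS' hv)) (hSY v (hS' hv))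
      _ = κ ^ 2 * (degIn G v X * degIn G v Y) := by ring
  set good := (X ×ˢ Y).filter fun p => h ≤ (pat p).card with hgood
  have h2 : ∑ p ∈ X ×ˢ Y, (pat p).card ≤ N * good.card + h * (X.card * Y.card) := by
    calc ∑ p ∈ X ×ˢ Y, (pat p).card ≤ ∑ p ∈ X ×ˢ Y, ((if h ≤ (pat p).card then N else 0) + h) := by
          refine Finset.sum_le_sum fun p _ => ?_
          have := hpatcard p
          split_ifs <;> omega
      _ = _ := by
          rw [Finset.sum_add_distrib, ← Finset.sum_filter, Finset.sum_const, Finset.sum_const,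
            Finset.card_product, smul_eq_mul, smul_eq_mul]
          ring
  have hpos : 0 < X.card * Y.card := Nat.mul_pos hX.card_pos hY.card_pos
  have h3 : X.card * Y.card ≤ 2 * κ ^ 2 * good.card := by
    have h4 : N * (X.card * Y.card) ≤ κ ^ 2 * (N * good.card + h * (X.card * Y.card)) :=
      h1.trans (Nat.mul_le_mul_left _ h2)
    have h5 : (h * κ ^ 2) * (X.card * Y.card) ≤ (h * κ ^ 2) * (2 * κ ^ 2 * good.card) := by
      rw [hN] at h4
      nlinarith
    exact Nat.le_of_mul_le_mul_left h5 (by positivity)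
  have hne : good.Nonempty := by
    rw [← Finset.card_pos]
    by_contra hcon
    have : good.card = 0 := by omega
    rw [this] at h3
    omega
  obtain ⟨p₀, hp₀, hfib⟩ := exists_large_fiber hne (U := S') (f := pat)
    fun p _ => Finset.filter_subset _ _
  rw [hcard] at hfib
  have hfib2 : (good.filter fun p => pat p = pat p₀).card
      ≤ (commonIn G (pat p₀) X).card * (commonIn G (pat p₀) Y).card := by
    rw [← Finset.card_product]
    refine Finset.card_le_card fun p hp => ?_
    rw [Finset.mem_filter] at hp
    have hp1 := Finset.mem_product.1 (Finset.mem_filter.1 hp.1).1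
    rw [Finset.mem_product, mem_commonIn, mem_commonIn, ← hp.2]
    exact ⟨⟨hp1.1, fun v hv => (Finset.mem_filter.1 hv).2.1⟩,
      ⟨hp1.2, fun v hv => (Finset.mem_filter.1 hv).2.2⟩⟩
  have hall : X.card * Y.card ≤ 2 * κ ^ 2 * 2 ^ N *
      ((commonIn G (pat p₀) X).card * (commonIn G (pat p₀) Y).card) := by
    calc X.card * Y.card ≤ 2 * κ ^ 2 * good.card := h3
      _ ≤ 2 * κ ^ 2 * (2 ^ N *
          ((commonIn G (pat p₀) X).card * (commonIn G (pat p₀) Y).card)) :=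
          Nat.mul_le_mul_left _ (hfib.trans (Nat.mul_le_mul_left _ hfib2))
      _ = _ := by ring
  refine ⟨pat p₀, (Finset.filter_subset _ _).trans hS', (Finset.mem_filter.1 hp₀).2, ?_, ?_⟩
  · refine Nat.le_of_mul_le_mul_right (hall.trans ?_) hY.card_pos
    rw [mul_assoc (2 * κ ^ 2 * 2 ^ N)]
    exact Nat.mul_le_mul_left _ (Nat.mul_le_mul_left _
      (Finset.card_le_card (commonIn_subset _ _)))
  · refine Nat.le_of_mul_le_mul_left (hall.trans ?_) hX.card_pos
    rw [← mul_assoc, mul_comm _ (commonIn G (pat p₀) X).card, mul_assoc]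
    exact Nat.mul_le_mul_right _ (Finset.card_le_card (commonIn_subset _ _))

/-- A graph with minimum degree about half its order contains a large complete bipartite graph. -/
theorem exists_biclique [Fintype V] (T : ℕ) (hT : 0 < T)
    (hn : 4 * T + 4 * 2 ^ (4 * T) * T + 2 ≤ Fintype.card V)
    (hdeg : ∀ v : V, Fintype.card V ≤ 2 * degIn G v Finset.univ + 1) :
    ∃ X Y : Finset V, X.card = T ∧ Y.card = T ∧ ∀ x ∈ X, ∀ y ∈ Y, G.Adj x y := by
  classical
  obtain ⟨U, -, hU⟩ := Finset.exists_subset_card_eq (s := (Finset.univ : Finset V)) (n := 4 * T)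
    (by rw [Finset.card_univ]; omega)
  set n := Fintype.card V with hn'
  have h1 : U.card * n ≤ 2 * ∑ p : V, degIn G p U + U.card := by
    rw [← sum_degIn_comm, Finset.mul_sum]
    calc U.card * n = ∑ u ∈ U, n := by rw [Finset.sum_const, smul_eq_mul]
      _ ≤ ∑ u ∈ U, (2 * degIn G u Finset.univ + 1) := Finset.sum_le_sum fun u _ => hdeg u
      _ = _ := by rw [Finset.sum_add_distrib, Finset.sum_const, smul_eq_mul, mul_one]
  -- A vertex has about `2 * T` or more neighbours in the `4 * T` vertices of `U` on average, so
  -- about a quarter of all vertices have at least `T`. One of the `2 ^ (4 * T)` possible traces is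
  -- shared by `T` of them.
  set good := (Finset.univ : Finset V).filter fun p => T ≤ degIn G p U with hgood
  have h2 : ∑ p : V, degIn G p U ≤ 4 * T * good.card + T * n := by
    calc ∑ p : V, degIn G p U ≤ ∑ p : V, ((if T ≤ degIn G p U then 4 * T else 0) + T) := by
          refine Finset.sum_le_sum fun p _ => ?_
          have := degIn_le_card (G := G) p U
          split_ifs <;> omega
      _ = _ := by
          rw [Finset.sum_add_distrib, ← Finset.sum_filter, Finset.sum_const, Finset.sum_const,
            smul_eq_mul, smul_eq_mul, Finset.card_univ]
          ring
  rw [hU] at h1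
  have h3 : n ≤ 4 * good.card + 2 := by
    have : T * (4 * n) ≤ T * (8 * good.card + 2 * n + 4) := by nlinarith
    have := Nat.le_of_mul_le_mul_left this hT
    omega
  have hgc : 2 ^ (4 * T) * T < good.card + 1 := by
    have : 4 * 2 ^ (4 * T) * T = 4 * (2 ^ (4 * T) * T) := by ring
    omega
  have hne : good.Nonempty := by
    rw [← Finset.card_pos]
    have : 0 < 2 ^ (4 * T) * T := by positivity
    omega
  obtain ⟨p₀, hp₀, hfib⟩ := exists_large_fiber hne (U := U) (f := fun p => nbrIn G p U)
    fun p _ => fun y hy => (mem_nbrIn.1 hy).1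
  rw [hU] at hfib
  have h4 : T ≤ (good.filter fun a => nbrIn G a U = nbrIn G p₀ U).card := by
    have : 2 ^ (4 * T) * T ≤ 2 ^ (4 * T) *
        (good.filter fun a => nbrIn G a U = nbrIn G p₀ U).card := by omega
    exact Nat.le_of_mul_le_mul_left this (by positivity)
  obtain ⟨Y, hY, hYc⟩ := Finset.exists_subset_card_eq h4
  obtain ⟨X, hX, hXc⟩ := Finset.exists_subset_card_eq (s := nbrIn G p₀ U) (n := T)
    (by rw [card_nbrIn]; exact (Finset.mem_filter.1 hp₀).2)
  refine ⟨X, Y, hXc, hYc, fun x hx y hy => ?_⟩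
  have h5 := (Finset.mem_filter.1 (hY hy)).2
  have h6 := hX hx
  rw [← h5] at h6
  exact (mem_nbrIn.1 h6).2.symm

end Pigeonhole

/-! ### Embeddings with one defect per cycle -/

section Embeddings

variable {W V : Type*} {H : SimpleGraph W} {ℓ : H.edgeSet → ℕ}

lemma exists_coloring (hH : H.IsBipartite) (y₀ : W) :
    ∃ c : W → Bool, (∀ a b, H.Adj a b → c a ≠ c b) ∧ c y₀ = true := by
  classical
  obtain ⟨C⟩ := hH
  refine ⟨fun u => decide (C u = C y₀), fun a b hab h => ?_, by simp⟩
  have := C.valid hab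
  simp only [decide_eq_decide] at h
  omega

lemma exists_coloring' (hH : H.IsBipartite) :
    ∃ c : W → Bool, ∀ a b, H.Adj a b → c a ≠ c b := by
  classical
  obtain ⟨C⟩ := hH
  refine ⟨fun u => decide (C u = 0), fun a b hab h => ?_⟩
  have := C.valid hab
  simp only [decide_eq_decide] at h
  omega

/-- Finitely many vertices with many common neighbours in both classes. -/
theorem isContained_of_hubs [Finite W] (hH : H.IsBipartite) (hℓ : ∀ e, Odd (ℓ e) ∧ 5 ≤ ℓ e)
    (G : SimpleGraph V) (X : Bool → Finset V) (C : ℕ)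
    (hX : ∀ b, ∀ v ∈ X b, missIn G v (X (!b)) ≤ C) (Q : Finset V)
    (hQ : Nat.card H.edgeSet ≤ Q.card)
    (hY : ∀ b, (C + 1) * Nat.card (BVert H ℓ) ≤ (commonIn G Q (X b)).card) :
    oddBallooning H ℓ ⊑ G := by
  classical
  have := Fintype.ofFinite W
  obtain ⟨c, hc⟩ := exists_coloring' hH
  obtain ⟨o, ho⟩ := exists_orientation_of_coloring hc
  obtain ⟨ω⟩ : Nonempty (H.edgeSet ↪ Q) := by
    refine Function.Embedding.nonempty_of_card_le ?_
    rw [Fintype.card_coe, ← Nat.card_eq_fintype_card]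
    exact hQ
  refine isContained_of_kinds o hℓ G X C hX c (fun e => (ho e).1) (fun e => (ho e).2)
    (commonIn G Q (X true)) (commonIn G Q (X false)) (fun _ => commonIn G Q (X false))
    (commonIn_subset _ _) (commonIn_subset _ _) (fun _ => commonIn_subset _ _)
    (hY true) (hY false) (fun _ => hY false) (fun _ => none) (fun e => .hub (ω e))
    (by simp) (by simp) ?_ ?_
  · intro e e' v hv hv'
    simp only [Kind.verts, Set.mem_singleton_iff] at hv hv'
    exact ω.injective (Subtype.ext (hv.symm.trans hv'))
  · intro e
    have := fun b => missIn_commonIn (G := G) (X := X b) (ω e).2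
    exact ⟨rfl, (this true).le.trans (Nat.zero_le _), (this false).le.trans (Nat.zero_le _),
      by simp⟩

lemma MatchIn.disjoint_pair {G : SimpleGraph V} {M : Finset (V × V)} {S : Finset V}
    (h : MatchIn G M S) {e f : V × V} (he : e ∈ M) (hf : f ∈ M) {v : V}
    (hv : v = e.1 ∨ v = e.2) (hv' : v = f.1 ∨ v = f.2) : e = f := by
  by_contra hne
  obtain ⟨h1, h2, h3, h4⟩ := h.disj e he f hf hne
  rcases hv with rfl | rfl <;> rcases hv' with hv' | hv'
  exacts [h1 hv', h2 hv', h3 hv', h4 hv']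

/-- A large matching on one side. -/
theorem isContained_of_matching [Finite W] (hH : H.IsBipartite)
    (hℓ : ∀ e, Odd (ℓ e) ∧ 5 ≤ ℓ e)
    (G : SimpleGraph V) (X : Bool → Finset V) (C : ℕ)
    (hX : ∀ b, ∀ v ∈ X b, missIn G v (X (!b)) ≤ C) {M : Finset (V × V)} {S : Finset V}
    (hM : MatchIn G M S) (hMc : Nat.card H.edgeSet ≤ M.card) (b : Bool)
    (hS : ∀ v ∈ S, missIn G v (X (!b)) ≤ C)
    (hXc : ∀ b, (C + 1) * Nat.card (BVert H ℓ) ≤ (X b).card) :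
    oddBallooning H ℓ ⊑ G := by
  classical
  have := Fintype.ofFinite W
  obtain ⟨c, hc⟩ := exists_coloring' hH
  obtain ⟨o, ho⟩ := exists_orientation_of_coloring hc
  obtain ⟨μ⟩ : Nonempty (H.edgeSet ↪ M) := by
    refine Function.Embedding.nonempty_of_card_le ?_
    rw [Fintype.card_coe, ← Nat.card_eq_fintype_card]
    exact hMc
  -- The classes are renamed so that `X b` becomes the class `true`, in whose role the matching is
  -- used.
  refine isContained_of_kinds o hℓ G (fun b' => X (b' ^^ !b)) C (fun b' v hv => ?_) c
    (fun e => (ho e).1) (fun e => (ho e).2) _ _ (fun _ => X (!b)) (fun _ h => h)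
    (fun _ h => h) (fun _ => by simp) (hXc _) (hXc _) (fun _ => hXc _) (fun _ => none)
    (fun e => .aa (μ e).1.1 (μ e).1.2) (by simp) (by simp) ?_ ?_
  · have := hX _ v hv
    simpa using this
  · intro e e' v hv hv'
    simp only [Kind.verts, Set.mem_insert_iff, Set.mem_singleton_iff] at hv hv'
    exact μ.injective (Subtype.ext (hM.disjoint_pair (μ e).2 (μ e').2 hv hv'))
  · intro e
    have := hM.mem _ (μ e).2
    exact ⟨rfl, hM.adj _ (μ e).2, hS _ this.1, by simpa using hS _ this.2, by simp⟩

end Embeddings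

end Ballooning

namespace Ballooning

/-! ### Stability: almost bipartite structure -/

section Stability

variable {W V : Type*} {H : SimpleGraph W} {ℓ : H.edgeSet → ℕ} [Fintype V] {G : SimpleGraph V}

lemma degIn_le_add {v : V} {A B D : Finset V} (h : ∀ x, x ∈ A ∨ x ∈ B ∨ x ∈ D) :
    degIn G v Finset.univ ≤ degIn G v A + degIn G v B + degIn G v D := by
  classical
  have h1 : (Finset.univ : Finset V) ⊆ (A ∪ B) ∪ D := fun x _ => by
    have := h x
    simp only [Finset.mem_union]
    tauto
  have h2 := degIn_mono (G := G) v h1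
  have h3 := degIn_union_le (G := G) v (A ∪ B) D
  have h4 := degIn_union_le (G := G) v A B
  omega

/-- Vertices are classified by their neighbours in a biclique `X`, `Y` of constant size. Those with
a fair share of both are few, as they would serve as hubs. Counting edges at `X ∪ Y` shows that few
of the others have noticeably fewer than `T` neighbours there. The remaining ones have few
neighbours in one side and nearly all of the other; those of one type have no large matching, so
bounded deletions make them independent. -/
theorem rough_partition_aux [Finite W] (hH : H.IsBipartite)
    (hℓ : ∀ e, Odd (ℓ e) ∧ 5 ≤ ℓ e) {τ h κ' κ₁ κ₂ N M T : ℕ} (hτ : Nat.card (BVert H ℓ) = τ)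
    (hh : Nat.card H.edgeSet = h) (hhpos : 0 < h) (hτpos : 0 < τ) (hκ' : 0 < κ')
    (hκ₂ : κ₂ = 4 * τ) (hκ₁ : κ₁ = 2 * κ₂ * κ') (hN : N = 2 * h * κ₁ ^ 2)
    (hM : M = 2 * κ₁ ^ 2 * 2 ^ (2 * h * κ₁ ^ 2)) (hT : T = 2 * M * τ) (hMpos : 0 < M)
    (hn : 4 * T + 4 * 2 ^ (4 * T) * T + 2 ≤ Fintype.card V)
    (hn2 : 2 * κ' * (N + 4 * h) + 2 * κ' * κ₂ * (2 * N + 1) + Fintype.card V ≤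
      2 * Fintype.card V)
    (hfree : (oddBallooning H ℓ).Free G)
    (hdeg : ∀ v : V, Fintype.card V ≤ 2 * degIn G v Finset.univ + 1) :
    ∃ A B D : Finset V, Disjoint A B ∧ (∀ x ∈ A, ∀ y ∈ A, ¬ G.Adj x y) ∧
      (∀ x ∈ B, ∀ y ∈ B, ¬ G.Adj x y) ∧ Disjoint A D ∧ Disjoint B D ∧
      (∀ x, x ∈ A ∨ x ∈ B ∨ x ∈ D) ∧ κ' * D.card ≤ Fintype.card V := by
  classical
  have hκ₂pos : 4 ≤ κ₂ := by omega
  have hκ₁2 : 2 * κ₂ ≤ κ₁ := by rw [hκ₁]; exact Nat.le_mul_of_pos_right _ hκ'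
  have hTpos : 0 < T := by rw [hT]; positivity
  have hTτ : 2 * τ ≤ T := by rw [hT]; exact Nat.mul_le_mul_right _ (Nat.le_mul_of_pos_right _ hMpos)
  obtain ⟨X, Y, hXc, hYc, hXY⟩ := exists_biclique (G := G) T hTpos hn hdeg
  generalize hn' : Fintype.card V = n at *
  let XX : Bool → Finset V := fun b => if b then X else Y
  have hXX : ∀ b, ∀ v ∈ XX b, missIn G v (XX (!b)) = 0 := by
    rintro (_ | _) v hv
    · exact missIn_eq_zero.2 fun y hy => (hXY y hy v hv).symm
    · exact missIn_eq_zero.2 fun y hy => hXY v hv y hy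
  have hXXc : ∀ b, (XX b).card = T := by rintro (_ | _) <;> simp [XX, hXc, hYc]
  set s : V → ℕ := fun v => degIn G v X + degIn G v Y with hs
  set bad := (Finset.univ : Finset V).filter fun v => T ≤ κ₁ * degIn G v X ∧
    T ≤ κ₁ * degIn G v Y with hbad
  set atyp := (Finset.univ : Finset V).filter fun v => ¬ (T ≤ κ₁ * degIn G v X ∧
    T ≤ κ₁ * degIn G v Y) ∧ κ₂ * s v + T ≤ κ₂ * T with hatyp
  have hbadN : bad.card ≤ N := by
    by_contra hcon
    obtain ⟨Q, -, hQc, hQX, hQY⟩ := exists_commonIn (G := G) (κ := κ₁) (h := h) (S := bad)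
      (X := X) (Y := Y) (by omega) hhpos (by omega) (Finset.card_pos.1 (by omega))
      (Finset.card_pos.1 (by omega))
      (fun v hv => by rw [hXc]; exact (Finset.mem_filter.1 hv).2.1)
      (fun v hv => by rw [hYc]; exact (Finset.mem_filter.1 hv).2.2)
    refine hfree (isContained_of_hubs hH hℓ G XX 0 (fun b v hv => (hXX b v hv).le) Q (hh ▸ hQc) ?_)
    rw [hXc, ← hM] at hQX
    rw [hYc, ← hM] at hQY
    have key : ∀ m, T ≤ M * m → τ ≤ m := by
      intro m hm
      have : 0 < τ := hτpos
      refine Nat.le_of_mul_le_mul_left (?_ : M * τ ≤ M * m) hMpos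
      rw [hT] at hm
      nlinarith
    rintro (_ | _)
    · rw [zero_add, one_mul, hτ]
      exact key _ hQY
    · rw [zero_add, one_mul, hτ]
      exact key _ hQX
  have hsum : T * n ≤ ∑ v : V, s v + T := by
    have h1 : ∑ v : V, s v = ∑ x ∈ X, degIn G x Finset.univ + ∑ y ∈ Y, degIn G y Finset.univ := by
      rw [sum_degIn_comm X, sum_degIn_comm Y, ← Finset.sum_add_distrib]
    have h2 : ∀ Z : Finset V, Z.card = T →
        T * n ≤ 2 * ∑ z ∈ Z, degIn G z Finset.univ + T := by
      intro Z hZ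
      calc T * n = ∑ z ∈ Z, n := by rw [Finset.sum_const, hZ, smul_eq_mul]
        _ ≤ ∑ z ∈ Z, (2 * degIn G z Finset.univ + 1) := Finset.sum_le_sum fun z _ => hdeg z
        _ = _ := by
          rw [Finset.sum_add_distrib, Finset.sum_const, hZ, smul_eq_mul, mul_one, Finset.mul_sum]
    have h3 := h2 X hXc
    have h4 := h2 Y hYc
    omega
  have hle : ∀ v, degIn G v X ≤ T ∧ degIn G v Y ≤ T := fun v =>
    ⟨hXc ▸ degIn_le_card v X, hYc ▸ degIn_le_card v Y⟩
  -- Scaled by `κ₁ * κ₂`: a vertex outside `bad` has `s v` at most `T + T / κ₁`, an atypical one at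
  -- most `T - T / κ₂`, and any vertex at most `2 * T`. Summation against the lower bound `hsum`
  -- bounds the number of atypical vertices.
  have hpt : ∀ v, κ₁ * κ₂ * s v + (if v ∈ atyp then κ₁ * T else 0)
      ≤ κ₂ * (κ₁ + 1) * T + (if v ∈ bad then κ₁ * κ₂ * (2 * T) else 0) := by
    intro v
    obtain ⟨h1, h2⟩ := hle v
    by_cases hb : T ≤ κ₁ * degIn G v X ∧ T ≤ κ₁ * degIn G v Y
    · have hva : v ∉ atyp := by simp [hatyp, hb]
      have hvb : v ∈ bad := by simp [hbad, hb]
      rw [if_neg hva, if_pos hvb]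
      have : κ₁ * κ₂ * s v ≤ κ₁ * κ₂ * (2 * T) := Nat.mul_le_mul_left _ (by simp only [hs]; omega)
      omega
    · have hvb : v ∉ bad := by simpa [hbad] using hb
      rw [if_neg hvb]
      by_cases hva : κ₂ * s v + T ≤ κ₂ * T
      · rw [if_pos (by simp only [hatyp, Finset.mem_filter]; exact ⟨Finset.mem_univ _, hb, hva⟩)]
        calc κ₁ * κ₂ * s v + κ₁ * T = κ₁ * (κ₂ * s v + T) := by ring
          _ ≤ κ₁ * (κ₂ * T) := Nat.mul_le_mul_left _ hva
          _ ≤ κ₁ * (κ₂ * T) + κ₂ * T := Nat.le_add_right _ _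
          _ = κ₂ * (κ₁ + 1) * T + 0 := by ring
      · rw [if_neg (by simp only [hatyp, Finset.mem_filter]; tauto)]
        have h3 : κ₁ * s v ≤ (κ₁ + 1) * T := by
          have e1 := Nat.mul_le_mul_left κ₁ h1
          have e2 := Nat.mul_le_mul_left κ₁ h2
          rw [show s v = degIn G v X + degIn G v Y from rfl, mul_add, add_mul, one_mul]
          omega
        calc κ₁ * κ₂ * s v + 0 = κ₂ * (κ₁ * s v) := by ring
          _ ≤ κ₂ * ((κ₁ + 1) * T) := Nat.mul_le_mul_left _ h3
          _ = κ₂ * (κ₁ + 1) * T + 0 := by ring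
  have hz : 2 * κ' * atyp.card ≤ 2 * κ' * κ₂ * (2 * N + 1) + n := by
    have h1 := Finset.sum_le_sum fun v (_ : v ∈ (Finset.univ : Finset V)) => hpt v
    rw [Finset.sum_add_distrib, Finset.sum_add_distrib, ← Finset.mul_sum, ← Finset.sum_filter,
      ← Finset.sum_filter, Finset.sum_const, Finset.sum_const, Finset.sum_const,
      Finset.filter_mem_eq_inter, Finset.filter_mem_eq_inter, Finset.univ_inter,
      Finset.univ_inter, Finset.card_univ, hn', smul_eq_mul, smul_eq_mul, smul_eq_mul] at h1
    have h2 : bad.card * (κ₁ * κ₂ * (2 * T)) ≤ N * (κ₁ * κ₂ * (2 * T)) :=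
      Nat.mul_le_mul_right _ hbadN
    have h3 : κ₁ * κ₂ * (T * n) ≤ κ₁ * κ₂ * (∑ v : V, s v + T) := Nat.mul_le_mul_left _ hsum
    have h4 : κ₂ * T * (2 * κ' * atyp.card) ≤ κ₂ * T * (2 * κ' * κ₂ * (2 * N + 1) + n) := by
      have e1 : κ₂ * T * (2 * κ' * atyp.card) = atyp.card * (κ₁ * T) := by rw [hκ₁]; ring
      have e2 : κ₂ * T * (2 * κ' * κ₂ * (2 * N + 1) + n)
          = N * (κ₁ * κ₂ * (2 * T)) + κ₁ * κ₂ * T + κ₂ * T * n := by rw [hκ₁]; ring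
      rw [e1, e2]
      have e3 : n * (κ₂ * (κ₁ + 1) * T) = κ₁ * κ₂ * (T * n) + κ₂ * T * n := by ring
      have e4 : κ₁ * κ₂ * (∑ v : V, s v + T) = κ₁ * κ₂ * ∑ v : V, s v + κ₁ * κ₂ * T := by ring
      omega
    exact Nat.le_of_mul_le_mul_left h4 (by positivity)
  -- the two typical classes
  obtain ⟨C, hC⟩ : ∃ C, C = 2 * T / κ₂ := ⟨_, rfl⟩
  have hCT : (C + 1) * τ ≤ T := by
    have h1 : C * κ₂ ≤ 2 * T := hC ▸ Nat.div_mul_le_self _ _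
    have h2 : C * κ₂ = 4 * (C * τ) := by rw [hκ₂]; ring
    rw [add_mul, one_mul]
    omega
  have hside : ∀ b : Bool, ∃ A' : Finset V,
      (∀ x ∈ A', ∀ y ∈ A', ¬ G.Adj x y) ∧
      (∀ v ∈ A', κ₁ * degIn G v (XX b) < T ∧ κ₂ * T < κ₂ * s v + T) ∧
      ((Finset.univ : Finset V).filter fun v => κ₁ * degIn G v (XX b) < T ∧
        κ₂ * T < κ₂ * s v + T).card ≤ A'.card + 2 * h := by
    intro b
    obtain ⟨A', hA', hind, hc⟩ := exists_indep_of_no_matching (G := G) (h := h)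
      (S := (Finset.univ : Finset V).filter fun v => κ₁ * degIn G v (XX b) < T ∧
        κ₂ * T < κ₂ * s v + T) (fun Mt hMt => by
        by_contra hcon
        refine hfree (isContained_of_matching hH hℓ G XX C
          (fun b v hv => (hXX b v hv).le.trans (Nat.zero_le _)) hMt (by omega) b ?_ ?_)
        · intro v hv
          have hv' := (Finset.mem_filter.1 hv).2
          rw [hC, Nat.le_div_iff_mul_le (by omega)]
          have h1 := degIn_add_missIn (G := G) v (XX (!b))
          rw [hXXc] at h1
          have h2 : s v = degIn G v (XX b) + degIn G v (XX (!b)) := by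
            cases b <;> simp [hs, XX, add_comm]
          rw [h2, mul_add] at hv'
          have e1 : κ₂ * degIn G v (XX (!b)) + κ₂ * missIn G v (XX (!b)) = κ₂ * T := by
            rw [← mul_add, h1]
          have e2 : κ₂ * degIn G v (XX b) ≤ κ₁ * degIn G v (XX b) :=
            Nat.mul_le_mul_right _ (by omega)
          rw [mul_comm]
          omega
        · intro b
          rw [hXXc, hτ]
          exact hCT)
    exact ⟨A', hind, fun v hv => (Finset.mem_filter.1 (hA' hv)).2, hc⟩
  obtain ⟨A, hAi, hAm, hAc⟩ := hside true
  obtain ⟨B, hBi, hBm, hBc⟩ := hside false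
  have hAB : Disjoint A B := by
    rw [Finset.disjoint_left]
    intro v hvA hvB
    obtain ⟨h1, h2⟩ := hAm v hvA
    obtain ⟨h3, -⟩ := hBm v hvB
    simp only [XX, if_true] at h1
    simp only [XX, Bool.false_eq_true, if_false] at h3
    rw [show s v = degIn G v X + degIn G v Y from rfl, mul_add] at h2
    have e1 : 2 * (κ₂ * degIn G v X) ≤ κ₁ * degIn G v X := by
      rw [← mul_assoc]; exact Nat.mul_le_mul_right _ hκ₁2
    have e2 : 2 * (κ₂ * degIn G v Y) ≤ κ₁ * degIn G v Y := by
      rw [← mul_assoc]; exact Nat.mul_le_mul_right _ hκ₁2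
    have e3 : 4 * T ≤ κ₂ * T := Nat.mul_le_mul_right _ hκ₂pos
    omega
  refine ⟨A, B, Finset.univ \ (A ∪ B), hAB, hAi, hBi,
    Finset.disjoint_sdiff.mono_left Finset.subset_union_left,
    Finset.disjoint_sdiff.mono_left Finset.subset_union_right, fun x => ?_, ?_⟩
  · simp only [Finset.mem_sdiff, Finset.mem_univ, true_and, Finset.mem_union]
    tauto
  · have hcover : (Finset.univ : Finset V) ⊆ bad ∪ atyp ∪
        (((Finset.univ : Finset V).filter fun v => κ₁ * degIn G v (XX true) < T ∧
        κ₂ * T < κ₂ * s v + T) ∪ ((Finset.univ : Finset V).filter fun v =>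
        κ₁ * degIn G v (XX false) < T ∧ κ₂ * T < κ₂ * s v + T)) := by
      intro v _
      simp only [Finset.mem_union, hbad, hatyp, Finset.mem_filter, Finset.mem_univ, true_and, XX,
        if_true, Bool.false_eq_true, if_false]
      by_cases h1 : T ≤ κ₁ * degIn G v X <;> by_cases h2 : T ≤ κ₁ * degIn G v Y <;>
        by_cases h3 : κ₂ * s v + T ≤ κ₂ * T <;> simp only [h1, h2, h3] <;> simp <;> omega
    have h1 := Finset.card_le_card hcover
    have h2 := Finset.card_union_le (bad ∪ atyp)
        (((Finset.univ : Finset V).filter fun v => κ₁ * degIn G v (XX true) < T ∧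
        κ₂ * T < κ₂ * s v + T) ∪ ((Finset.univ : Finset V).filter fun v =>
        κ₁ * degIn G v (XX false) < T ∧ κ₂ * T < κ₂ * s v + T))
    have h3 := Finset.card_union_le bad atyp
    have h4 := Finset.card_union_le
        ((Finset.univ : Finset V).filter fun v => κ₁ * degIn G v (XX true) < T ∧
        κ₂ * T < κ₂ * s v + T) ((Finset.univ : Finset V).filter fun v =>
        κ₁ * degIn G v (XX false) < T ∧ κ₂ * T < κ₂ * s v + T)
    have h5 : (Finset.univ \ (A ∪ B)).card + (A.card + B.card) = n := by
      rw [← Finset.card_union_of_disjoint hAB, Finset.card_sdiff_add_card_eq_card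
        (Finset.subset_univ _), Finset.card_univ, hn']
    rw [Finset.card_univ, hn'] at h1
    have h6 : (Finset.univ \ (A ∪ B)).card ≤ N + 4 * h + atyp.card := by omega
    have h7 : 2 * κ' * (Finset.univ \ (A ∪ B)).card ≤ 2 * κ' * (N + 4 * h + atyp.card) :=
      Nat.mul_le_mul_left _ h6
    have h8 : 2 * κ' * (N + 4 * h + atyp.card) = 2 * κ' * (N + 4 * h) + 2 * κ' * atyp.card := by
      ring
    have h9 : 2 * (κ' * (Finset.univ \ (A ∪ B)).card)
        = 2 * κ' * (Finset.univ \ (A ∪ B)).card := by ring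
    omega

lemma card_pos_of_ne_bot [Finite W] (hne : H ≠ ⊥) :
    0 < Nat.card H.edgeSet ∧ 0 < Nat.card (BVert H ℓ) := by
  obtain ⟨a, b, hab⟩ := ne_bot_iff_exists_adj.1 hne
  have : Nonempty H.edgeSet := ⟨⟨s(a, b), hab⟩⟩
  have : Nonempty (BVert H ℓ) := ⟨.inl a⟩
  exact ⟨Nat.card_pos, Nat.card_pos⟩

theorem exists_rough_partition [Finite W] (hH : H.IsBipartite) (hne : H ≠ ⊥)
    (hℓ : ∀ e, Odd (ℓ e) ∧ 5 ≤ ℓ e) (κ' : ℕ) (hκ' : 0 < κ') :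
    ∃ n₁ : ℕ, ∀ {V : Type*} [Fintype V] (G : SimpleGraph V), n₁ ≤ Fintype.card V →
      (oddBallooning H ℓ).Free G →
      (∀ v : V, Fintype.card V ≤ 2 * degIn G v Finset.univ + 1) →
      ∃ A B D : Finset V, Disjoint A B ∧ (∀ x ∈ A, ∀ y ∈ A, ¬ G.Adj x y) ∧
        (∀ x ∈ B, ∀ y ∈ B, ¬ G.Adj x y) ∧ Disjoint A D ∧ Disjoint B D ∧
        (∀ x, x ∈ A ∨ x ∈ B ∨ x ∈ D) ∧ κ' * D.card ≤ Fintype.card V := by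
  classical
  obtain ⟨τ, hτ⟩ : ∃ τ, Nat.card (BVert H ℓ) = τ := ⟨_, rfl⟩
  obtain ⟨h, hh⟩ : ∃ h, Nat.card H.edgeSet = h := ⟨_, rfl⟩
  obtain ⟨hhpos, hτpos⟩ := card_pos_of_ne_bot (ℓ := ℓ) hne
  rw [hh] at hhpos
  rw [hτ] at hτpos
  obtain ⟨κ₂, hκ₂⟩ : ∃ x, x = 4 * τ := ⟨_, rfl⟩
  obtain ⟨κ₁, hκ₁⟩ : ∃ x, x = 2 * κ₂ * κ' := ⟨_, rfl⟩
  have hκ₁pos : 0 < κ₁ := by rw [hκ₁, hκ₂]; positivity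
  obtain ⟨N, hN⟩ : ∃ x, x = 2 * h * κ₁ ^ 2 := ⟨_, rfl⟩
  obtain ⟨M, hM⟩ : ∃ x, x = 2 * κ₁ ^ 2 * 2 ^ (2 * h * κ₁ ^ 2) := ⟨_, rfl⟩
  have hMpos : 0 < M := by rw [hM]; positivity
  obtain ⟨T, hT⟩ : ∃ x, x = 2 * M * τ := ⟨_, rfl⟩
  obtain ⟨a₁, ha₁⟩ : ∃ x, x = 4 * T + 4 * 2 ^ (4 * T) * T + 2 := ⟨_, rfl⟩
  obtain ⟨a₂, ha₂⟩ : ∃ x, x = 2 * κ' * (N + 4 * h) + 2 * κ' * κ₂ * (2 * N + 1) := ⟨_, rfl⟩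
  exact ⟨a₁ + a₂, fun {V} _ G hn hfree hdeg => rough_partition_aux hH hℓ hτ hh hhpos hτpos hκ'
    hκ₂ hκ₁ hN hM hT hMpos (ha₁ ▸ by omega) (ha₂ ▸ by omega) hfree hdeg⟩

/-- The classification is repeated with the large sets `A`, `B` in place of the biclique. By the
degree condition, a vertex with few neighbours in one class misses few of the other, so no vertex is
atypical any more. The exceptions are the at most `N` hubs and `2 * h` vertices deleted from each
side. -/
theorem stability_aux [Finite W] (hH : H.IsBipartite)
    (hℓ : ∀ e, Odd (ℓ e) ∧ 5 ≤ ℓ e) {τ h κ κ' N M : ℕ} (hτ : Nat.card (BVert H ℓ) = τ)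
    (hh : Nat.card H.edgeSet = h) (hhpos : 0 < h) (hτpos : 0 < τ)
    (hκ : κ = 8 * τ) (hN : N = 2 * h * κ ^ 2)
    (hM : M = 2 * κ ^ 2 * 2 ^ (2 * h * κ ^ 2)) (hM2 : 2 ≤ M) (hκ' : κ' = 4 * (M * τ) + 8)
    (hn : 16 * (M * τ) + 16 ≤ Fintype.card V)
    (hfree : (oddBallooning H ℓ).Free G)
    (hdeg : ∀ v : V, Fintype.card V ≤ 2 * degIn G v Finset.univ + 1)
    {A B D : Finset V} (hAB : Disjoint A B) (hA : ∀ x ∈ A, ∀ y ∈ A, ¬ G.Adj x y)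
    (hB : ∀ x ∈ B, ∀ y ∈ B, ¬ G.Adj x y) (hAD : Disjoint A D) (hBD : Disjoint B D)
    (hcov : ∀ x, x ∈ A ∨ x ∈ B ∨ x ∈ D) (hD : κ' * D.card ≤ Fintype.card V) :
    ∃ A B : Finset V, Disjoint A B ∧ (∀ x ∈ A, ∀ y ∈ A, ¬ G.Adj x y) ∧
      (∀ x ∈ B, ∀ y ∈ B, ¬ G.Adj x y) ∧ Fintype.card V ≤ A.card + B.card + (N + 4 * h) := by
  classical
  have hcard : A.card + B.card + D.card = Fintype.card V := by
    rw [← Finset.card_union_of_disjoint hAB, ← Finset.card_union_of_disjoint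
      (Finset.disjoint_union_left.2 ⟨hAD, hBD⟩), ← Finset.card_univ]
    congr 1
    ext x
    have := hcov x
    simp only [Finset.mem_union, Finset.mem_univ, iff_true]
    tauto
  generalize hn' : Fintype.card V = n at *
  obtain ⟨r, hr⟩ : ∃ r, D.card = r := ⟨_, rfl⟩
  rw [hr] at hcard hD
  let X : Bool → Finset V := fun b => if b then A else B
  have hXi : ∀ b, ∀ x ∈ X b, ∀ y ∈ X b, ¬ G.Adj x y := by
    rintro (_ | _)
    exacts [hB, hA]
  have hsize : ∀ b, 2 * (X b).card ≤ n + 1 := by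
    intro b
    rcases (X b).eq_empty_or_nonempty with he | ⟨v, hv⟩
    · simp [he]
    · have h1 := hdeg v
      have h2 : degIn G v (X b) = 0 := degIn_eq_zero.2 fun y hy => hXi b v hv y hy
      have h3 := degIn_add_missIn (G := G) v Finset.univ
      have h4 := missIn_mono (G := G) v (Finset.subset_univ (X b))
      have h5 := degIn_add_missIn (G := G) v (X b)
      rw [Finset.card_univ, hn'] at h3
      omega
  have hsum : ∀ b, (X b).card + (X (!b)).card + r = n := by
    rintro (_ | _) <;> simp [X] <;> omega
  have hmiss : ∀ b v, missIn G v (X (!b)) ≤ 1 + r + degIn G v (X b) := by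
    intro b v
    have h1 := hdeg v
    have h2 : degIn G v Finset.univ ≤ degIn G v (X b) + degIn G v (X (!b)) + degIn G v D :=
      degIn_le_add fun x => by
        have := hcov x
        cases b <;> simp [X] <;> tauto
    have h3 := degIn_add_missIn (G := G) v (X (!b))
    have h4 := hsize (!b)
    have h5 := degIn_le_card (G := G) v D
    omega
  have hmiss0 : ∀ b, ∀ v ∈ X b, missIn G v (X (!b)) ≤ r + 1 := by
    intro b v hv
    have h1 := hmiss b v
    have h2 : degIn G v (X b) = 0 := degIn_eq_zero.2 fun y hy => hXi b v hv y hy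
    omega
  have hbig : ∀ b, n ≤ 2 * (X b).card + 2 * r + 1 := fun b => by
    have h1 := hsum b
    have h2 := hsize (!b)
    omega
  have hMτ : 2 * τ ≤ M * τ := Nat.mul_le_mul_right _ hM2
  have hDr : 4 * (M * τ * r) + 8 * r ≤ n := by
    rw [hκ'] at hD
    calc _ = (4 * (M * τ) + 8) * r := by ring
      _ ≤ n := hD
  have hτr : 2 * (τ * r) ≤ M * τ * r := by
    rw [← mul_assoc]
    exact Nat.mul_le_mul_right _ hMτ
  set bad := (Finset.univ : Finset V).filter fun v => (X true).card ≤ κ * degIn G v (X true) ∧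
    (X false).card ≤ κ * degIn G v (X false) with hbad
  have hbadN : bad.card ≤ N := by
    by_contra hcon
    have hXne : ∀ b, (X b).Nonempty := fun b => Finset.card_pos.1 (by have := hbig b; omega)
    obtain ⟨Q, -, hQc, hQX, hQY⟩ := exists_commonIn (G := G) (κ := κ) (h := h) (S := bad)
      (by omega) hhpos (by omega) (hXne true) (hXne false)
      (fun v hv => (Finset.mem_filter.1 hv).2.1) (fun v hv => (Finset.mem_filter.1 hv).2.2)
    rw [← hM] at hQX hQY
    refine hfree (isContained_of_hubs hH hℓ G X (r + 1) hmiss0 Q (hh ▸ hQc) fun b => ?_)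
    rw [hτ]
    have h1 : (X b).card ≤ M * (commonIn G Q (X b)).card := by cases b <;> assumption
    have h2 := hbig b
    refine Nat.le_of_mul_le_mul_left (h1.trans' ?_ : M * _ ≤ M * _) (by omega)
    have : M * ((r + 1 + 1) * τ) = M * τ * r + 2 * (M * τ) := by ring
    omega
  -- With `κ = 8 * τ`, the allowance `n / κ` for neighbours in the own class costs at most `n / 8`
  -- candidates, against classes of about `n / 2`.
  have hdiv : τ * (n / κ) * 8 ≤ n := by
    have := Nat.div_mul_le_self n κ
    calc τ * (n / κ) * 8 = n / κ * κ := by rw [hκ]; ring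
      _ ≤ n := this
  have hside : ∀ b : Bool, ∀ S : Finset V, (∀ v ∈ S, κ * degIn G v (X b) < (X b).card) →
      ∃ A' ⊆ S, (∀ x ∈ A', ∀ y ∈ A', ¬ G.Adj x y) ∧ S.card ≤ A'.card + 2 * h := by
    intro b S hS
    refine exists_indep_of_no_matching (G := G) (h := h) (S := S) fun Mt hMt => ?_
    by_contra hcon
    refine hfree (isContained_of_matching hH hℓ G X (1 + r + n / κ) (fun b v hv =>
      (hmiss0 b v hv).trans (by rw [add_comm r]; exact Nat.le_add_right _ _)) hMt (by omega) b (fun v hv => ?_) fun b => ?_)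
    · have h1 := hS v hv
      have h2 := hsum b
      have h3 : degIn G v (X b) ≤ n / κ := by
        rw [Nat.le_div_iff_mul_le (by omega), mul_comm]
        omega
      have := hmiss b v
      omega
    · rw [hτ]
      have h2 := hbig b
      have : (1 + r + n / κ + 1) * τ = 2 * τ + τ * r + τ * (n / κ) := by ring
      omega
  obtain ⟨A', hA'S, hA'i, hA'c⟩ := hside true ((Finset.univ : Finset V).filter fun v =>
    κ * degIn G v (X true) < (X true).card) fun v hv => (Finset.mem_filter.1 hv).2
  obtain ⟨B', hB'S, hB'i, hB'c⟩ := hside false ((Finset.univ : Finset V).filter fun v =>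
    (X true).card ≤ κ * degIn G v (X true) ∧ κ * degIn G v (X false) < (X false).card)
    fun v hv => (Finset.mem_filter.1 hv).2.2
  refine ⟨A', B', ?_, hA'i, hB'i, ?_⟩
  · rw [Finset.disjoint_left]
    intro v hv hv'
    have h1 := (Finset.mem_filter.1 (hA'S hv)).2
    have h2 := (Finset.mem_filter.1 (hB'S hv')).2.1
    omega
  · have hcover : (Finset.univ : Finset V) ⊆ ((Finset.univ : Finset V).filter fun v =>
        κ * degIn G v (X true) < (X true).card) ∪ ((Finset.univ : Finset V).filter fun v =>
        (X true).card ≤ κ * degIn G v (X true) ∧ κ * degIn G v (X false) < (X false).card)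
        ∪ bad := by
      intro v _
      simp only [Finset.mem_union, hbad, Finset.mem_filter, Finset.mem_univ, true_and]
      omega
    have h1 := Finset.card_le_card hcover
    rw [Finset.card_univ, hn'] at h1
    have h2 := h1.trans (Finset.card_union_le _ _)
    have h3 := Finset.card_union_le ((Finset.univ : Finset V).filter fun v =>
        κ * degIn G v (X true) < (X true).card) ((Finset.univ : Finset V).filter fun v =>
        (X true).card ≤ κ * degIn G v (X true) ∧ κ * degIn G v (X false) < (X false).card)
    omega

/-- A graph without the ballooning whose minimum degree is about half its order is bipartite up
to a bounded number of vertices. -/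
theorem exists_stability [Finite W] (hH : H.IsBipartite) (hne : H ≠ ⊥)
    (hℓ : ∀ e, Odd (ℓ e) ∧ 5 ≤ ℓ e) :
    ∃ E₀ n₁ : ℕ, ∀ {V : Type*} [Fintype V] (G : SimpleGraph V), n₁ ≤ Fintype.card V →
      (oddBallooning H ℓ).Free G →
      (∀ v : V, Fintype.card V ≤ 2 * degIn G v Finset.univ + 1) →
      ∃ A B : Finset V, Disjoint A B ∧ (∀ x ∈ A, ∀ y ∈ A, ¬ G.Adj x y) ∧
        (∀ x ∈ B, ∀ y ∈ B, ¬ G.Adj x y) ∧ Fintype.card V ≤ A.card + B.card + E₀ := by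
  obtain ⟨τ, hτ⟩ : ∃ τ, Nat.card (BVert H ℓ) = τ := ⟨_, rfl⟩
  obtain ⟨h, hh⟩ : ∃ h, Nat.card H.edgeSet = h := ⟨_, rfl⟩
  obtain ⟨hhpos, hτpos⟩ := card_pos_of_ne_bot (ℓ := ℓ) hne
  rw [hh] at hhpos
  rw [hτ] at hτpos
  obtain ⟨κ, hκ⟩ : ∃ x, x = 8 * τ := ⟨_, rfl⟩
  have hκpos : 0 < κ := by omega
  obtain ⟨N, hN⟩ : ∃ x, x = 2 * h * κ ^ 2 := ⟨_, rfl⟩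
  obtain ⟨M, hM⟩ : ∃ x, x = 2 * κ ^ 2 * 2 ^ (2 * h * κ ^ 2) := ⟨_, rfl⟩
  have hM2 : 2 ≤ M := by
    have h1 : 0 < κ ^ 2 * 2 ^ (2 * h * κ ^ 2) := by positivity
    rw [hM, mul_assoc]
    omega
  obtain ⟨κ', hκ'⟩ : ∃ x, x = 4 * (M * τ) + 8 := ⟨_, rfl⟩
  obtain ⟨n₁, hn₁⟩ := exists_rough_partition hH hne hℓ κ' (by omega)
  refine ⟨N + 4 * h, n₁ + (16 * (M * τ) + 16), fun {V} _ G hn hfree hdeg => ?_⟩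
  obtain ⟨A, B, D, hAB, hA, hB, hAD, hBD, hcov, hD⟩ := hn₁ G (by omega) hfree hdeg
  exact stability_aux hH hℓ hτ hh hhpos hτpos hκ hN hM hM2 hκ' (by omega) hfree hdeg hAB hA hB
    hAD hBD hcov hD

end Stability

end Ballooning

namespace Ballooning

/-! ### Exceptional vertices and the edge count -/

section Counting

variable {V : Type*} {G : SimpleGraph V}

/-- A vertex of an independent set has all its neighbours outside, so the degree condition caps each
set at about half of all vertices. A vertex that misses many vertices of one set must then make up
for them in the other. -/
lemma rough_bounds [Fintype V] {A B : Finset V} {r : ℕ} (hAB : Disjoint A B)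
    (hA : ∀ x ∈ A, ∀ y ∈ A, ¬ G.Adj x y) (hB : ∀ x ∈ B, ∀ y ∈ B, ¬ G.Adj x y)
    (hr : Fintype.card V ≤ A.card + B.card + r)
    (hdeg : ∀ v : V, Fintype.card V ≤ 2 * degIn G v Finset.univ + 1) :
    2 * A.card ≤ Fintype.card V + 1 ∧ 2 * B.card ≤ Fintype.card V + 1 ∧
      ∀ v, degIn G v Finset.univ ≤ degIn G v A + degIn G v B + r ∧
        missIn G v B ≤ 1 + r + degIn G v A ∧ missIn G v A ≤ 1 + r + degIn G v B := by
  classical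
  have hsize : ∀ S : Finset V, (∀ x ∈ S, ∀ y ∈ S, ¬ G.Adj x y) →
      2 * S.card ≤ Fintype.card V + 1 := by
    intro S hS
    rcases S.eq_empty_or_nonempty with rfl | ⟨v, hv⟩
    · simp
    · have h1 := hdeg v
      have h2 : degIn G v S = 0 := degIn_eq_zero.2 fun y hy => hS v hv y hy
      have h3 := degIn_add_missIn (G := G) v Finset.univ
      have h4 := missIn_mono (G := G) v (Finset.subset_univ S)
      have h5 := degIn_add_missIn (G := G) v S
      rw [Finset.card_univ] at h3
      omega
  have h1 := hsize A hA
  have h2 := hsize B hB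
  have hD : (Finset.univ \ (A ∪ B)).card ≤ r := by
    rw [Finset.card_sdiff_of_subset (Finset.subset_univ _), Finset.card_univ,
      Finset.card_union_of_disjoint hAB]
    omega
  refine ⟨h1, h2, fun v => ?_⟩
  have h3 : degIn G v Finset.univ ≤ degIn G v A + degIn G v B +
      degIn G v (Finset.univ \ (A ∪ B)) := degIn_le_add fun x => by
    simp only [Finset.mem_sdiff, Finset.mem_univ, true_and, Finset.mem_union]
    tauto
  have h4 := degIn_le_card (G := G) v (Finset.univ \ (A ∪ B))
  have h5 := degIn_add_missIn (G := G) v A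
  have h6 := degIn_add_missIn (G := G) v B
  have h7 := hdeg v
  refine ⟨by omega, by omega, by omega⟩

/-- The common neighbourhoods that occur many times: `Q` is a largest set that is the trace on `W`
of at least `K` neighbourhoods of vertices of `S`. -/
lemma exists_popular {S W : Finset V} {K : ℕ} (hS : S.Nonempty)
    (hSc : 2 ^ W.card * K ≤ S.card) :
    ∃ Q ⊆ W, ∃ Y ⊆ S, K ≤ Y.card ∧ (∀ v ∈ Q, missIn G v Y = 0) ∧
      ∑ x ∈ S, degIn G x W ≤ Q.card * S.card + 2 ^ W.card * K * W.card := by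
  classical
  let fib : Finset V → Finset V := fun Q => S.filter fun x => nbrIn G x W = Q
  have hsub : ∀ x, nbrIn G x W ⊆ W := fun x y hy => (mem_nbrIn.1 hy).1
  obtain ⟨x₀, -, hx₀⟩ := exists_large_fiber hS (U := W) (f := fun x => nbrIn G x W)
    fun x _ => hsub x
  have hx₀' : K ≤ (fib (nbrIn G x₀ W)).card :=
    Nat.le_of_mul_le_mul_left (hSc.trans hx₀) (by positivity)
  obtain ⟨Q, hQ, hmax⟩ := Finset.exists_max_image (W.powerset.filter fun Q => K ≤ (fib Q).card)
    Finset.card ⟨nbrIn G x₀ W, Finset.mem_filter.2 ⟨Finset.mem_powerset.2 (hsub _), hx₀'⟩⟩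
  rw [Finset.mem_filter, Finset.mem_powerset] at hQ
  refine ⟨Q, hQ.1, fib Q, Finset.filter_subset _ _, hQ.2, fun v hv => ?_, ?_⟩
  · rw [missIn_eq_zero]
    intro x hx
    have h1 := (Finset.mem_filter.1 hx).2
    rw [← h1] at hv
    exact (mem_nbrIn.1 hv).2.symm
  -- A popular trace has at most `Q.card` elements. Each of the at most `2 ^ W.card` unpopular
  -- traces occurs fewer than `K` times, at a cost of at most `W.card` each time.
  · set S' := S.filter fun x => (fib (nbrIn G x W)).card < K with hS'
    have h1 : ∀ x ∈ S, degIn G x W ≤ Q.card + if (fib (nbrIn G x W)).card < K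
        then W.card else 0 := by
      intro x hx
      split_ifs with h
      · have := degIn_le_card (G := G) x W
        omega
      · have := hmax (nbrIn G x W) (Finset.mem_filter.2 ⟨Finset.mem_powerset.2 (hsub x),
          not_lt.1 h⟩)
        rw [card_nbrIn] at this
        omega
    have h2 : S'.card ≤ 2 ^ W.card * K := by
      have h3 := Finset.card_le_mul_card_image_of_maps_to (s := S') (t := W.powerset)
        (f := fun x => nbrIn G x W) (fun x _ => Finset.mem_powerset.2 (hsub x)) K (by
          intro b _
          by_cases hb : (fib b).card < K
          · refine (Finset.card_le_card fun x hx => ?_).trans hb.le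
            rw [Finset.mem_filter, Finset.mem_filter] at hx
            exact Finset.mem_filter.2 ⟨hx.1.1, hx.2⟩
          · rw [Finset.card_eq_zero.2]
            · exact Nat.zero_le _
            · rw [Finset.filter_eq_empty_iff]
              intro x hx hxb
              exact hb (hxb ▸ (Finset.mem_filter.1 hx).2))
      rw [Finset.card_powerset, mul_comm] at h3
      exact h3
    calc ∑ x ∈ S, degIn G x W ≤ _ := Finset.sum_le_sum h1
      _ = Q.card * S.card + S'.card * W.card := by
        rw [Finset.sum_add_distrib, ← Finset.sum_filter, Finset.sum_const, Finset.sum_const,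
          smul_eq_mul, smul_eq_mul, mul_comm]
      _ ≤ _ := Nat.add_le_add_left (Nat.mul_le_mul_right _ h2) _

/-- Two almost independent classes `A`, `B` and a bounded set `W` of vertices with many
neighbours in large independent parts `A₃`, `B₃` of the classes. -/
structure RoughStructure (G : SimpleGraph V) (E₀ K : ℕ) (A₃ B₃ A B W : Finset V) : Prop where
  subA : A₃ ⊆ A
  subB : B₃ ⊆ B
  disjAB : Disjoint A B
  disjAW : Disjoint A W
  disjBW : Disjoint B W
  cover : ∀ x, x ∈ A ∨ x ∈ B ∨ x ∈ W
  indA : ∀ x ∈ A₃, ∀ y ∈ A₃, ¬ G.Adj x y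
  indB : ∀ x ∈ B₃, ∀ y ∈ B₃, ¬ G.Adj x y
  cardA : A.card ≤ A₃.card + E₀
  cardB : B.card ≤ B₃.card + E₀
  cardW : W.card ≤ E₀
  degA : ∀ v ∈ A, degIn G v A ≤ K + E₀
  degB : ∀ v ∈ B, degIn G v B ≤ K + E₀
  degWA : ∀ w ∈ W, K ≤ degIn G w A₃
  degWB : ∀ w ∈ W, K ≤ degIn G w B₃

lemma RoughStructure.symm {E₀ K : ℕ} {A₃ B₃ A B W : Finset V}
    (h : RoughStructure G E₀ K A₃ B₃ A B W) : RoughStructure G E₀ K B₃ A₃ B A W :=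
  ⟨h.subB, h.subA, h.disjAB.symm, h.disjBW, h.disjAW, fun x => by have := h.cover x; tauto,
    h.indB, h.indA, h.cardB, h.cardA, h.cardW, h.degB, h.degA, h.degWB, h.degWA⟩

/-- An exceptional vertex with fewer than `K` neighbours in one of the independent sets is added to
that set; the others form `W`. -/
lemma exists_roughStructure [Fintype V] {A₃ B₃ : Finset V} {E₀ : ℕ} (K : ℕ)
    (hAB : Disjoint A₃ B₃)
    (hA : ∀ x ∈ A₃, ∀ y ∈ A₃, ¬ G.Adj x y) (hB : ∀ x ∈ B₃, ∀ y ∈ B₃, ¬ G.Adj x y)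
    (hr : Fintype.card V ≤ A₃.card + B₃.card + E₀)
    (hdeg : ∀ v : V, Fintype.card V ≤ 2 * degIn G v Finset.univ + 1) :
    ∃ A B W, RoughStructure G E₀ K A₃ B₃ A B W := by
  classical
  obtain ⟨hAc, hBc, hv⟩ := rough_bounds hAB hA hB hr hdeg
  set E := Finset.univ \ (A₃ ∪ B₃) with hE
  have hEc : E.card ≤ E₀ := by
    rw [hE, Finset.card_sdiff_of_subset (Finset.subset_univ _), Finset.card_univ,
      Finset.card_union_of_disjoint hAB]
    omega
  have hmemE : ∀ x, x ∈ E ↔ x ∉ A₃ ∧ x ∉ B₃ := fun x => by simp [hE]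
  have hA0 : ∀ v ∈ A₃, degIn G v A₃ = 0 := fun v hv => degIn_eq_zero.2 fun y hy => hA v hv y hy
  have hB0 : ∀ v ∈ B₃, degIn G v B₃ = 0 := fun v hv => degIn_eq_zero.2 fun y hy => hB v hv y hy
  have hnotAB : ∀ x, x ∈ A₃ → x ∉ B₃ := fun x h h' => Finset.disjoint_left.1 hAB h h'
  refine ⟨A₃ ∪ E.filter fun v => degIn G v A₃ < K,
    B₃ ∪ E.filter fun v => K ≤ degIn G v A₃ ∧ degIn G v B₃ < K,
    E.filter fun v => K ≤ degIn G v A₃ ∧ K ≤ degIn G v B₃, Finset.subset_union_left,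
    Finset.subset_union_left, ?_, ?_, ?_, ?_, hA, hB, ?_, ?_, ?_, ?_, ?_, ?_, ?_⟩
  · rw [Finset.disjoint_left]
    intro x
    simp only [Finset.mem_union, Finset.mem_filter, hmemE]
    have := hnotAB x
    rintro (h | ⟨h, h'⟩) (h1 | ⟨h1, h2, -⟩)
    exacts [this h h1, h1.1 h, h.2 h1, by omega]
  · rw [Finset.disjoint_left]
    intro x
    simp only [Finset.mem_union, Finset.mem_filter, hmemE]
    rintro (h | ⟨h, h'⟩) ⟨h1, h2, -⟩
    exacts [h1.1 h, by omega]
  · rw [Finset.disjoint_left]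
    intro x
    simp only [Finset.mem_union, Finset.mem_filter, hmemE]
    rintro (h | ⟨h, -, h'⟩) ⟨h1, -, h2⟩
    exacts [h1.2 h, by omega]
  · intro x
    simp only [Finset.mem_union, Finset.mem_filter, hmemE]
    by_cases h1 : x ∈ A₃
    · exact .inl (.inl h1)
    by_cases h2 : x ∈ B₃
    · exact .inr (.inl (.inl h2))
    by_cases h3 : degIn G x A₃ < K
    · exact .inl (.inr ⟨⟨h1, h2⟩, h3⟩)
    by_cases h4 : degIn G x B₃ < K
    · exact .inr (.inl (.inr ⟨⟨h1, h2⟩, not_lt.1 h3, h4⟩))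
    · exact .inr (.inr ⟨⟨h1, h2⟩, not_lt.1 h3, not_lt.1 h4⟩)
  · exact (Finset.card_union_le _ _).trans (Nat.add_le_add_left
      ((Finset.card_filter_le _ _).trans hEc) _)
  · exact (Finset.card_union_le _ _).trans (Nat.add_le_add_left
      ((Finset.card_filter_le _ _).trans hEc) _)
  · exact (Finset.card_filter_le _ _).trans hEc
  · intro v hv
    have h1 : degIn G v A₃ ≤ K := by
      rcases Finset.mem_union.1 hv with h | h
      · rw [hA0 v h]; exact Nat.zero_le _
      · exact (Finset.mem_filter.1 h).2.le
    refine (degIn_union_le _ _ _).trans (Nat.add_le_add h1 ?_)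
    exact (degIn_le_card _ _).trans ((Finset.card_filter_le _ _).trans hEc)
  · intro v hv
    have h1 : degIn G v B₃ ≤ K := by
      rcases Finset.mem_union.1 hv with h | h
      · rw [hB0 v h]; exact Nat.zero_le _
      · exact (Finset.mem_filter.1 h).2.2.le
    refine (degIn_union_le _ _ _).trans (Nat.add_le_add h1 ?_)
    exact (degIn_le_card _ _).trans ((Finset.card_filter_le _ _).trans hEc)
  · exact fun w hw => (Finset.mem_filter.1 hw).2.1
  · exact fun w hw => (Finset.mem_filter.1 hw).2.2

lemma RoughStructure.card_eq [Fintype V] {E₀ K : ℕ} {A₃ B₃ A B W : Finset V}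
    (h : RoughStructure G E₀ K A₃ B₃ A B W) : A.card + B.card + W.card = Fintype.card V := by
  classical
  rw [← Finset.card_union_of_disjoint h.disjAB, ← Finset.card_union_of_disjoint
    (Finset.disjoint_union_left.2 ⟨h.disjAW, h.disjBW⟩), ← Finset.card_univ]
  congr 1
  ext x
  have := h.cover x
  simp only [Finset.mem_union, Finset.mem_univ, iff_true]
  tauto

/-- The at most `E₀` vertices of `A` outside `A₃` cover all edges inside `A`, and each has bounded
degree there. -/
lemma RoughStructure.sum_degIn_le {E₀ K : ℕ} {A₃ B₃ A B W : Finset V}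
    (h : RoughStructure G E₀ K A₃ B₃ A B W) :
    ∑ x ∈ A, degIn G x A ≤ 2 * (E₀ * (K + E₀)) ∧
      ∑ x ∈ A, degIn G x W ≤ ∑ x ∈ A₃, degIn G x W + E₀ * E₀ := by
  classical
  have hT : (A \ A₃).card ≤ E₀ := by
    rw [Finset.card_sdiff_of_subset h.subA]
    have := h.cardA
    omega
  constructor
  · have h1 := sum_degIn_add_sum_of_cover (G := G) (A := A) (T := A \ A₃) Finset.sdiff_subset
      (fun y hy z hz hyz => by
        simp only [Finset.mem_sdiff, hy, hz, true_and]
        by_contra! hcon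
        exact h.indA y hcon.1 z hcon.2 hyz)
    have h2 : ∑ t ∈ A \ A₃, degIn G t A ≤ (A \ A₃).card • (K + E₀) :=
      Finset.sum_le_card_nsmul _ _ _ fun t ht => h.degA t (Finset.mem_sdiff.1 ht).1
    rw [smul_eq_mul] at h2
    have h3 := Nat.mul_le_mul_right (K + E₀) hT
    omega
  · rw [← Finset.sum_sdiff h.subA, add_comm]
    refine Nat.add_le_add_left ?_ _
    refine (Finset.sum_le_card_nsmul _ _ E₀ fun t _ =>
      (degIn_le_card _ _).trans h.cardW).trans ?_
    rw [smul_eq_mul]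
    exact Nat.mul_le_mul_right _ hT

/-- Between `A` and `B` there are at most `(n - |W|) ^ 2 / 4` edges, and inside `A`, `B` and `W`
boundedly many. To reach about `n ^ 2 / 4 + p * n / 2` edges, there must be about `(|W| + p) * n /
2` edges between `W` and the classes. -/
lemma RoughStructure.card_mul_le [Fintype V] {E₀ K : ℕ} {A₃ B₃ A B W : Finset V}
    (h : RoughStructure G E₀ K A₃ B₃ A B W) {p c₀ : ℕ}
    (he : Fintype.card V ^ 2 + 2 * p * Fintype.card V
      ≤ 2 * ∑ v, degIn G v Finset.univ + c₀) :
    (W.card + p) * Fintype.card V ≤ 2 * (∑ x ∈ A₃, degIn G x W + ∑ x ∈ B₃, degIn G x W) +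
      (c₀ + 6 * (E₀ * E₀) + 4 * (E₀ * (K + E₀))) := by
  classical
  have hU : ∑ v, degIn G v Finset.univ = ∑ v ∈ A, degIn G v Finset.univ +
      ∑ v ∈ B, degIn G v Finset.univ + ∑ v ∈ W, degIn G v Finset.univ := by
    rw [← Finset.sum_union h.disjAB, ← Finset.sum_union
      (Finset.disjoint_union_left.2 ⟨h.disjAW, h.disjBW⟩)]
    refine Finset.sum_congr ?_ fun _ _ => rfl
    ext x
    have := h.cover x
    simp only [Finset.mem_union, Finset.mem_univ, true_iff]
    tauto
  have hS : ∀ S : Finset V, ∑ v ∈ S, degIn G v Finset.univ ≤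
      ∑ v ∈ S, degIn G v A + ∑ v ∈ S, degIn G v B + ∑ v ∈ S, degIn G v W := by
    intro S
    rw [← Finset.sum_add_distrib, ← Finset.sum_add_distrib]
    exact Finset.sum_le_sum fun v _ => degIn_le_add h.cover
  have h1 := hS A
  have h2 := hS B
  have h3 := hS W
  obtain ⟨h4, h5⟩ := h.sum_degIn_le
  obtain ⟨h6, h7⟩ := h.symm.sum_degIn_le
  have h8 : ∑ v ∈ A, degIn G v B ≤ A.card * B.card :=
    Finset.sum_le_card_nsmul _ _ _ fun t _ => degIn_le_card _ _
  have h9 := sum_degIn_comm (G := G) B A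
  have h10 := sum_degIn_comm (G := G) W A
  have h11 := sum_degIn_comm (G := G) W B
  have h12 : ∑ v ∈ W, degIn G v W ≤ E₀ * E₀ :=
    (Finset.sum_le_card_nsmul _ _ _ fun t _ => degIn_le_card _ _).trans
      (Nat.mul_le_mul h.cardW h.cardW)
  have h13 := h.card_eq
  have h14 : W.card * W.card ≤ E₀ * E₀ := Nat.mul_le_mul h.cardW h.cardW
  have h15 : 4 * (A.card * B.card) ≤ (A.card + B.card) ^ 2 := by
    have := four_mul_le_sq_add A.card B.card
    rwa [mul_assoc] at this
  rw [← h13] at he ⊢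
  have h16 : (A.card + B.card + W.card) ^ 2 + W.card * W.card = (A.card + B.card) ^ 2 +
      2 * (W.card * (A.card + B.card + W.card)) := by ring
  have h17 : 2 * ((W.card + p) * (A.card + B.card + W.card)) =
      2 * (W.card * (A.card + B.card + W.card)) + 2 * p * (A.card + B.card + W.card) := by ring
  omega

end Counting

end Ballooning

namespace Ballooning

/-! ### Embeddings using vertices outside the classes -/

section Structure

variable {W V : Type*} {H : SimpleGraph W} {ℓ : H.edgeSet → ℕ}

lemma exists_assignment {α β : Type*} [Nonempty V] (I : Finset α) (F : Finset β) (Ω : Finset V)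
    (h : I.card + F.card ≤ Ω.card) :
    ∃ (φ : α → V) (ψ : β → V), (∀ a ∈ I, φ a ∈ Ω) ∧ (∀ e ∈ F, ψ e ∈ Ω) ∧
      (∀ a ∈ I, ∀ b ∈ I, φ a = φ b → a = b) ∧ (∀ a ∈ F, ∀ b ∈ F, ψ a = ψ b → a = b) ∧
      ∀ a ∈ I, ∀ e ∈ F, φ a ≠ ψ e := by
  classical
  obtain ⟨θ⟩ : Nonempty (I ⊕ F ↪ Ω) := by
    refine Function.Embedding.nonempty_of_card_le ?_
    rw [Fintype.card_sum, Fintype.card_coe, Fintype.card_coe, Fintype.card_coe]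
    exact h
  refine ⟨fun a => if h : a ∈ I then θ (.inl ⟨a, h⟩) else Classical.arbitrary V,
    fun a => if h : a ∈ F then θ (.inr ⟨a, h⟩) else Classical.arbitrary V, ?_, ?_, ?_, ?_, ?_⟩
  · intro a ha
    simp only [ha, dif_pos]
    exact (θ _).2
  · intro a ha
    simp only [ha, dif_pos]
    exact (θ _).2
  · intro a ha b hb hab
    simp only [ha, hb, dif_pos] at hab
    simpa using θ.injective (Subtype.ext hab)
  · intro a ha b hb hab
    simp only [ha, hb, dif_pos] at hab
    simpa using θ.injective (Subtype.ext hab)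
  · intro a ha e he hab
    simp only [ha, he, dif_pos] at hab
    simpa using θ.injective (Subtype.ext hab)

/-- Embedding an odd-ballooning in which the vertices of `I` and a new vertex of each cycle of `F`
are mapped outside the two classes, and the cycles of `U` use prescribed defects. -/
theorem isContained_of_structure [Finite W] (hH : H.IsBipartite)
    (hℓ : ∀ e, Odd (ℓ e) ∧ 5 ≤ ℓ e)
    (G : SimpleGraph V) (X : Bool → Finset V) (C : ℕ)
    (hX : ∀ b, ∀ v ∈ X b, missIn G v (X (!b)) ≤ C)
    {I : Finset W} {F U : Finset H.edgeSet} {y₀ : W}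
    (hI : ∀ u ∈ I, ∀ v ∈ I, ¬ H.Adj u v)
    (hcov : ∀ e, e ∉ F → e ∉ U → ∃ u ∈ I, u ∈ e.1)
    (hF : ∀ e ∈ F, ∀ u ∈ I, u ∉ e.1) (hU : ∀ e ∈ U, ∀ u ∈ I, u ∉ e.1)
    (hy₀ : ∀ e ∈ U, y₀ ∈ e.1)
    {YA YB : Finset V} {Z : H.edgeSet → Finset V} (hA : YA ⊆ X true) (hB : YB ⊆ X false)
    (hZ : ∀ e, Z e ⊆ X false)
    (hAc : (C + 1) * Nat.card (BVert H ℓ) ≤ YA.card)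
    (hBc : (C + 1) * Nat.card (BVert H ℓ) ≤ YB.card)
    (hZc : ∀ e, (C + 1) * Nat.card (BVert H ℓ) ≤ (Z e).card)
    (Ω : Finset V) (φ : W → V) (ψ : H.edgeSet → V) (hφ : ∀ a ∈ I, φ a ∈ Ω)
    (hψ : ∀ e ∈ F, ψ e ∈ Ω) (hφi : ∀ a ∈ I, ∀ b ∈ I, φ a = φ b → a = b)
    (hψi : ∀ a ∈ F, ∀ b ∈ F, ψ a = ψ b → a = b) (hφψ : ∀ a ∈ I, ∀ e ∈ F, φ a ≠ ψ e)
    (hφm : ∀ a ∈ I, missIn G (φ a) YA ≤ C ∧ missIn G (φ a) YB ≤ C)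
    (hψm : ∀ e ∈ F, missIn G (ψ e) YA ≤ C ∧ missIn G (ψ e) (Z e) ≤ C)
    (gv : Option V)
    (hgv : ∀ v, gv = some v → v ∉ Ω ∧ missIn G v YB ≤ C ∧ (∀ e ∈ F, missIn G v (Z e) ≤ C) ∧
      ∀ u ∈ I, ¬ H.Adj y₀ u)
    (kU : H.edgeSet → Kind V) (hkΩ : ∀ e ∈ U, ∀ v ∈ (kU e).verts, v ∉ Ω)
    (hkgv : ∀ e ∈ U, ∀ v ∈ (kU e).verts, gv ≠ some v)
    (hkk : ∀ e ∈ U, ∀ e' ∈ U, ∀ v ∈ (kU e).verts, v ∈ (kU e').verts → e = e')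
    (hk : ∀ e ∈ U, (kU e).Good G C YA YB (Z e) gv none) :
    oddBallooning H ℓ ⊑ G := by
  classical
  -- With `y₀` coloured `true`, it is the source of every edge of `U`, as `Kind.Good` expects.
  obtain ⟨c, hc, hcy⟩ := exists_coloring hH y₀
  obtain ⟨o, ho⟩ := exists_orientation_of_coloring hc
  have hdsty : ∀ e, o.dst e ≠ y₀ := by
    intro e h
    have h1 := (ho e).2
    rw [h, hcy] at h1
    cases h1
  let g : W → Option V := fun a => if a ∈ I then some (φ a) else if a = y₀ then gv else none
  have hgI : ∀ a ∈ I, g a = some (φ a) := fun a ha => if_pos ha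
  have hgy : y₀ ∉ I → g y₀ = gv := fun h => by simp [g, h]
  have hgn : ∀ a, a ∉ I → a ≠ y₀ → g a = none := fun a h h' => by simp [g, h, h']
  have hgcases : ∀ a v, g a = some v → (a ∈ I ∧ v = φ a) ∨ (a ∉ I ∧ a = y₀ ∧ gv = some v) := by
    intro a v h
    by_cases h1 : a ∈ I
    · rw [hgI a h1] at h
      exact .inl ⟨h1, (Option.some.inj h).symm⟩
    · by_cases h2 : a = y₀
      · subst h2
        rw [hgy h1] at h
        exact .inr ⟨h1, rfl, h⟩
      · rw [hgn a h1 h2] at h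
        cases h
  let k : H.edgeSet → Kind V := fun e => if e ∈ F then .hub (ψ e) else if e ∈ U then kU e
    else if o.src e ∈ I then .covS else .covD
  have hsrcmem : ∀ e : H.edgeSet, o.src e ∈ e.1 := fun e => o.mem_iff.2 (.inl rfl)
  have hdstmem : ∀ e : H.edgeSet, o.dst e ∈ e.1 := fun e => o.mem_iff.2 (.inr rfl)
  have hverts : ∀ e v, v ∈ (k e).verts → (e ∈ F ∧ v = ψ e) ∨ (e ∈ U ∧ v ∈ (kU e).verts) := by
    intro e v hv
    simp only [k] at hv
    split_ifs at hv with h1 h2 h3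
    · exact .inl ⟨h1, by simpa [Kind.verts] using hv⟩
    · exact .inr ⟨h2, hv⟩
    · simp [Kind.verts] at hv
    · simp [Kind.verts] at hv
  refine isContained_of_kinds o hℓ G X C hX c (fun e => (ho e).1) (fun e => (ho e).2) YA YB Z hA
    hB hZ hAc hBc hZc g k ?_ ?_ ?_ ?_
  · intro a b v ha hb
    rcases hgcases a v ha with ⟨h1, h2⟩ | ⟨h1, h2, h3⟩ <;>
      rcases hgcases b v hb with ⟨h4, h5⟩ | ⟨h4, h5, h6⟩
    · exact hφi a h1 b h4 (h2.symm.trans h5)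
    · exact absurd (h2 ▸ hφ a h1) (hgv v h6).1
    · exact absurd (h5 ▸ hφ b h4) (hgv v h3).1
    · rw [h2, h5]
  · intro a v e ha hv
    rcases hgcases a v ha with ⟨h1, h2⟩ | ⟨h1, h2, h3⟩ <;>
      rcases hverts e v hv with ⟨h4, h5⟩ | ⟨h4, h5⟩
    · exact hφψ a h1 e h4 (h2.symm.trans h5)
    · exact hkΩ e h4 v h5 (h2 ▸ hφ a h1)
    · exact (hgv v h3).1 (h5 ▸ hψ e h4)
    · exact hkgv e h4 v h5 h3
  · intro e e' v hv hv'
    rcases hverts e v hv with ⟨h1, h2⟩ | ⟨h1, h2⟩ <;>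
      rcases hverts e' v hv' with ⟨h4, h5⟩ | ⟨h4, h5⟩
    · exact hψi e h1 e' h4 (h2.symm.trans h5)
    · exact absurd (h2 ▸ hψ e h1) (hkΩ e' h4 v h5)
    · exact absurd (h5 ▸ hψ e' h4) (hkΩ e h1 v h2)
    · exact hkk e h1 e' h4 v h2 h5
  · intro e
    by_cases h1 : e ∈ F
    · have hs : o.src e ∉ I := fun h => hF e h1 _ h (hsrcmem e)
      have hd : o.dst e ∉ I := fun h => hF e h1 _ h (hdstmem e)
      simp only [k, if_pos h1]
      refine ⟨hgn _ hd (hdsty e), (hψm e h1).1, (hψm e h1).2, fun v hv => ?_⟩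
      rcases hgcases _ v hv with ⟨h2, -⟩ | ⟨-, -, h3⟩
      · exact absurd h2 hs
      · exact ⟨(hgv v h3).2.1, (hgv v h3).2.2.1 e h1⟩
    by_cases h2 : e ∈ U
    · have hs : o.src e ∉ I := fun h => hU e h2 _ h (hsrcmem e)
      have hd : o.dst e ∉ I := fun h => hU e h2 _ h (hdstmem e)
      have hy : y₀ = o.src e := (o.mem_iff.1 (hy₀ e h2)).resolve_right fun h => hdsty e h.symm
      simp only [k, if_neg h1, if_pos h2]
      rw [hgn _ hd (hdsty e), ← hy, hgy (hy ▸ hs)]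
      exact hk e h2
    by_cases h3 : o.src e ∈ I
    · simp only [k, if_neg h1, if_neg h2, if_pos h3]
      have hd : o.dst e ∉ I := fun h => hI _ h3 _ h (o.adj e)
      exact ⟨hgn _ hd (hdsty e), φ (o.src e), hgI _ h3, hφm _ h3⟩
    · simp only [k, if_neg h1, if_neg h2, if_neg h3]
      obtain ⟨u, hu, hue⟩ := hcov e h1 h2
      obtain rfl : u = o.dst e := (o.mem_iff.1 hue).resolve_left fun h => h3 (h ▸ hu)
      refine ⟨?_, φ (o.dst e), hgI _ hu, hφm _ hu⟩
      by_contra hne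
      obtain ⟨v, hv⟩ := Option.ne_none_iff_exists'.1 hne
      rcases hgcases _ v hv with ⟨h4, -⟩ | ⟨-, h5, h6⟩
      · exact h3 h4
      · exact (hgv v h6).2.2.2 _ hu (h5 ▸ o.adj e)

/-- Besides `q - 1` vertices complete to `YA` and `YB`, a last one, `u`, needs only `YA` and a
bounded number of neighbours in the other class. If some cycle has its covering vertex among the new
vertices, `u` takes that place and one neighbour of it on the cycle is chosen from the neighbours of
`u` in `X false`. Otherwise `I` covers `H`; all other old vertices go to `YA`, and the first new
vertex of each cycle is chosen from the neighbours of the image of its source in `X false`. -/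
theorem isContained_of_extra_hub [Finite W] (hH : H.IsBipartite)
    (hℓ : ∀ e, Odd (ℓ e) ∧ 5 ≤ ℓ e)
    (G : SimpleGraph V) (X : Bool → Finset V) (C : ℕ)
    (hX : ∀ b, ∀ v ∈ X b, missIn G v (X (!b)) ≤ C)
    {YA YB : Finset V} (hA : YA ⊆ X true) (hB : YB ⊆ X false)
    (hAc : (C + 1) * Nat.card (BVert H ℓ) ≤ YA.card)
    (hBc : (C + 1) * Nat.card (BVert H ℓ) ≤ YB.card)
    {Ω : Finset V} {u : V} (hu : u ∉ Ω) (hΩ : qTilde (oddBallooning H ℓ) ≤ Ω.card + 1)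
    (hΩA : ∀ w ∈ Ω, missIn G w YA = 0) (hΩB : ∀ w ∈ Ω, missIn G w YB = 0)
    (huA : missIn G u YA = 0)
    (huX : (C + 1) * Nat.card (BVert H ℓ) ≤ degIn G u (X false)) :
    oddBallooning H ℓ ⊑ G := by
  classical
  have : Nonempty V := ⟨u⟩
  obtain ⟨I, F, hI, hcov, hF, hIF⟩ := exists_cover_structure hH hℓ
  have hnbr : ∀ w S, missIn G w (nbrIn G w S) = 0 := fun w S =>
    missIn_eq_zero.2 fun y hy => (mem_nbrIn.1 hy).2
  rcases F.eq_empty_or_nonempty with rfl | ⟨e₀, he₀⟩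
  · -- all old vertices outside `I` lie in the class `true`
    simp only [Finset.notMem_empty, not_false_eq_true, true_implies] at hcov
    obtain ⟨φ, ψ, hφ, -, hφi, -⟩ := exists_assignment I (∅ : Finset Unit) (insert u Ω)
      (by rw [Finset.card_insert_of_notMem hu]; simpa using hIF.trans hΩ)
    obtain ⟨o, ho⟩ := exists_orientation_of_mem (H := H) (fun a => a ∈ I)
    have hsrc : ∀ e, o.src e ∈ I := fun e => ho e (by
      obtain ⟨a, ha, hae⟩ := hcov e
      exact ⟨a, hae, ha⟩)
    have hdst : ∀ e, o.dst e ∉ I := fun e h => hI _ (hsrc e) _ h (o.adj e)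
    have hφA : ∀ a ∈ I, missIn G (φ a) YA ≤ C := by
      intro a ha
      rcases Finset.mem_insert.1 (hφ a ha) with h | h
      · rw [h, huA]; exact Nat.zero_le _
      · rw [hΩA _ h]; exact Nat.zero_le _
    have hφX : ∀ a ∈ I, (C + 1) * Nat.card (BVert H ℓ) ≤ (nbrIn G (φ a) (X false)).card := by
      intro a ha
      rcases Finset.mem_insert.1 (hφ a ha) with h | h
      · rw [h]; exact huX
      · refine hBc.trans ?_
        have h1 := degIn_add_missIn (G := G) (φ a) YB
        rw [hΩB _ h, add_zero] at h1
        rw [← h1]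
        exact degIn_mono _ hB
    let κ : W → Cell V := fun a => (if a ∈ I then some (φ a) else none, true, YA)
    let κe : H.edgeSet → ℕ → Cell V := fun e j =>
      if j = 0 then (none, false, nbrIn G (φ (o.src e)) (X false))
      else baseCell YA YB (decide (j % 2 = 1))
    have hκI : ∀ a ∈ I, κ a = (some (φ a), true, YA) := fun a ha => by simp [κ, ha]
    have hκn : ∀ a, a ∉ I → κ a = (none, true, YA) := fun a ha => by simp [κ, ha]
    have hκ0 : ∀ e, κe e 0 = (none, false, nbrIn G (φ (o.src e)) (X false)) := fun e => rfl
    have hκs : ∀ e j, κe e (j + 1) = baseCell YA YB (decide ((j + 1) % 2 = 1)) :=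
      fun e j => by simp [κe]
    have hκen : ∀ e j, (κe e j).1 = none := by
      rintro e (_ | j)
      · rfl
      · rw [hκs]; rfl
    have hκsome : ∀ a v, (κ a).1 = some v → a ∈ I ∧ v = φ a := by
      intro a v h
      by_cases h1 : a ∈ I
      · rw [hκI a h1] at h
        exact ⟨h1, (Option.some.inj h).symm⟩
      · rw [hκn a h1] at h
        cases h
    refine isContained_of_cells o G X C hX κ κe ?_ ?_ ?_ ?_ ?_ ?_ ?_ ?_ ?_
    · intro a b v ha hb
      obtain ⟨h1, h2⟩ := hκsome a v ha
      obtain ⟨h3, h4⟩ := hκsome b v hb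
      exact hφi a h1 b h3 (h2.symm.trans h4)
    · intro a e j v _ h
      rw [hκen] at h
      cases h
    · intro e e' j j' v h
      rw [hκen] at h
      cases h
    · exact fun z _ => ⟨hA, hAc⟩
    · rintro e (_ | j) -
      · exact ⟨fun y hy => (mem_nbrIn.1 hy).1, hφX _ (hsrc e)⟩
      · rw [hκs]
        cases decide ((j + 1) % 2 = 1)
        exacts [⟨hB, hBc⟩, ⟨hA, hAc⟩]
    · intro e
      rw [hκI _ (hsrc e), hκn _ (hdst e)]
      exact cellOK_some_none (hφA _ (hsrc e))
    · intro e
      rw [hκI _ (hsrc e), hκ0]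
      exact cellOK_some_none ((hnbr _ _).trans_le (Nat.zero_le _))
    · intro e
      obtain ⟨r, hr⟩ := (hℓ e).1
      have h5 := (hℓ e).2
      obtain ⟨j, hj⟩ : ∃ j, ℓ e - 3 = 2 * j + 1 + 1 := ⟨r - 2, by omega⟩
      rw [hκn _ (hdst e), hj, hκs, show (2 * j + 1 + 1) % 2 = 0 by omega]
      exact cellOK_none (by decide)
    · rintro e (_ | j)
      · rw [hκ0, hκs]
        exact cellOK_none (by decide)
      · rw [hκs, hκs]
        exact cellOK_base (decide_mod_ne _ 1 (by norm_num))
  · obtain ⟨φ, ψ, hφ, hψ, hφi, hψi, hφψ⟩ := exists_assignment I (F.erase e₀) Ω (by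
      rw [Finset.card_erase_of_mem he₀]
      have : 0 < F.card := Finset.card_pos.2 ⟨e₀, he₀⟩
      omega)
    obtain ⟨a₀⟩ : Nonempty W := ⟨(Quot.out e₀.1).1⟩
    have hup : ∀ e, e ≠ e₀ → Function.update ψ e₀ u e = ψ e := fun e he =>
      Function.update_of_ne he _ _
    have hself : Function.update ψ e₀ u e₀ = u := Function.update_self _ _ _
    have hψ' : ∀ e ∈ F, e ≠ e₀ → ψ e ∈ Ω := fun e he h => hψ e (Finset.mem_erase.2 ⟨h, he⟩)
    refine isContained_of_structure hH hℓ G X C hX (U := ∅) (y₀ := a₀) hI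
      (fun e he _ => hcov e he) hF (by simp) (by simp) hA hB
      (Z := fun e => if e = e₀ then nbrIn G u (X false) else YB) ?_ hAc hBc ?_ (insert u Ω) φ
      (Function.update ψ e₀ u) (fun a ha => Finset.mem_insert_of_mem (hφ a ha)) ?_ hφi ?_ ?_
      (fun a ha => ⟨(hΩA _ (hφ a ha)).trans_le (Nat.zero_le _),
        (hΩB _ (hφ a ha)).trans_le (Nat.zero_le _)⟩) ?_ none (by simp) (fun _ => .covS)
      (by simp) (by simp) (by simp) (by simp)
    · intro e
      split_ifs
      exacts [fun y hy => (mem_nbrIn.1 hy).1, hB]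
    · intro e
      split_ifs
      exacts [huX, hBc]
    · intro e he
      by_cases h : e = e₀
      · subst h
        rw [hself]
        exact Finset.mem_insert_self _ _
      · rw [hup e h]
        exact Finset.mem_insert_of_mem (hψ' e he h)
    · intro e he e' he' h
      by_cases h1 : e = e₀ <;> by_cases h2 : e' = e₀
      · rw [h1, h2]
      · rw [h1, hself, hup e' h2] at h
        exact absurd (h ▸ hψ' e' he' h2) hu
      · rw [h2, hself, hup e h1] at h
        exact absurd (h ▸ hψ' e he h1) hu
      · rw [hup e h1, hup e' h2] at h
        exact hψi e (Finset.mem_erase.2 ⟨h1, he⟩) e' (Finset.mem_erase.2 ⟨h2, he'⟩) h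
    · intro a ha e he h
      by_cases h1 : e = e₀
      · rw [h1, hself] at h
        exact hu (h ▸ hφ a ha)
      · rw [hup e h1] at h
        exact hφψ a ha e (Finset.mem_erase.2 ⟨h1, he⟩) h
    · intro e he
      by_cases h1 : e = e₀
      · subst h1
        rw [hself, if_pos rfl, huA, hnbr]
        exact ⟨Nat.zero_le _, Nat.zero_le _⟩
      · rw [hup e h1, if_neg h1, hΩA _ (hψ' e he h1), hΩB _ (hψ' e he h1)]
        exact ⟨Nat.zero_le _, Nat.zero_le _⟩

end Structure

end Ballooning

namespace Ballooning

/-! ### Exactly `q - 1` vertices outside two nearly complete classes -/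

section NearStructure

variable {W V : Type*} {H : SimpleGraph W} {ℓ : H.edgeSet → ℕ}

/-- Two almost completely joined classes `A`, `B` of almost the same size, and `p` further vertices
adjacent to almost all vertices of the classes. -/
structure NearStructure [Fintype V] (G : SimpleGraph V) (p C : ℕ) (A B Ω : Finset V) : Prop where
  disjAB : Disjoint A B
  disjAΩ : Disjoint A Ω
  disjBΩ : Disjoint B Ω
  cover : ∀ x, x ∈ A ∨ x ∈ B ∨ x ∈ Ω
  card : Ω.card = p
  missA : ∀ v ∈ A, missIn G v B ≤ C
  missB : ∀ v ∈ B, missIn G v A ≤ C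
  missΩA : ∀ w ∈ Ω, missIn G w A ≤ C
  missΩB : ∀ w ∈ Ω, missIn G w B ≤ C
  largeA : Fintype.card V ≤ 2 * A.card + C
  largeB : Fintype.card V ≤ 2 * B.card + C

lemma NearStructure.symm [Fintype V] {G : SimpleGraph V} {p C : ℕ} {A B Ω : Finset V}
    (h : NearStructure G p C A B Ω) : NearStructure G p C B A Ω :=
  ⟨h.disjAB.symm, h.disjBΩ, h.disjAΩ, fun x => by have := h.cover x; tauto, h.card, h.missB,
    h.missA, h.missΩB, h.missΩA, h.largeB, h.largeA⟩

/-- Two popular traces that together exceed the number of vertices outside the classes yield the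
ballooning. -/
lemma RoughStructure.false_of_popular [Finite W] [DecidableEq V] (hH : H.IsBipartite)
    (hℓ : ∀ e, Odd (ℓ e) ∧ 5 ≤ ℓ e) {G : SimpleGraph V} (hfree : (oddBallooning H ℓ).Free G)
    {E₀ C p : ℕ} {A₃ B₃ A B Ω : Finset V}
    (h : RoughStructure G E₀ ((C + 1) * Nat.card (BVert H ℓ)) A₃ B₃ A B Ω)
    (hA₃ : ∀ v ∈ A₃, missIn G v B₃ ≤ C) (hB₃ : ∀ v ∈ B₃, missIn G v A₃ ≤ C)
    (hp : qTilde (oddBallooning H ℓ) ≤ p + 1) {QA QB YA YB : Finset V} (hQA : QA ⊆ Ω)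
    (hYA : YA ⊆ A₃) (hYB : YB ⊆ B₃)
    (hYAc : (C + 1) * Nat.card (BVert H ℓ) ≤ YA.card)
    (hYBc : (C + 1) * Nat.card (BVert H ℓ) ≤ YB.card) (hQYA : ∀ v ∈ QA, missIn G v YA = 0)
    (hQYB : ∀ v ∈ QB, missIn G v YB = 0) (hcap : p ≤ (QA ∩ QB).card) (hQAc : p < QA.card) :
    False := by
  classical
  obtain ⟨Ω', hΩ', hΩ'c⟩ := Finset.exists_subset_card_eq hcap
  obtain ⟨u, hu, huΩ⟩ := Finset.exists_mem_notMem_of_card_lt_card (hΩ'c.trans_lt hQAc)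
  refine hfree (isContained_of_extra_hub hH hℓ G (fun b => if b then A₃ else B₃) C ?_ hYA hYB
    hYAc hYBc huΩ (by omega) (fun w hw => hQYA w (Finset.mem_inter.1 (hΩ' hw)).1)
    (fun w hw => hQYB w (Finset.mem_inter.1 (hΩ' hw)).2) (hQYA u hu) (h.degWB u (hQA hu)))
  rintro (_ | _)
  exacts [hB₃, hA₃]

/-- Let `QA`, `QB` be the largest popular traces of `A₃`, `B₃` on the exceptional set `Ω`. The edge
count gives `|QA| + |QB| ≥ |Ω| + p`, so they share at least `p` vertices. If `|Ω| ≠ p`, one of them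
has more than `p` elements and provides the extra hub, a contradiction. With `|Ω| = p`, the same
count leaves boundedly many missing edges between `Ω` and the classes. -/
lemma nearStructure_aux [Finite W] [Fintype V] (hH : H.IsBipartite)
    (hℓ : ∀ e, Odd (ℓ e) ∧ 5 ≤ ℓ e) {G : SimpleGraph V} (hfree : (oddBallooning H ℓ).Free G)
    {E₀ K p c₀ c₁ c₂ : ℕ} (hK : K = (E₀ + 1 + 1) * Nat.card (BVert H ℓ))
    (hp : qTilde (oddBallooning H ℓ) = p + 1)
    (hc₁ : c₁ = c₀ + 6 * (E₀ * E₀) + 4 * (E₀ * (K + E₀))) (hc₂ : c₂ = 2 ^ E₀ * K * E₀)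
    (hn : 2 * E₀ + 4 * c₂ + c₁ + 2 * (2 ^ E₀ * K) + 4 < Fintype.card V)
    {A₃ B₃ : Finset V} (hAB : Disjoint A₃ B₃)
    (hA : ∀ x ∈ A₃, ∀ y ∈ A₃, ¬ G.Adj x y) (hB : ∀ x ∈ B₃, ∀ y ∈ B₃, ¬ G.Adj x y)
    (hr : Fintype.card V ≤ A₃.card + B₃.card + E₀)
    (hdeg : ∀ v : V, Fintype.card V ≤ 2 * degIn G v Finset.univ + 1)
    (he : Fintype.card V ^ 2 + 2 * p * Fintype.card V
      ≤ 2 * ∑ v, degIn G v Finset.univ + c₀) :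
    ∃ A B Ω, NearStructure G p (c₁ + 3 * E₀ + K + 1) A B Ω := by
  classical
  obtain ⟨hAc, hBc, hv⟩ := rough_bounds hAB hA hB hr hdeg
  obtain ⟨A, B, Ω, h⟩ := exists_roughStructure K hAB hA hB hr hdeg
  have h1 := h.card_mul_le he
  rw [← hc₁] at h1
  have hΩ := h.cardW
  have hpow : 2 ^ Ω.card * K ≤ 2 ^ E₀ * K :=
    Nat.mul_le_mul_right _ (Nat.pow_le_pow_right (by norm_num) hΩ)
  have hpow' : 2 ^ Ω.card * K * Ω.card ≤ c₂ := hc₂ ▸ Nat.mul_le_mul hpow hΩ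
  obtain ⟨QA, hQA, YA, hYA, hYAc, hQYA, hsumA⟩ := exists_popular (G := G) (S := A₃) (W := Ω)
    (K := K) (Finset.card_pos.1 (by omega)) (by omega)
  obtain ⟨QB, hQB, YB, hYB, hYBc, hQYB, hsumB⟩ := exists_popular (G := G) (S := B₃) (W := Ω)
    (K := K) (Finset.card_pos.1 (by omega)) (by omega)
  have hQAc := Finset.card_le_card hQA
  have hQBc := Finset.card_le_card hQB
  have hA0 : ∀ v ∈ A₃, degIn G v A₃ = 0 := fun v hv => degIn_eq_zero.2 fun y hy => hA v hv y hy
  have hB0 : ∀ v ∈ B₃, degIn G v B₃ = 0 := fun v hv => degIn_eq_zero.2 fun y hy => hB v hv y hy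
  have hA₃ : ∀ v ∈ A₃, missIn G v B₃ ≤ E₀ + 1 := fun v hvA => by
    have := (hv v).2.1
    rw [hA0 v hvA] at this
    omega
  have hB₃ : ∀ v ∈ B₃, missIn G v A₃ ≤ E₀ + 1 := fun v hvB => by
    have := (hv v).2.2
    rw [hB0 v hvB] at this
    omega
  have hQ : Ω.card + p ≤ QA.card + QB.card := by
    by_contra hcon
    have h2 : (QA.card + QB.card + 1) * Fintype.card V ≤ (Ω.card + p) * Fintype.card V :=
      Nat.mul_le_mul_right _ (by omega)
    have h3 : QA.card * (2 * A₃.card) ≤ QA.card * (Fintype.card V + 1) :=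
      Nat.mul_le_mul_left _ hAc
    have h4 : QB.card * (2 * B₃.card) ≤ QB.card * (Fintype.card V + 1) :=
      Nat.mul_le_mul_left _ hBc
    have e1 : (QA.card + QB.card + 1) * Fintype.card V = QA.card * Fintype.card V +
      QB.card * Fintype.card V + Fintype.card V := by ring
    have e2 : QA.card * (2 * A₃.card) = 2 * (QA.card * A₃.card) := by ring
    have e3 : QB.card * (2 * B₃.card) = 2 * (QB.card * B₃.card) := by ring
    rw [mul_add, mul_one] at h3 h4
    omega
  have hcap : p ≤ (QA ∩ QB).card := by
    have h2 := Finset.card_union_add_card_inter QA QB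
    have h3 := Finset.card_le_card (Finset.union_subset hQA hQB)
    omega
  have hΩp : Ω.card = p := by
    by_contra hne
    have hlt : p < QA.card ∨ p < QB.card := by omega
    rw [hK] at h hYAc hYBc
    rcases hlt with hlt | hlt
    · exact h.false_of_popular hH hℓ hfree hA₃ hB₃ hp.le hQA hYA hYB hYAc hYBc hQYA hQYB hcap hlt
    · exact h.symm.false_of_popular hH hℓ hfree hB₃ hA₃ hp.le hQB hYB hYA hYBc hYAc hQYB hQYA
        (Finset.inter_comm QA QB ▸ hcap) hlt
  have hmissΩ : ∀ w ∈ Ω, missIn G w A₃ + missIn G w B₃ ≤ c₁ := by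
    have h2 : ∑ w ∈ Ω, (degIn G w A₃ + degIn G w B₃) + ∑ w ∈ Ω, (missIn G w A₃ + missIn G w B₃)
        ≤ p * Fintype.card V := by
      rw [← Finset.sum_add_distrib, ← hΩp, ← smul_eq_mul]
      refine Finset.sum_le_card_nsmul _ _ _ fun w _ => ?_
      have h3 := degIn_add_missIn (G := G) w A₃
      have h4 := degIn_add_missIn (G := G) w B₃
      have h5 := h.card_eq
      have h6 := Finset.card_le_card h.subA
      have h7 := Finset.card_le_card h.subB
      omega
    have h3 : ∑ w ∈ Ω, (missIn G w A₃ + missIn G w B₃) ≤ c₁ := by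
      rw [sum_degIn_comm A₃, sum_degIn_comm B₃, ← Finset.sum_add_distrib, hΩp] at h1
      have e1 : (p + p) * Fintype.card V = 2 * (p * Fintype.card V) := by ring
      omega
    exact fun w hw => (Finset.single_le_sum (f := fun w => missIn G w A₃ + missIn G w B₃)
      (fun _ _ => Nat.zero_le _) hw).trans h3
  have hext : ∀ S T : Finset V, S ⊆ T → T.card ≤ S.card + E₀ → ∀ v,
      missIn G v T ≤ missIn G v S + E₀ := by
    intro S T hST hc v
    have h2 : T \ S ∪ S = T := Finset.sdiff_union_of_subset hST
    rw [← h2, missIn_union v Finset.sdiff_disjoint, add_comm]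
    refine Nat.add_le_add_left ((missIn_le_card _ _).trans ?_) _
    rw [Finset.card_sdiff_of_subset hST]
    omega
  have hextA := hext _ _ h.subA h.cardA
  have hextB := hext _ _ h.subB h.cardB
  have h6 := Finset.card_le_card h.subA
  have h7 := Finset.card_le_card h.subB
  -- A vertex of a class misses at most `1 + E₀` plus its at most `K + E₀` neighbours in the own
  -- class, and `E₀` more outside the independent part of the other class; a vertex of `Ω` misses at
  -- most `c₁ + E₀` in either class.
  refine ⟨A, B, Ω, h.disjAB, h.disjAW, h.disjBW, h.cover, hΩp, fun v hvA => ?_, fun v hvB => ?_,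
    fun w hw => ?_, fun w hw => ?_, by omega, by omega⟩
  · have h2 := (hv v).2.1
    have h3 := h.degA v hvA
    have h4 := degIn_mono (G := G) v h.subA
    have h5 := hextB v
    omega
  · have h2 := (hv v).2.2
    have h3 := h.degB v hvB
    have h4 := degIn_mono (G := G) v h.subB
    have h5 := hextA v
    omega
  · have h2 := hmissΩ w hw
    have h5 := hextA w
    omega
  · have h2 := hmissΩ w hw
    have h5 := hextB w
    omega

theorem exists_nearStructure [Finite W] (hH : H.IsBipartite) (hne : H ≠ ⊥)
    (hℓ : ∀ e, Odd (ℓ e) ∧ 5 ≤ ℓ e) (c₀ : ℕ) :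
    ∃ C n₁ : ℕ, ∀ {V : Type*} [Fintype V] (G : SimpleGraph V), n₁ ≤ Fintype.card V →
      (oddBallooning H ℓ).Free G →
      (∀ v : V, Fintype.card V ≤ 2 * degIn G v Finset.univ + 1) →
      Fintype.card V ^ 2 + 2 * (qTilde (oddBallooning H ℓ) - 1) * Fintype.card V
        ≤ 2 * ∑ v, degIn G v Finset.univ + c₀ →
      ∃ A B Ω, NearStructure G (qTilde (oddBallooning H ℓ) - 1) C A B Ω := by
  obtain ⟨E₀, n₁, hst⟩ := exists_stability hH hne hℓ
  have hq := one_le_qTilde hH hne hℓ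
  obtain ⟨p, hp⟩ : ∃ p, qTilde (oddBallooning H ℓ) - 1 = p := ⟨_, rfl⟩
  rw [hp]
  obtain ⟨K, hK⟩ : ∃ K, K = (E₀ + 1 + 1) * Nat.card (BVert H ℓ) := ⟨_, rfl⟩
  obtain ⟨c₁, hc₁⟩ : ∃ c, c = c₀ + 6 * (E₀ * E₀) + 4 * (E₀ * (K + E₀)) := ⟨_, rfl⟩
  obtain ⟨c₂, hc₂⟩ : ∃ c, c = 2 ^ E₀ * K * E₀ := ⟨_, rfl⟩
  refine ⟨c₁ + 3 * E₀ + K + 1, n₁ + (2 * E₀ + 4 * c₂ + c₁ + 2 * (2 ^ E₀ * K) + 4 + 1),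
    fun {V} _ G hn hfree hdeg he => ?_⟩
  obtain ⟨A, B, hAB, hA, hB, hr⟩ := hst G ((Nat.le_add_right _ _).trans hn) hfree hdeg
  exact nearStructure_aux hH hℓ hfree hK (by omega) hc₁ hc₂ ((Nat.le_add_left _ _).trans hn) hAB hA hB hr
    hdeg he

end NearStructure

end Ballooning

namespace Ballooning

/-! ### Conditions forced on a near structure by freeness -/

section Conditions

variable {W V : Type*} {H : SimpleGraph W} {ℓ : H.edgeSet → ℕ} [Fintype V] {G : SimpleGraph V}
  {p C : ℕ} {A B Ω : Finset V}

/-- The set `Ω` hosts `I` and one hub for each cycle of `F`. Each cycle of `U` takes a resource of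
its own from `R`, a defect inside the classes. -/
lemma NearStructure.isContained_of_resources [Finite W] (h : NearStructure G p C A B Ω)
    (hH : H.IsBipartite) (hℓ : ∀ e, Odd (ℓ e) ∧ 5 ≤ ℓ e)
    (hA : (C + 1) * Nat.card (BVert H ℓ) ≤ A.card)
    (hB : (C + 1) * Nat.card (BVert H ℓ) ≤ B.card) [Nonempty V]
    {I : Finset W} {F U : Finset H.edgeSet} {y₀ : W}
    (hI : ∀ u ∈ I, ∀ v ∈ I, ¬ H.Adj u v)
    (hcov : ∀ e, e ∉ F → e ∉ U → ∃ u ∈ I, u ∈ e.1)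
    (hF : ∀ e ∈ F, ∀ u ∈ I, u ∉ e.1) (hU : ∀ e ∈ U, ∀ u ∈ I, u ∉ e.1)
    (hy₀ : ∀ e ∈ U, y₀ ∈ e.1) (hIF : I.card + F.card ≤ p) {R : Type*} [Fintype R]
    (κ : R → Kind V) (hUR : U.card ≤ Fintype.card R)
    (hκ : ∀ r, ∀ v ∈ (κ r).verts, v ∈ A ∨ v ∈ B)
    (hdisj : ∀ r r' v, v ∈ (κ r).verts → v ∈ (κ r').verts → r = r') (gv : Option V)
    (hgv : ∀ v, gv = some v → v ∈ A ∧ (∀ u ∈ I, ¬ H.Adj y₀ u) ∧ ∀ r, v ∉ (κ r).verts)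
    (hk : ∀ r, (κ r).Good G C A B B gv none) : oddBallooning H ℓ ⊑ G := by
  classical
  obtain ⟨φ, ψ, hφ, hψ, hφi, hψi, hφψ⟩ := exists_assignment I F Ω (hIF.trans h.card.ge)
  obtain ⟨θ⟩ : Nonempty (U ↪ R) :=
    Function.Embedding.nonempty_of_card_le (by rwa [Fintype.card_coe])
  let kU : H.edgeSet → Kind V := fun e => if he : e ∈ U then κ (θ ⟨e, he⟩) else .covS
  have hkU : ∀ e (he : e ∈ U), kU e = κ (θ ⟨e, he⟩) := fun e he => dif_pos he
  have hnotΩ : ∀ v, v ∈ A ∨ v ∈ B → v ∉ Ω := by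
    rintro v (hv | hv) hv'
    exacts [Finset.disjoint_left.1 h.disjAΩ hv hv', Finset.disjoint_left.1 h.disjBΩ hv hv']
  refine isContained_of_structure hH hℓ G (fun b => if b then A else B) C ?_ hI hcov hF hU hy₀
    (YA := A) (YB := B) (Z := fun _ => B) (fun _ h => h) (fun _ h => h) (fun _ _ h => h) hA hB
    (fun _ => hB) Ω φ ψ hφ hψ hφi hψi hφψ
    (fun a ha => ⟨h.missΩA _ (hφ a ha), h.missΩB _ (hφ a ha)⟩)
    (fun a ha => ⟨h.missΩA _ (hψ a ha), h.missΩB _ (hψ a ha)⟩) gv ?_ kU ?_ ?_ ?_ ?_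
  · rintro (_ | _)
    exacts [h.missB, h.missA]
  · intro v hv
    obtain ⟨h1, h2, -⟩ := hgv v hv
    exact ⟨hnotΩ v (.inl h1), h.missA v h1, fun _ _ => h.missA v h1, h2⟩
  · intro e he v hv
    rw [hkU e he] at hv
    exact hnotΩ v (hκ _ v hv)
  · intro e he v hv hv'
    rw [hkU e he] at hv
    exact (hgv v hv').2.2 _ hv
  · intro e he e' he' v hv hv'
    rw [hkU e he] at hv
    rw [hkU e' he'] at hv'
    simpa using θ.injective (hdisj _ _ v hv hv')
  · intro e he
    rw [hkU e he]
    exact hk _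

lemma good_aa (h : NearStructure G p C A B Ω) {e : V × V} (he : G.Adj e.1 e.2) (h1 : e.1 ∈ A)
    (h2 : e.2 ∈ A) {gv : Option V} (hgv : ∀ v, gv = some v → v ∈ A) :
    (Kind.aa e.1 e.2).Good G C A B B gv none :=
  ⟨rfl, he, h.missA _ h1, h.missA _ h2, fun v hv => ⟨h.missA _ (hgv v hv), h.missA _ (hgv v hv)⟩⟩

lemma good_bb (h : NearStructure G p C A B Ω) {b b' : V} (he : G.Adj b b') (h1 : b ∈ B)
    (h2 : b' ∈ B) {gv : Option V} (hgv : ∀ v, gv = some v → v ∈ A ∧ G.Adj v b) :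
    (Kind.bb b b').Good G C A B B gv none :=
  ⟨rfl, he, h.missB _ h1, h.missB _ h2, fun v hv => ⟨(hgv v hv).2, h.missA _ (hgv v hv).1⟩⟩

/-- No old vertex is prescribed in the classes here, so any edge inside a class repairs one cycle of
`U`. -/
theorem NearStructure.matchCond [Finite W] (h : NearStructure G p C A B Ω)
    (hH : H.IsBipartite) (hne : H ≠ ⊥) (hℓ : ∀ e, Odd (ℓ e) ∧ 5 ≤ ℓ e)
    (hfree : (oddBallooning H ℓ).Free G) (hp : qTilde (oddBallooning H ℓ) = p + 1)
    (hA : (C + 1) * Nat.card (BVert H ℓ) ≤ A.card)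
    (hB : (C + 1) * Nat.card (BVert H ℓ) ≤ B.card) :
    MatchCond G (kParam (oddBallooning H ℓ) - 1) A B := by
  classical
  intro M₁ M₂ hM₁ hM₂
  by_contra hcon
  have hcard : Fintype.card (M₁ ⊕ M₂) = M₁.card + M₂.card := by
    rw [Fintype.card_sum, Fintype.card_coe, Fintype.card_coe]
  obtain ⟨e⟩ : Nonempty (M₁ ⊕ M₂) := Fintype.card_pos_iff.1 (by omega)
  have : Nonempty V := ⟨e.elim (fun e => e.1.1) fun e => e.1.1⟩
  obtain ⟨I, F, U, y₀, hI, hcov, hF, hU, -, hy₀, hIF, hUc, -⟩ := exists_star_structure hH hne hℓ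
  refine hfree (h.isContained_of_resources hH hℓ hA hB hI hcov hF hU hy₀ (by omega)
    (R := M₁ ⊕ M₂) (Sum.elim (fun e => .aa e.1.1 e.1.2) fun e => .bb e.1.1 e.1.2)
    (by omega) ?_ ?_ none (by simp) ?_)
  · rintro (e | e) v hv
    · have := hM₁.mem _ e.2
      rcases hv with rfl | rfl
      exacts [.inl this.1, .inl this.2]
    · have := hM₂.mem _ e.2
      rcases hv with rfl | rfl
      exacts [.inr this.1, .inr this.2]
  · have hAB : ∀ (e : M₁) (f : M₂) (v : V), (v = e.1.1 ∨ v = e.1.2) → (v = f.1.1 ∨ v = f.1.2) →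
        False := by
      intro e f v hv hv'
      have h1 := hM₁.mem _ e.2
      have h2 := hM₂.mem _ f.2
      have h3 : v ∈ A := by rcases hv with rfl | rfl; exacts [h1.1, h1.2]
      have h4 : v ∈ B := by rcases hv' with rfl | rfl; exacts [h2.1, h2.2]
      exact Finset.disjoint_left.1 h.disjAB h3 h4
    rintro (e | e) (f | f) v hv hv'
    · rw [Subtype.ext (hM₁.disjoint_pair e.2 f.2 hv hv')]
    · exact (hAB e f v hv hv').elim
    · exact (hAB f e v hv' hv).elim
    · rw [Subtype.ext (hM₂.disjoint_pair e.2 f.2 hv hv')]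
  · rintro (e | e)
    · exact good_aa h (hM₁.adj _ e.2) (hM₁.mem _ e.2).1 (hM₁.mem _ e.2).2 (by simp)
    · exact good_bb h (hM₂.adj _ e.2) (hM₂.mem _ e.2).1 (hM₂.mem _ e.2).2 (by simp)

/-- The vertex `y₀` is mapped to `v`. Each neighbour of `v` in `A` is a leaf that repairs one cycle;
an edge of `M₁` is inserted further along a cycle; an edge of `M₂` directly follows `v` on its
cycle, so one of its ends must be adjacent to `v`. Placing `y₀` in a class requires that it has no
neighbour in `I`; the only other possibility is a single cycle in `U`, for which one edge inside a
class is enough. -/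
theorem NearStructure.starCond [Finite W] (h : NearStructure G p C A B Ω)
    (hH : H.IsBipartite) (hne : H ≠ ⊥) (hℓ : ∀ e, Odd (ℓ e) ∧ 5 ≤ ℓ e)
    (hfree : (oddBallooning H ℓ).Free G) (hp : qTilde (oddBallooning H ℓ) = p + 1)
    (hA : (C + 1) * Nat.card (BVert H ℓ) ≤ A.card)
    (hB : (C + 1) * Nat.card (BVert H ℓ) ≤ B.card) :
    StarCond G (kParam (oddBallooning H ℓ) - 1) A B := by
  classical
  intro v hv M₁ M₂ hM₁ hM₂ htouch
  by_contra hcon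
  have : Nonempty V := ⟨v⟩
  obtain ⟨I, F, U, y₀, hI, hcov, hF, hU, -, hy₀, hIF, hUc, hy⟩ := exists_star_structure hH hne hℓ
  have hcard : Fintype.card (nbrIn G v A ⊕ M₁ ⊕ M₂) = degIn G v A + (M₁.card + M₂.card) := by
    rw [Fintype.card_sum, Fintype.card_sum, Fintype.card_coe, Fintype.card_coe, Fintype.card_coe,
      card_nbrIn]
  have hM₁A : ∀ e ∈ M₁, e.1 ∈ A ∧ e.2 ∈ A := fun e he =>
    ⟨(mem_farIn.1 (hM₁.mem _ he).1).1, (mem_farIn.1 (hM₁.mem _ he).2).1⟩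
  rcases hy with hU1 | hy
  · -- a single edge inside one of the classes
    have key : ∀ k : Kind V, (∀ u ∈ k.verts, u ∈ A ∨ u ∈ B) → k.Good G C A B B none none →
        False := fun k hk hk' =>
      hfree (h.isContained_of_resources hH hℓ hA hB hI hcov hF hU hy₀ (by omega)
        (R := Unit) (fun _ => k) (by simpa using hU1) (fun _ => hk) (fun _ _ _ _ _ => rfl) none
        (by simp) fun _ => hk')
    obtain ⟨r⟩ : Nonempty (nbrIn G v A ⊕ M₁ ⊕ M₂) := Fintype.card_pos_iff.1 (by omega)
    rcases r with a | e | e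
    · have ha := mem_nbrIn.1 a.2
      refine key (.aa v a) ?_ (good_aa (e := (v, a.1)) h ha.2 hv ha.1 (by simp))
      rintro u (rfl | rfl)
      exacts [.inl hv, .inl ha.1]
    · have := hM₁A _ e.2
      refine key (.aa e.1.1 e.1.2) ?_ (good_aa h (hM₁.adj _ e.2) this.1 this.2 (by simp))
      rintro u (rfl | rfl)
      exacts [.inl this.1, .inl this.2]
    · have := hM₂.mem _ e.2
      refine key (.bb e.1.1 e.1.2) ?_ (good_bb h (hM₂.adj _ e.2) this.1 this.2 (by simp))
      rintro u (rfl | rfl)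
      exacts [.inr this.1, .inr this.2]
  · let κ : nbrIn G v A ⊕ M₁ ⊕ M₂ → Kind V := Sum.elim (fun a => .leaf a.1)
      (Sum.elim (fun e => .aa e.1.1 e.1.2) fun e =>
        if G.Adj v e.1.1 then .bb e.1.1 e.1.2 else .bb e.1.2 e.1.1)
    have hv1 : ∀ a u, u ∈ (κ (.inl a)).verts → u = a.1 := fun a u hu => hu
    have hv2 : ∀ e u, u ∈ (κ (.inr (.inl e))).verts → u = e.1.1 ∨ u = e.1.2 := fun e u hu => hu
    have hv3 : ∀ e u, u ∈ (κ (.inr (.inr e))).verts → u = e.1.1 ∨ u = e.1.2 := by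
      intro e u hu
      simp only [κ, Sum.elim_inr] at hu
      split_ifs at hu
      exacts [hu, hu.symm]
    have hw1 : ∀ a u, u ∈ (κ (.inl a)).verts → u ∈ A ∧ G.Adj v u := fun a u hu => by
      rw [hv1 a u hu]
      exact mem_nbrIn.1 a.2
    have hw2 : ∀ e u, u ∈ (κ (.inr (.inl e))).verts → u ∈ A ∧ u ≠ v ∧ ¬ G.Adj v u := by
      intro e u hu
      have := hM₁.mem _ e.2
      rcases hv2 e u hu with rfl | rfl
      exacts [mem_farIn.1 this.1, mem_farIn.1 this.2]
    have hw3 : ∀ e u, u ∈ (κ (.inr (.inr e))).verts → u ∈ B := by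
      intro e u hu
      have := hM₂.mem _ e.2
      rcases hv3 e u hu with rfl | rfl
      exacts [this.1, this.2]
    have hAB : ∀ u, u ∈ A → u ∉ B := fun u hu hu' => Finset.disjoint_left.1 h.disjAB hu hu'
    refine hfree (h.isContained_of_resources hH hℓ hA hB hI hcov hF hU hy₀ (by omega)
      κ (by omega) ?_ ?_ (some v) ?_ ?_)
    · rintro (a | e | e) u hu
      exacts [.inl (hw1 a u hu).1, .inl (hw2 e u hu).1, .inr (hw3 e u hu)]
    · rintro (a | e | e) (a' | e' | e') u hu hu'
      · rw [Subtype.ext ((hv1 a u hu).symm.trans (hv1 a' u hu'))]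
      · exact absurd (hw1 a u hu).2 (hw2 e' u hu').2.2
      · exact absurd (hw3 e' u hu') (hAB u (hw1 a u hu).1)
      · exact absurd (hw1 a' u hu').2 (hw2 e u hu).2.2
      · rw [Subtype.ext (hM₁.disjoint_pair e.2 e'.2 (hv2 e u hu) (hv2 e' u hu'))]
      · exact absurd (hw3 e' u hu') (hAB u (hw2 e u hu).1)
      · exact absurd (hw3 e u hu) (hAB u (hw1 a' u hu').1)
      · exact absurd (hw3 e u hu) (hAB u (hw2 e' u hu').1)
      · rw [Subtype.ext (hM₂.disjoint_pair e.2 e'.2 (hv3 e u hu) (hv3 e' u hu'))]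
    · intro u hu
      obtain rfl := Option.some.inj hu
      refine ⟨hv, fun a ha => hy a ha, ?_⟩
      rintro (a | e | e) hr
      exacts [(hw1 a _ hr).2.ne rfl, (hw2 e _ hr).2.1 rfl, hAB _ hv (hw3 e _ hr)]
    · have hgv : ∀ u, some v = some u → u ∈ A := fun u hu => Option.some.inj hu ▸ hv
      rintro (a | e | e)
      · have ha := mem_nbrIn.1 a.2
        exact ⟨rfl, h.missA _ ha.1, v, rfl, ha.2, h.missA _ hv⟩
      · exact good_aa h (hM₁.adj _ e.2) (hM₁A _ e.2).1 (hM₁A _ e.2).2 hgv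
      · have h1 := hM₂.mem _ e.2
        have h2 := hM₂.adj _ e.2
        simp only [κ, Sum.elim_inr]
        split_ifs with h3
        · exact good_bb h h2 h1.1 h1.2 fun u hu => ⟨hgv u hu, Option.some.inj hu ▸ h3⟩
        · exact good_bb h h2.symm h1.2 h1.1 fun u hu =>
            ⟨hgv u hu, Option.some.inj hu ▸ (htouch _ e.2).resolve_left h3⟩

/-- The graph on the vertices outside the classes contains no member of the subgraph covering
family. -/
theorem NearStructure.familyFree [Finite W] (h : NearStructure G p C A B Ω)
    (hfree : (oddBallooning H ℓ).Free G) (hp : qTilde (oddBallooning H ℓ) = p + 1)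
    (hA : (C + 1) * Nat.card (BVert H ℓ) ≤ A.card)
    (hB : (C + 1) * Nat.card (BVert H ℓ) ≤ B.card) {Q : SimpleGraph (Fin p)} {θ : Fin p → V}
    (hθ : Function.Injective θ) (hθΩ : ∀ i, θ i ∈ Ω) (hQ : ∀ i j, Q.Adj i j → G.Adj (θ i) (θ j)) :
    FamilyFree (BTilde (oddBallooning H ℓ)) Q := by
  classical
  have := Fintype.ofFinite (BVert H ℓ)
  rintro J hJ ⟨f⟩
  have hcardJ : J.1 ≤ p := by simpa using Fintype.card_le_of_injective _ f.injective
  unfold BTilde subgraphCoveringFamily at hJ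
  split_ifs at hJ with hcase
  · obtain rfl := Set.mem_singleton_iff.1 hJ
    change qTilde (oddBallooning H ℓ) ≤ p at hcardJ
    omega
  · obtain ⟨M, hM, D, hD, -, ⟨ι⟩⟩ := hJ
    obtain ⟨s, ⟨g⟩⟩ := hM.1
    have hg : ∀ a b, (oddBallooning H ℓ).Adj a b → (graphJoin (M.2 ⊕g (⊥ : SimpleGraph (Fin s)))
      (⊥ : SimpleGraph (Fin s))).Adj (g a) (g b) := fun a b hab => g.toHom.map_adj hab
    -- Only the vertices of the covering `D` get prescribed images, in `Ω`. The other vertices on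
    -- the side of `M` are pairwise non-adjacent and are embedded into `A`, those on the other side
    -- of the join into `B`.
    let im : (Fin M.1 ⊕ Fin s) ⊕ Fin s → Option V
      | .inl (.inl x) => if hx : x ∈ D then some (θ (f (ι.symm ⟨x, hx⟩))) else none
      | .inl (.inr _) => none
      | .inr _ => none
    have him : ∀ z v, im z = some v → ∃ x, ∃ hx : x ∈ D, z = .inl (.inl x) ∧
        v = θ (f (ι.symm ⟨x, hx⟩)) := by
      rintro ((x | y) | y) v hv
      · by_cases hx : x ∈ D
        · simp only [im, hx, dif_pos] at hv
          exact ⟨x, hx, rfl, (Option.some.inj hv).symm⟩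
        · simp [im, hx] at hv
      · simp [im] at hv
      · simp [im] at hv
    have himn : ∀ x, im (.inl (.inl x)) = none → x ∉ D := by
      intro x hx hxD
      simp [im, hxD] at hx
    have hmiss : ∀ z v, im z = some v → ∀ b : Bool, missIn G v (if b then A else B) ≤ C := by
      intro z v hv
      obtain ⟨x, hx, -, rfl⟩ := him z v hv
      rintro (_ | _)
      exacts [h.missΩB _ (hθΩ _), h.missΩA _ (hθΩ _)]
    refine hfree (isContained_of_greedy (oddBallooning H ℓ) G (fun b => if b then A else B) C ?_
      (fun a => (g a).isLeft) (fun a => if (g a).isLeft then A else B) (fun a => im (g a)) ?_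
      (fun _ _ _ h => h) ?_ ?_)
    · rintro (_ | _)
      exacts [h.missB, h.missA]
    · intro a b v ha hb
      obtain ⟨x, hx, hgx, hvx⟩ := him _ _ ha
      obtain ⟨y, hy, hgy, hvy⟩ := him _ _ hb
      have h1 := hθ (hvx.symm.trans hvy)
      have h2 := ι.symm.injective (f.injective h1)
      rw [Subtype.mk.injEq] at h2
      subst h2
      exact g.injective (hgx.trans hgy.symm)
    · intro z _
      rw [← Nat.card_eq_fintype_card]
      split_ifs
      exacts [hA, hB]
    · intro a b hab
      refine ⟨fun u v hu hv => ?_, fun hu hv => ?_, fun u hu _ => hmiss _ u hu (g b).isLeft,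
        fun v _ hv => hmiss _ v hv (g a).isLeft⟩
      · obtain ⟨x, hx, hgx, rfl⟩ := him _ _ hu
        obtain ⟨y, hy, hgy, rfl⟩ := him _ _ hv
        have h1 := hg a b hab
        rw [hgx, hgy, graphJoin_adj_inl] at h1
        have h2 : M.2.Adj x y := by simpa using h1
        have h3 : J.2.Adj (ι.symm ⟨x, hx⟩) (ι.symm ⟨y, hy⟩) := by
          rw [ι.symm.map_adj_iff]
          exact h2
        exact hQ _ _ (f.toHom.map_adj h3)
      · have h1 := hg a b hab
        dsimp only at hu hv ⊢
        generalize g a = z at *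
        generalize g b = z' at *
        rcases z with (x | x) | x <;> rcases z' with (y | y) | y
        · rw [graphJoin_adj_inl] at h1
          have h2 : M.2.Adj x y := by simpa using h1
          have h3 : x ∈ D ∨ y ∈ D := by simpa using hD h2
          rcases h3 with h3 | h3
          exacts [absurd h3 (himn x hu), absurd h3 (himn y hv)]
        · rw [graphJoin_adj_inl] at h1
          simp at h1
        · simp
        · rw [graphJoin_adj_inl] at h1
          simp at h1
        · rw [graphJoin_adj_inl] at h1
          simp at h1
        · simp
        · simp
        · simp
        · rw [graphJoin_adj_inr] at h1
          simp at h1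

end Conditions

end Ballooning

namespace Ballooning

/-! ### Edge numbers and recognition of the extremal shape -/

section EdgeCount

variable {V R : Type*}

lemma two_mul_ncard_edgeSet [Fintype V] (G : SimpleGraph V) :
    2 * G.edgeSet.ncard = ∑ v, degIn G v Finset.univ := by
  classical
  rw [← coe_edgeFinset, Set.ncard_coe_finset, ← sum_degrees_eq_twice_card_edges]
  refine Finset.sum_congr rfl fun v _ => ?_
  rw [← card_neighborFinset_eq_degree]
  unfold degIn
  congr 1
  ext w
  simp

lemma degIn_univ_eq_sum [Fintype V] (G : SimpleGraph V) [DecidableRel G.Adj] (v : V) :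
    degIn G v Finset.univ = ∑ w, if G.Adj v w then 1 else 0 := by
  classical
  unfold degIn
  rw [Finset.card_filter]
  exact Finset.sum_congr rfl fun w _ => by split_ifs <;> rfl

lemma ncard_edgeSet_graphJoin [Fintype V] [Fintype R] (Q : SimpleGraph V) (S : SimpleGraph R) :
    (graphJoin Q S).edgeSet.ncard =
      Q.edgeSet.ncard + S.edgeSet.ncard + Fintype.card V * Fintype.card R := by
  classical
  have h1 := two_mul_ncard_edgeSet (graphJoin Q S)
  have h2 := two_mul_ncard_edgeSet Q
  have h3 := two_mul_ncard_edgeSet S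
  have h4 : ∀ v, degIn (graphJoin Q S) (.inl v) Finset.univ
      = degIn Q v Finset.univ + Fintype.card R := by
    intro v
    rw [degIn_univ_eq_sum, degIn_univ_eq_sum, Fintype.sum_sum_type]
    simp [graphJoin_adj_inl, graphJoin_adj_inl_inr]
  have h5 : ∀ r, degIn (graphJoin Q S) (.inr r) Finset.univ
      = Fintype.card V + degIn S r Finset.univ := by
    intro v
    rw [degIn_univ_eq_sum, degIn_univ_eq_sum, Fintype.sum_sum_type]
    simp [graphJoin_adj_inr, adj_comm, graphJoin_adj_inl_inr]
  rw [Fintype.sum_sum_type] at h1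
  simp only [h4, h5, Finset.sum_add_distrib, Finset.sum_const, smul_eq_mul,
    Finset.card_univ] at h1
  have h6 : Fintype.card R * Fintype.card V = Fintype.card V * Fintype.card R := mul_comm _ _
  omega

lemma ncard_edgeSet_turanGraph (N : ℕ) : (turanGraph N 2).edgeSet.ncard = N ^ 2 / 4 := by
  classical
  rw [← coe_edgeFinset, Set.ncard_coe_finset]
  have h := card_edgeFinset_turanGraph (n := N) (r := 2)
  have h2 : (turanGraph N 2).edgeFinset.card
      = (N ^ 2 - (N % 2) ^ 2) * (2 - 1) / (2 * 2) + (N % 2).choose 2 := by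
    rw [← h]
  rw [h2]
  rcases Nat.mod_two_eq_zero_or_one N with h0 | h0
  · simp [h0]
  · obtain ⟨a, rfl⟩ : ∃ a, N = 2 * a + 1 := ⟨N / 2, by omega⟩
    rw [h0]
    have : (2 * a + 1) ^ 2 = 4 * (a ^ 2 + a) + 1 := by ring
    rw [this]
    generalize a ^ 2 + a = z
    simp
    omega

lemma ncard_edgeSet_completeBipartiteGraph [Fintype V] [Fintype R] :
    (completeBipartiteGraph V R).edgeSet.ncard = Fintype.card V * Fintype.card R := by
  have h := ncard_edgeSet_graphJoin (⊥ : SimpleGraph V) (⊥ : SimpleGraph R)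
  have h2 : graphJoin (⊥ : SimpleGraph V) (⊥ : SimpleGraph R) = completeBipartiteGraph V R := by
    unfold graphJoin
    rw [sup_eq_right]
    rintro (a | a) (b | b) hab <;> simp at hab
  rw [h2] at h
  simpa using h

lemma fNum_eq (n q : ℕ) : fNum n q = (q - 1) * (n - (q - 1)) + (n - (q - 1)) ^ 2 / 4 := by
  unfold fNum
  rw [ncard_edgeSet_graphJoin, ncard_edgeSet_turanGraph]
  simp [add_comm]

/-- The graph obtained from a Turán graph by placing a complete bipartite graph in a class. -/
abbrev turanPlus {m N : ℕ} (φ : (Fin m ⊕ Fin m) ↪ Fin N) : SimpleGraph (Fin N) :=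
  turanGraph N 2 ⊔ (completeBipartiteGraph (Fin m) (Fin m)).map φ

lemma ncard_edgeSet_turanPlus {m N : ℕ} (φ : (Fin m ⊕ Fin m) ↪ Fin N)
    (hφ : ∃ i : ℕ, ∀ x, (φ x).val % 2 = i) :
    (turanPlus φ).edgeSet.ncard = N ^ 2 / 4 + m ^ 2 := by
  classical
  obtain ⟨i, hi⟩ := hφ
  rw [edgeSet_sup, Set.ncard_union_eq ?_ (Set.toFinite _) (Set.toFinite _),
    ncard_edgeSet_turanGraph, edgeSet_map, Set.ncard_image_of_injective _ (Function.Embedding.injective _),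
    ncard_edgeSet_completeBipartiteGraph]
  · simp [sq]
  · rw [disjoint_edgeSet, disjoint_left]
    rintro a b hab ⟨hne, x, y, -, rfl, rfl⟩
    exact hab ((hi x).trans (hi y).symm)

/-- The number of edges of the graphs in the family, as a function of the order of the Turán
part. -/
noncomputable def topCount (p m N : ℕ) (𝓛 : GraphFamily) : ℕ :=
  p * N + N ^ 2 / 4 + exFamily p 𝓛 + m ^ 2

lemma ncard_le_exFamily {p : ℕ} {𝓛 : GraphFamily} {Q : SimpleGraph (Fin p)}
    (hQ : FamilyFree 𝓛 Q) : Q.edgeSet.ncard ≤ exFamily p 𝓛 := by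
  classical
  unfold exFamily
  exact Finset.le_sup (f := fun Q : SimpleGraph (Fin p) => Q.edgeSet.ncard) (by simpa using hQ)

/-- `FFamily` for graphs on an arbitrary vertex set, with `p + N` vertices. -/
def HasTopShape {V : Type*} (G : SimpleGraph V) (p m N : ℕ) (𝓛 : GraphFamily) : Prop :=
  ∃ Q ∈ EXFamily p 𝓛, ∃ φ : (Fin m ⊕ Fin m) ↪ Fin N,
    (∃ i : ℕ, ∀ x, (φ x).val % 2 = i) ∧ Nonempty (G ≃g graphJoin Q (turanPlus φ))

lemma ncard_edgeSet_of_iso {G : SimpleGraph V} {G' : SimpleGraph R} (e : G ≃g G') :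
    G.edgeSet.ncard = G'.edgeSet.ncard :=
  Nat.card_congr e.mapEdgeSet

lemma HasTopShape.ncard_edgeSet {G : SimpleGraph V} {p m N : ℕ} {𝓛 : GraphFamily}
    (h : HasTopShape G p m N 𝓛) : G.edgeSet.ncard = topCount p m N 𝓛 := by
  obtain ⟨Q, hQ, φ, hφ, ⟨e⟩⟩ := h
  rw [ncard_edgeSet_of_iso e, ncard_edgeSet_graphJoin, hQ.2, ncard_edgeSet_turanPlus φ hφ]
  simp only [Fintype.card_fin, topCount]
  ring

lemma card_filter_mod_two (N i : ℕ) (hi : i < 2) :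
    Fintype.card {j : Fin N // j.val % 2 = i} = (N + 1 - i) / 2 := by
  have h : ∀ N, ((Finset.range N).filter fun j => j % 2 = i).card = (N + 1 - i) / 2 := by
    intro N
    induction N with
    | zero => simp; omega
    | succ N ih =>
      rw [Finset.range_add_one, Finset.filter_insert]
      split_ifs with h
      · rw [Finset.card_insert_of_notMem (by simp), ih]
        omega
      · rw [ih]
        omega
  rw [Fintype.card_subtype, ← h N, ← Finset.card_map Fin.valEmbedding]
  congr 1
  ext j
  simp only [Finset.mem_map, Finset.mem_filter, Finset.mem_univ, true_and, Fin.valEmbedding_apply,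
    Finset.mem_range]
  constructor
  · rintro ⟨j, hj, rfl⟩
    exact ⟨j.2, hj⟩
  · rintro ⟨hj, h⟩
    exact ⟨⟨j, hj⟩, h, rfl⟩

lemma card_filter_mod_two_ne (N i : ℕ) (hi : i < 2) :
    Fintype.card {j : Fin N // ¬ j.val % 2 = i} = (N + i) / 2 := by
  rw [Fintype.card_subtype_compl, card_filter_mod_two N i hi, Fintype.card_fin]
  omega

/-- A product at its maximum forces `a` and `b` to differ by at most one; `i` is the residue modulo
two that occurs `a` times in `Fin (a + b)`. -/
lemma exists_parity {a b : ℕ} (h : a * b = (a + b) ^ 2 / 4) :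
    ∃ i < 2, a = (a + b + 1 - i) / 2 ∧ b = (a + b + i) / 2 := by
  have h1 : (a + b) ^ 2 < 4 * (a * b) + 4 := by omega
  have h2 : a ≤ b + 1 := by
    by_contra hcon
    obtain ⟨d, rfl⟩ : ∃ d, a = b + 2 + d := ⟨a - b - 2, by omega⟩
    nlinarith
  have h3 : b ≤ a + 1 := by
    by_contra hcon
    obtain ⟨d, rfl⟩ : ∃ d, b = a + 2 + d := ⟨b - a - 2, by omega⟩
    nlinarith
  rcases le_total b a with h4 | h4
  · exact ⟨0, by norm_num, by omega, by omega⟩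
  · exact ⟨1, by norm_num, by omega, by omega⟩

/-- A complete join of three parts, one of which contains a balanced complete bipartite graph. -/
lemma hasTopShape_of_partition [Fintype V] {G : SimpleGraph V} {p m : ℕ} {𝓛 : GraphFamily}
    {A B Ω : Finset V} (hAB : Disjoint A B) (hAΩ : Disjoint A Ω) (hBΩ : Disjoint B Ω)
    (hcov : ∀ x, x ∈ A ∨ x ∈ B ∨ x ∈ Ω)
    (hbal : A.card * B.card = (A.card + B.card) ^ 2 / 4)
    (hAB' : ∀ x ∈ A, ∀ y ∈ B, G.Adj x y) (hΩA : ∀ w ∈ Ω, ∀ x ∈ A, G.Adj w x)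
    (hΩB : ∀ w ∈ Ω, ∀ x ∈ B, G.Adj w x) (hB : ∀ x ∈ B, ∀ y ∈ B, ¬ G.Adj x y)
    (hA : IsBalancedBiclique G m A) (θ : Fin p ≃ Ω)
    (hQ : G.comap (fun i => (θ i).1) ∈ EXFamily p 𝓛) :
    HasTopShape G p m (A.card + B.card) 𝓛 := by
  classical
  obtain ⟨S, T, hS, hT, hST, hSc, hTc, hadj⟩ := hA
  obtain ⟨i, hi, hAi, hBi⟩ := exists_parity hbal
  set N := A.card + B.card with hN
  let eA : {j : Fin N // j.val % 2 = i} ≃ A := Fintype.equivOfCardEq (by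
    rw [card_filter_mod_two N i hi, Fintype.card_coe]; exact hAi.symm)
  let eB : {j : Fin N // ¬ j.val % 2 = i} ≃ B := Fintype.equivOfCardEq (by
    rw [card_filter_mod_two_ne N i hi, Fintype.card_coe]; exact hBi.symm)
  let sS : Fin m ≃ S := Fintype.equivOfCardEq (by rw [Fintype.card_coe, Fintype.card_fin, hSc])
  let sT : Fin m ≃ T := Fintype.equivOfCardEq (by rw [Fintype.card_coe, Fintype.card_fin, hTc])
  let f₂ : Fin N → V := fun j => if h : j.val % 2 = i then eA ⟨j, h⟩ else eB ⟨j, h⟩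
  have hf₂A : ∀ j (h : j.val % 2 = i), f₂ j = eA ⟨j, h⟩ := fun j h => dif_pos h
  have hf₂B : ∀ j (h : ¬ j.val % 2 = i), f₂ j = eB ⟨j, h⟩ := fun j h => dif_neg h
  have hmA : ∀ j, j.val % 2 = i → f₂ j ∈ A := fun j h => by rw [hf₂A j h]; exact (eA _).2
  have hmB : ∀ j, ¬ j.val % 2 = i → f₂ j ∈ B := fun j h => by rw [hf₂B j h]; exact (eB _).2
  have hf₂inj : Function.Injective f₂ := by
    intro j j' h
    by_cases h1 : j.val % 2 = i <;> by_cases h2 : j'.val % 2 = i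
    · rw [hf₂A j h1, hf₂A j' h2] at h
      simpa using eA.injective (Subtype.ext h)
    · exact absurd (h ▸ hmA j h1) (Finset.disjoint_right.1 hAB (hmB j' h2))
    · exact absurd (h ▸ hmB j h1) (Finset.disjoint_left.1 hAB (hmA j' h2))
    · rw [hf₂B j h1, hf₂B j' h2] at h
      simpa using eB.injective (Subtype.ext h)
  have hf₂Ω : ∀ j, f₂ j ∉ Ω := fun j hj => by
    by_cases h1 : j.val % 2 = i
    · exact Finset.disjoint_left.1 hAΩ (hmA j h1) hj
    · exact Finset.disjoint_left.1 hBΩ (hmB j h1) hj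
  let f : Fin p ⊕ Fin N → V := Sum.elim (fun k => θ k) f₂
  have hfinj : Function.Injective f := by
    refine Function.Injective.sumElim (fun a b h => θ.injective (Subtype.ext h)) hf₂inj ?_
    intro a b h
    exact hf₂Ω b (h ▸ (θ a).2)
  have hfsurj : Function.Surjective f := by
    intro v
    rcases hcov v with hv | hv | hv
    · refine ⟨.inr (eA.symm ⟨v, hv⟩).1, ?_⟩
      show f₂ _ = v
      rw [hf₂A _ (eA.symm ⟨v, hv⟩).2]
      simp
    · refine ⟨.inr (eB.symm ⟨v, hv⟩).1, ?_⟩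
      show f₂ _ = v
      rw [hf₂B _ (eB.symm ⟨v, hv⟩).2]
      simp
    · exact ⟨.inl (θ.symm ⟨v, hv⟩), by simp [f]⟩
  let φf : Fin m ⊕ Fin m → Fin N := Sum.elim (fun a => (eA.symm ⟨sS a, hS (sS a).2⟩).1)
    fun a => (eA.symm ⟨sT a, hT (sT a).2⟩).1
  have hφS : ∀ a, f₂ (φf (.inl a)) = sS a := fun a => by
    show f₂ (eA.symm ⟨sS a, hS (sS a).2⟩).1 = sS a
    rw [hf₂A _ (eA.symm ⟨sS a, hS (sS a).2⟩).2]
    simp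
  have hφT : ∀ a, f₂ (φf (.inr a)) = sT a := fun a => by
    show f₂ (eA.symm ⟨sT a, hT (sT a).2⟩).1 = sT a
    rw [hf₂A _ (eA.symm ⟨sT a, hT (sT a).2⟩).2]
    simp
  have hφmod : ∀ x, (φf x).val % 2 = i := by
    rintro (a | a)
    exacts [(eA.symm ⟨sS a, hS (sS a).2⟩).2, (eA.symm ⟨sT a, hT (sT a).2⟩).2]
  have hφinj : Function.Injective φf := by
    have hST' : ∀ a b, (sS a).1 ≠ (sT b).1 := fun a b h =>
      Finset.disjoint_left.1 hST (sS a).2 (h ▸ (sT b).2)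
    rintro (a | a) (b | b) h <;> have h' := congrArg f₂ h
    · rw [hφS, hφS] at h'
      rw [sS.injective (Subtype.ext h')]
    · rw [hφS, hφT] at h'
      exact absurd h' (hST' a b)
    · rw [hφS, hφT] at h'
      exact absurd h'.symm (hST' b a)
    · rw [hφT, hφT] at h'
      rw [sT.injective (Subtype.ext h')]
  let φ : (Fin m ⊕ Fin m) ↪ Fin N := ⟨φf, hφinj⟩
  have hmap : ∀ j j', ((completeBipartiteGraph (Fin m) (Fin m)).map φ).Adj j j' ↔
      (f₂ j ∈ S ∧ f₂ j' ∈ T) ∨ (f₂ j ∈ T ∧ f₂ j' ∈ S) := by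
    intro j j'
    constructor
    · rw [map_adj]
      rintro ⟨x, y, hxy, rfl, rfl⟩
      rcases x with a | a <;> rcases y with b | b <;> simp at hxy
      · exact .inl ⟨(hφS a).symm ▸ (sS a).2, (hφT b).symm ▸ (sT b).2⟩
      · exact .inr ⟨(hφT a).symm ▸ (sT a).2, (hφS b).symm ▸ (sS b).2⟩
    · have hs : ∀ j, f₂ j ∈ S → ∃ a, φf (.inl a) = j := fun j hj =>
        ⟨sS.symm ⟨_, hj⟩, hf₂inj (by rw [hφS]; simp)⟩
      have ht : ∀ j, f₂ j ∈ T → ∃ a, φf (.inr a) = j := fun j hj =>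
        ⟨sT.symm ⟨_, hj⟩, hf₂inj (by rw [hφT]; simp)⟩
      rw [map_adj]
      rintro (⟨h1, h2⟩ | ⟨h1, h2⟩)
      · obtain ⟨a, ha⟩ := hs j h1
        obtain ⟨b, hb⟩ := ht j' h2
        exact ⟨.inl a, .inr b, by simp, ha, hb⟩
      · obtain ⟨a, ha⟩ := ht j h1
        obtain ⟨b, hb⟩ := hs j' h2
        exact ⟨.inr a, .inl b, by simp, ha, hb⟩
  refine ⟨_, hQ, φ, ⟨i, hφmod⟩, ⟨RelIso.symm ⟨Equiv.ofBijective f ⟨hfinj, hfsurj⟩, ?_⟩⟩⟩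
  intro x y
  show G.Adj (f x) (f y) ↔ _
  have hcross : ∀ k j, G.Adj (θ k).1 (f₂ j) := fun k j => by
    by_cases h1 : j.val % 2 = i
    · exact hΩA _ (θ k).2 _ (hmA j h1)
    · exact hΩB _ (θ k).2 _ (hmB j h1)
  rcases x with x | x <;> rcases y with y | y
  · rw [graphJoin_adj_inl]
    exact Iff.rfl
  · exact iff_of_true (hcross x y) (graphJoin_adj_inl_inr x y)
  · exact iff_of_true (hcross y x).symm (graphJoin_adj_inl_inr y x).symm
  · rw [graphJoin_adj_inr]
    show G.Adj (f₂ x) (f₂ y) ↔ _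
    rw [sup_adj, turanGraph_adj, hmap]
    have hBS : ∀ j, ¬ j.val % 2 = i → f₂ j ∉ S ∧ f₂ j ∉ T := fun j hj =>
      ⟨fun h => Finset.disjoint_right.1 hAB (hmB j hj) (hS h),
        fun h => Finset.disjoint_right.1 hAB (hmB j hj) (hT h)⟩
    by_cases h1 : x.val % 2 = i <;> by_cases h2 : y.val % 2 = i
    · rw [hadj _ (hmA x h1) _ (hmA y h2)]
      have : ¬ (x.val % 2 ≠ y.val % 2) := by omega
      tauto
    · exact iff_of_true (hAB' _ (hmA x h1) _ (hmB y h2)) (.inl (by omega))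
    · exact iff_of_true (hAB' _ (hmA y h2) _ (hmB x h1)).symm (.inl (by omega))
    · have := hBS x h1
      have := hBS y h2
      have : ¬ (x.val % 2 ≠ y.val % 2) := by omega
      have := hB _ (hmB x h1) _ (hmB y h2)
      tauto

end EdgeCount

end Ballooning

namespace Ballooning

/-! ### The bound under the degree condition -/

section Extremal

variable {W V : Type*} {H : SimpleGraph W} {ℓ : H.edgeSet → ℕ}

section Count

variable [Fintype V] {G : SimpleGraph V} {p C : ℕ} {A B Ω : Finset V}

lemma NearStructure.card_eq (h : NearStructure G p C A B Ω) :
    A.card + B.card + p = Fintype.card V := by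
  classical
  rw [← h.card, ← Finset.card_union_of_disjoint h.disjAB, ← Finset.card_union_of_disjoint
    (Finset.disjoint_union_left.2 ⟨h.disjAΩ, h.disjBΩ⟩), ← Finset.card_univ]
  congr 1
  ext x
  have := h.cover x
  simp only [Finset.mem_union, Finset.mem_univ, iff_true]
  tauto

/-- The number of edges, in terms of the edges inside the three parts and the missing edges
between them. -/
lemma NearStructure.count (h : NearStructure G p C A B Ω) :
    2 * G.edgeSet.ncard + 2 * ∑ x ∈ A, missIn G x B +
        2 * (∑ w ∈ Ω, missIn G w A + ∑ w ∈ Ω, missIn G w B) =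
      ∑ x ∈ A, degIn G x A + ∑ x ∈ B, degIn G x B + ∑ w ∈ Ω, degIn G w Ω +
        2 * (A.card * B.card) + 2 * (p * (A.card + B.card)) := by
  classical
  have hU : (Finset.univ : Finset V) = A ∪ B ∪ Ω := by
    ext x
    have := h.cover x
    simp only [Finset.mem_union, Finset.mem_univ, true_iff]
    tauto
  have hd := Finset.disjoint_union_left.2 ⟨h.disjAΩ, h.disjBΩ⟩
  have hdeg : ∀ v, degIn G v Finset.univ = degIn G v A + degIn G v B + degIn G v Ω := fun v => by
    rw [hU, degIn_union v hd, degIn_union v h.disjAB]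
  have hAB : ∑ x ∈ A, degIn G x B + ∑ x ∈ A, missIn G x B = A.card * B.card := by
    rw [← Finset.sum_add_distrib, ← smul_eq_mul, ← Finset.sum_const]
    exact Finset.sum_congr rfl fun x _ => degIn_add_missIn x B
  have hΩ : ∀ S : Finset V, ∑ x ∈ Ω, degIn G x S + ∑ x ∈ Ω, missIn G x S = p * S.card := by
    intro S
    rw [← Finset.sum_add_distrib, ← h.card, ← smul_eq_mul, ← Finset.sum_const]
    exact Finset.sum_congr rfl fun x _ => degIn_add_missIn x S
  have h1 := hΩ A
  have h2 := hΩ B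
  have h3 := sum_degIn_comm (G := G) B A
  have h4 := sum_degIn_comm (G := G) A Ω
  have h5 := sum_degIn_comm (G := G) B Ω
  rw [two_mul_ncard_edgeSet, hU, Finset.sum_union hd, Finset.sum_union h.disjAB]
  rw [← hU]
  simp only [hdeg, Finset.sum_add_distrib]
  rw [mul_add p]
  omega

/-- In the formula `count`, `core` bounds the edges inside the classes minus the missing ones,
`familyFree` those inside `Ω`, and the inequality of means `A.card * B.card`. A graph with
`topCount` edges attains all these bounds, and the equality cases determine it. -/
theorem NearStructure.ncard_le [Finite W] (h : NearStructure G p C A B Ω)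
    (hH : H.IsBipartite) (hne : H ≠ ⊥) (hℓ : ∀ e, Odd (ℓ e) ∧ 5 ≤ ℓ e)
    (hfree : (oddBallooning H ℓ).Free G) (hp : qTilde (oddBallooning H ℓ) = p + 1)
    (hA : (C + 1) * Nat.card (BVert H ℓ) ≤ A.card)
    (hB : (C + 1) * Nat.card (BVert H ℓ) ≤ B.card)
    (hle : topCount p (kParam (oddBallooning H ℓ) - 1) (A.card + B.card)
      (BTilde (oddBallooning H ℓ)) ≤ G.edgeSet.ncard) :
    HasTopShape G p (kParam (oddBallooning H ℓ) - 1) (A.card + B.card)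
      (BTilde (oddBallooning H ℓ)) := by
  classical
  set m := kParam (oddBallooning H ℓ) - 1 with hm
  have hθc : Fintype.card (Fin p) = Fintype.card Ω := by
    rw [Fintype.card_fin, Fintype.card_coe, h.card]
  let θ : Fin p ≃ Ω := Fintype.equivOfCardEq hθc
  let Q : SimpleGraph (Fin p) := G.comap fun i => (θ i).1
  have hQfree : FamilyFree (BTilde (oddBallooning H ℓ)) Q :=
    h.familyFree hfree hp hA hB (θ := fun i => (θ i).1)
      (fun a b hab => θ.injective (Subtype.ext hab)) (fun i => (θ i).2) fun _ _ hij => hij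
  have hQle := ncard_le_exFamily hQfree
  have hΩQ : ∑ w ∈ Ω, degIn G w Ω = 2 * Q.edgeSet.ncard := by
    rw [two_mul_ncard_edgeSet, ← Finset.sum_coe_sort Ω, ← Equiv.sum_comp θ]
    refine Finset.sum_congr rfl fun i _ => ?_
    unfold degIn
    symm
    refine Finset.card_bij (fun j _ => (θ j).1) ?_ ?_ ?_
    · intro j hj
      exact Finset.mem_filter.2 ⟨(θ j).2, (Finset.mem_filter.1 hj).2⟩
    · intro j _ j' _ hjj
      exact θ.injective (Subtype.ext hjj)
    · intro w hw
      rw [Finset.mem_filter] at hw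
      refine ⟨θ.symm ⟨w, hw.1⟩, Finset.mem_filter.2 ⟨Finset.mem_univ _, ?_⟩, by simp⟩
      show G.Adj _ (θ (θ.symm ⟨w, hw.1⟩)).1
      simpa using hw.2
  have hstarA := h.starCond hH hne hℓ hfree hp hA hB
  have hstarB := h.symm.starCond hH hne hℓ hfree hp hB hA
  have hmatch := h.matchCond hH hne hℓ hfree hp hA hB
  obtain ⟨hc1, hc2⟩ := core hstarA hstarB hmatch
  rw [← hm] at hc1 hc2
  have hcount := h.count
  have h4 : 4 * (A.card * B.card) ≤ (A.card + B.card) ^ 2 := by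
    have := four_mul_le_sq_add A.card B.card
    rwa [mul_assoc] at this
  unfold topCount at hle
  obtain ⟨hmiss, hor⟩ := hc2 (by omega)
  have hbal : A.card * B.card = (A.card + B.card) ^ 2 / 4 := by omega
  have hQEX : Q ∈ EXFamily p (BTilde (oddBallooning H ℓ)) := ⟨hQfree, by omega⟩
  have hΩA0 : ∑ w ∈ Ω, missIn G w A = 0 := by omega
  have hΩB0 : ∑ w ∈ Ω, missIn G w B = 0 := by omega
  have hadj : ∀ S T : Finset V, ∑ x ∈ S, missIn G x T = 0 → ∀ x ∈ S, ∀ y ∈ T, G.Adj x y :=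
    fun S T hS x hx => missIn_eq_zero.1 (Finset.sum_eq_zero_iff.1 hS x hx)
  have hABadj := hadj _ _ hmiss
  rcases hor with ⟨hBe, hbi⟩ | ⟨hAe, hbi⟩
  · exact hasTopShape_of_partition h.disjAB h.disjAΩ h.disjBΩ h.cover hbal hABadj
      (hadj _ _ hΩA0) (hadj _ _ hΩB0) hBe hbi θ hQEX
  · have := hasTopShape_of_partition h.disjAB.symm h.disjBΩ h.disjAΩ h.symm.cover
      (by rw [mul_comm, hbal, add_comm]) (fun x hx y hy => (hABadj y hy x hx).symm)
      (hadj _ _ hΩB0) (hadj _ _ hΩA0) hAe hbi θ hQEX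
    rwa [add_comm] at this

end Count

theorem exists_hasTopShape_of_degree [Finite W] (hH : H.IsBipartite) (hne : H ≠ ⊥)
    (hℓ : ∀ e, Odd (ℓ e) ∧ 5 ≤ ℓ e) {p : ℕ} (hp : qTilde (oddBallooning H ℓ) = p + 1) :
    ∃ n₁ : ℕ, ∀ {V : Type*} [Fintype V] (G : SimpleGraph V), n₁ ≤ Fintype.card V →
      (oddBallooning H ℓ).Free G →
      (∀ v : V, Fintype.card V ≤ 2 * degIn G v Finset.univ + 1) →
      topCount p (kParam (oddBallooning H ℓ) - 1) (Fintype.card V - p)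
        (BTilde (oddBallooning H ℓ)) ≤ G.edgeSet.ncard →
      HasTopShape G p (kParam (oddBallooning H ℓ) - 1) (Fintype.card V - p)
        (BTilde (oddBallooning H ℓ)) := by
  -- The term `3 * p ^ 2` comes from expanding in `N = n - p`, and `3` from rounding in `N ^ 2 / 4`.
  obtain ⟨C, n₁, hn₁⟩ := exists_nearStructure hH hne hℓ (3 * p ^ 2 + 3)
  obtain ⟨K, hK⟩ : ∃ K, K = (C + 1) * Nat.card (BVert H ℓ) := ⟨_, rfl⟩
  refine ⟨n₁ + p + 2 * K + C, fun {V} _ G hn hfree hdeg hle => ?_⟩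
  obtain ⟨N, hN⟩ : ∃ N, Fintype.card V = N + p := ⟨Fintype.card V - p, by omega⟩
  obtain ⟨A, B, Ω, h⟩ := hn₁ G (by omega) hfree hdeg (by
    rw [← two_mul_ncard_edgeSet, hp, hN]
    rw [hN, Nat.add_sub_cancel] at hle
    unfold topCount at hle
    have e1 : (N + p) ^ 2 + 2 * (p + 1 - 1) * (N + p) = N ^ 2 + 4 * (p * N) + 3 * p ^ 2 := by
      rw [Nat.add_sub_cancel]; ring
    rw [e1]
    omega)
  rw [hp, Nat.add_sub_cancel] at h
  have hcard := h.card_eq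
  have hlA := h.largeA
  have hlB := h.largeB
  have hNAB : Fintype.card V - p = A.card + B.card := by omega
  rw [hNAB] at hle ⊢
  exact h.ncard_le hH hne hℓ hfree hp (by omega) (by omega) hle

end Extremal

end Ballooning

namespace Ballooning

/-! ### Deleting vertices of low degree -/

section Deletion

variable {W V : Type*} {H : SimpleGraph W} {ℓ : H.edgeSet → ℕ}

lemma ncard_edgeSet_induce_compl [Fintype V] (G : SimpleGraph V) (v : V) :
    G.edgeSet.ncard = (G.induce ({v}ᶜ : Set V)).edgeSet.ncard + degIn G v Finset.univ := by
  classical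
  have h1 := card_edgeFinset_induce_compl_singleton G v
  have h2 := card_edgeFinset_deleteIncidenceSet G v
  have h3 := G.degree_le_card_edgeFinset v
  have h4 : degIn G v Finset.univ = G.degree v := by
    rw [← card_neighborFinset_eq_degree]
    unfold degIn
    congr 1
    ext w
    simp
  rw [← coe_edgeFinset, ← coe_edgeFinset, Set.ncard_coe_finset, Set.ncard_coe_finset, h4]
  omega

lemma topCount_succ (p m N : ℕ) (𝓛 : GraphFamily) :
    topCount p m (N + 1) 𝓛 = topCount p m N 𝓛 + p + (N + 1) / 2 := by
  have h : (N + 1) ^ 2 / 4 = N ^ 2 / 4 + (N + 1) / 2 := by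
    rcases Nat.even_or_odd' N with ⟨a, rfl | rfl⟩
    · have e1 : (2 * a + 1) ^ 2 = 4 * (a ^ 2 + a) + 1 := by ring
      have e2 : (2 * a) ^ 2 = 4 * a ^ 2 := by ring
      rw [e1, e2]
      omega
    · have e1 : (2 * a + 1) ^ 2 = 4 * (a ^ 2 + a) + 1 := by ring
      have e2 : (2 * a + 1 + 1) ^ 2 = 4 * (a ^ 2 + 2 * a + 1) := by ring
      rw [e1, e2]
      omega
  unfold topCount
  rw [h]
  ring

lemma ncard_edgeSet_le_sq [Fintype V] (G : SimpleGraph V) :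
    G.edgeSet.ncard ≤ Fintype.card V ^ 2 := by
  have h1 := two_mul_ncard_edgeSet G
  have h2 : ∑ v, degIn G v Finset.univ ≤ Fintype.card V * Fintype.card V := by
    have := Finset.sum_le_card_nsmul (Finset.univ : Finset V) (fun v => degIn G v Finset.univ)
      (Fintype.card V) fun v _ => degIn_le_card v Finset.univ
    rwa [Finset.card_univ, smul_eq_mul] at this
  rw [sq]
  omega

/-- The excess over `topCount` is at most `n₁ ^ 2` at the start and drops with every further vertex
until it vanishes. If the degree condition holds, there is no excess. Otherwise some vertex has
smaller degree than the increment in `topCount_succ`, and deleting it loses at least one edge less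
than the bound does. -/
theorem ncard_le_add [Finite W] {p n₁ : ℕ} (hpn : p ≤ n₁)
    (hn₁ : ∀ {V : Type} [Fintype V] (G : SimpleGraph V), n₁ ≤ Fintype.card V →
      (oddBallooning H ℓ).Free G →
      (∀ v : V, Fintype.card V ≤ 2 * degIn G v Finset.univ + 1) →
      topCount p (kParam (oddBallooning H ℓ) - 1) (Fintype.card V - p)
        (BTilde (oddBallooning H ℓ)) ≤ G.edgeSet.ncard →
      HasTopShape G p (kParam (oddBallooning H ℓ) - 1) (Fintype.card V - p)
        (BTilde (oddBallooning H ℓ))) (d : ℕ) :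
    ∀ {V : Type} [Fintype V] (G : SimpleGraph V), Fintype.card V = n₁ + d →
      (oddBallooning H ℓ).Free G →
      G.edgeSet.ncard ≤ topCount p (kParam (oddBallooning H ℓ) - 1) (n₁ + d - p)
        (BTilde (oddBallooning H ℓ)) + (n₁ ^ 2 - d) := by
  induction d with
  | zero =>
    intro V _ G hV _
    have := ncard_edgeSet_le_sq G
    rw [hV] at this
    exact this.trans (Nat.le_add_left _ _)
  | succ d ih =>
    intro V _ G hV hfree
    by_cases hdeg : ∀ v : V, Fintype.card V ≤ 2 * degIn G v Finset.univ + 1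
    · by_contra hcon
      have h := hn₁ G (by omega) hfree hdeg (by rw [hV]; omega)
      have := h.ncard_edgeSet
      rw [hV] at this
      omega
    · push Not at hdeg
      obtain ⟨v, hv⟩ := hdeg
      classical
      have hV' : Fintype.card ({v}ᶜ : Set V) = n₁ + d := by
        rw [Fintype.card_compl_set, hV]
        simp
      have h1 := ih (G.induce ({v}ᶜ : Set V)) hV'
        (fun h => hfree (h.trans ⟨(Embedding.induce _).toCopy⟩))
      have h2 := ncard_edgeSet_induce_compl G v
      have h3 : n₁ + (d + 1) - p = (n₁ + d - p) + 1 := by omega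
      rw [h3, topCount_succ]
      omega

/-- The upper bound and the structure of the graphs attaining it. -/
theorem exists_upper_bound [Finite W] (hH : H.IsBipartite) (hne : H ≠ ⊥)
    (hℓ : ∀ e, Odd (ℓ e) ∧ 5 ≤ ℓ e) {p : ℕ} (hp : qTilde (oddBallooning H ℓ) = p + 1) :
    ∃ n₀ : ℕ, ∀ {V : Type} [Fintype V] (G : SimpleGraph V), n₀ ≤ Fintype.card V →
      (oddBallooning H ℓ).Free G →
      G.edgeSet.ncard ≤ topCount p (kParam (oddBallooning H ℓ) - 1) (Fintype.card V - p)
        (BTilde (oddBallooning H ℓ)) ∧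
      (topCount p (kParam (oddBallooning H ℓ) - 1) (Fintype.card V - p)
        (BTilde (oddBallooning H ℓ)) ≤ G.edgeSet.ncard →
        HasTopShape G p (kParam (oddBallooning H ℓ) - 1) (Fintype.card V - p)
          (BTilde (oddBallooning H ℓ))) := by
  obtain ⟨n₂, hn₂⟩ := exists_hasTopShape_of_degree hH hne hℓ hp
  obtain ⟨n₁, hn₁⟩ : ∃ n₁, n₁ = n₂ + p := ⟨_, rfl⟩
  -- After `n₁ ^ 2` vertices the excess is zero. The additional `1` gives the same bound for `G`
  -- minus a vertex, which excludes a vertex of low degree in a graph attaining the bound.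
  refine ⟨n₁ + n₁ ^ 2 + 1, fun {V} _ G hn hfree => ⟨?_, fun hle => ?_⟩⟩
  · have := ncard_le_add (n₁ := n₁) (by omega) (fun {V} _ G hG => hn₂ G (by omega))
      (Fintype.card V - n₁) G (by omega) hfree
    rw [show n₁ + (Fintype.card V - n₁) = Fintype.card V by omega] at this
    omega
  · refine hn₂ G (by omega) hfree ?_ hle
    by_contra hdeg
    push Not at hdeg
    obtain ⟨v, hv⟩ := hdeg
    classical
    obtain ⟨d, hd⟩ : ∃ d, Fintype.card V = n₁ + d + 1 := ⟨Fintype.card V - n₁ - 1, by omega⟩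
    have hV' : Fintype.card ({v}ᶜ : Set V) = n₁ + d := by
      rw [Fintype.card_compl_set, hd]
      simp
    have h1 := ncard_le_add (n₁ := n₁) (by omega) (fun {V} _ G hG => hn₂ G (by omega)) d
      (G.induce ({v}ᶜ : Set V)) hV'
      (fun h => hfree (h.trans ⟨(Embedding.induce _).toCopy⟩))
    have h2 := ncard_edgeSet_induce_compl G v
    have h3 : Fintype.card V - p = (n₁ + d - p) + 1 := by omega
    rw [h3, topCount_succ] at hle
    omega

end Deletion

/-! ### The lower bound -/

section LowerBound

variable {T : Type*} {L : SimpleGraph T}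

/-- The edgeless graph contains no member of the subgraph covering family. -/
lemma familyFree_bot (hq : 1 ≤ qTilde L) :
    FamilyFree (BTilde L) (⊥ : SimpleGraph (Fin (qTilde L - 1))) := by
  classical
  rintro J hJ ⟨f⟩
  have hJbot : ∀ a b, ¬ J.2.Adj a b := fun a b hab => by simpa using f.toHom.map_adj hab
  have hcardJ : J.1 ≤ qTilde L - 1 := by simpa using Fintype.card_le_of_injective _ f.injective
  unfold BTilde subgraphCoveringFamily at hJ
  split_ifs at hJ with hcase
  · obtain rfl := Set.mem_singleton_iff.1 hJ
    change qTilde L ≤ qTilde L - 1 at hcardJ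
    omega
  · obtain ⟨M, hM, D, hD, hDc, ⟨ι⟩⟩ := hJ
    -- If the graph induced on `D` has no edges, `D` is an independent covering, so `M` is bipartite
    -- with `γ(M)` less than `q`, against the choice of `q`.
    have hind : ∀ x ∈ D, ∀ y ∈ D, ¬ M.2.Adj x y := by
      intro x hx y hy hxy
      refine hJbot (ι.symm ⟨x, hx⟩) (ι.symm ⟨y, hy⟩) ?_
      rw [ι.symm.map_adj_iff]
      exact hxy
    have hcov : ∀ x y, M.2.Adj x y → x ∈ D ∨ y ∈ D := fun x y hxy => by simpa using hD hxy
    have hbip : M.2.IsBipartite := by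
      refine ⟨Coloring.mk (fun x => if x ∈ D then (0 : Fin 2) else 1) fun {x y} hxy => ?_⟩
      have h1 := hind x
      have h2 := hcov x y hxy
      by_cases hx : x ∈ D <;> by_cases hy : y ∈ D
      · exact absurd hxy (h1 hx y hy)
      · simp [hx, hy]
      · simp [hx, hy]
      · tauto
    have h1 : indepCoveringNum M.2 ≤ D.card := Nat.sInf_le ⟨D, ⟨fun x hx y hy _ => hind x hx y hy,
      hD⟩, rfl⟩
    have h2 : indepCoveringNumber (twoDecompositionFamily L) ≤ indepCoveringNum M.2 :=
      Nat.sInf_le ⟨M, hM, hbip, rfl⟩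
    omega

lemma exists_mem_EXFamily {p : ℕ} {𝓛 : GraphFamily} {Q₀ : SimpleGraph (Fin p)}
    (h : FamilyFree 𝓛 Q₀) : ∃ Q, Q ∈ EXFamily p 𝓛 := by
  classical
  obtain ⟨Q, hQ, hsup⟩ := Finset.exists_mem_eq_sup
    (Finset.univ.filter fun G : SimpleGraph (Fin p) => FamilyFree 𝓛 G) ⟨Q₀, by simpa using h⟩
    fun G => G.edgeSet.ncard
  refine ⟨Q, by simpa using hQ, ?_⟩
  rw [← hsup]
  unfold exFamily
  congr

lemma le_extremalNumber [Fintype T] {V : Type*} [Fintype V] {G : SimpleGraph V}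
    (h : L.Free G) : G.edgeSet.ncard ≤ extremalNumber (Fintype.card V) L := by
  classical
  rw [← coe_edgeFinset, Set.ncard_coe_finset]
  exact card_edgeFinset_le_extremalNumber h

lemma turanGraph_ne {N : ℕ} {a b : Fin N} (h : (turanGraph N 2).Adj a b) :
    decide (a.val % 2 = 0) ≠ decide (b.val % 2 = 0) := by
  rw [turanGraph_adj] at h
  intro h'
  rw [decide_eq_decide] at h'
  omega

theorem lower_bound [Finite T] (hq : 1 ≤ qTilde L) {n : ℕ} (hn : qTilde L - 1 ≤ n) :
    fNum n (qTilde L) + exFamily (qTilde L - 1) (BTilde L) ≤ extremalNumber n L := by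
  classical
  have := Fintype.ofFinite T
  obtain ⟨Q, hQ⟩ := exists_mem_EXFamily (familyFree_bot hq)
  have hfree := free_graphJoin hq hQ.1 (R' := turanGraph (n - (qTilde L - 1)) 2)
    (c := fun a => decide (a.val % 2 = 0)) fun _ _ h => turanGraph_ne h
  have h1 := le_extremalNumber hfree
  rw [ncard_edgeSet_graphJoin, ncard_edgeSet_turanGraph, hQ.2, Fintype.card_sum, Fintype.card_fin,
    Fintype.card_fin, Nat.add_sub_cancel' hn] at h1
  rw [fNum_eq]
  omega

end LowerBound

/-! ### Freeness does not depend on the position of the biclique -/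

section Transfer

variable {T : Type*} {L : SimpleGraph T}

lemma free_of_iso {V V' : Type*} {G : SimpleGraph V} {G' : SimpleGraph V'} (e : G ≃g G')
    (h : L.Free G) : L.Free G' := fun h' => h (h'.trans ⟨e.symm.toCopy⟩)

lemma exists_parity_class {m N : ℕ} {φ : (Fin m ⊕ Fin m) ↪ Fin N}
    (hφ : ∃ i : ℕ, ∀ x, (φ x).val % 2 = i) : ∃ i < 2, ∀ x, (φ x).val % 2 = i := by
  obtain ⟨i, hi⟩ := hφ
  rcases isEmpty_or_nonempty (Fin m ⊕ Fin m) with h | ⟨⟨x⟩⟩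
  · exact ⟨0, by norm_num, fun x => h.elim x⟩
  · exact ⟨i, hi x ▸ Nat.mod_lt _ (by norm_num), hi⟩

/-- Containment in a graph of the extremal family depends only on the graph outside the Turán
part. -/
theorem isContained_transfer [Finite T] {p m N : ℕ} {Q Q' : SimpleGraph (Fin p)} (σ : Q' ≃g Q)
    {φ φ' : (Fin m ⊕ Fin m) ↪ Fin N} (hφ : ∃ i : ℕ, ∀ x, (φ x).val % 2 = i)
    (hφ' : ∃ i : ℕ, ∀ x, (φ' x).val % 2 = i) (hN : 2 * (Nat.card T + 2 * m) ≤ N)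
    (h : L ⊑ graphJoin Q' (turanPlus φ')) : L ⊑ graphJoin Q (turanPlus φ) := by
  classical
  have := Fintype.ofFinite T
  obtain ⟨f⟩ := h
  have hf : ∀ a b, L.Adj a b → (graphJoin Q' (turanPlus φ')).Adj (f a) (f b) :=
    fun a b hab => f.toHom.map_adj hab
  obtain ⟨i, hi, hφi⟩ := exists_parity_class hφ
  obtain ⟨i', hi', hφi'⟩ := exists_parity_class hφ'
  -- The vertices outside the Turán part are moved by `σ`, and those of the biclique from `φ'` to
  -- `φ`. All others are embedded anew, into the class with the biclique (colour `true`) or the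
  -- opposite one, according to their old class.
  let im : Fin p ⊕ Fin N → Option (Fin p ⊕ Fin N)
    | .inl a => some (.inl (σ a))
    | .inr j => if hj : ∃ x, φ' x = j then some (.inr (φ hj.choose)) else none
  have himφ : ∀ x, im (.inr (φ' x)) = some (.inr (φ x)) := by
    intro x
    have hx : ∃ y, φ' y = φ' x := ⟨x, rfl⟩
    have := φ'.injective hx.choose_spec
    simp only [im, hx, dif_pos]
    rw [this]
  have himn : ∀ j, im (.inr j) = none → ∀ x, φ' x ≠ j := by
    rintro j hj x rfl
    rw [himφ] at hj
    cases hj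
  have hims : ∀ j, (im (.inr j)).isSome → ∃ x, φ' x = j := by
    intro j hj
    by_contra hcon
    rw [show im (.inr j) = none from dif_neg hcon] at hj
    cases hj
  have hcases : ∀ z v, im z = some v → (∃ a, z = .inl a ∧ v = .inl (σ a)) ∨
      ∃ x, z = .inr (φ' x) ∧ v = .inr (φ x) := by
    rintro (a | j) v hv
    · exact .inl ⟨a, rfl, (Option.some.inj hv).symm⟩
    · obtain ⟨x, rfl⟩ := hims j (by rw [hv]; rfl)
      rw [himφ] at hv
      exact .inr ⟨x, rfl, (Option.some.inj hv).symm⟩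
  let Y : Bool → Finset (Fin p ⊕ Fin N) := fun b => if b then
      ((Finset.univ.filter fun j : Fin N => j.val % 2 = i) \ Finset.univ.map φ).map
        Function.Embedding.inr
    else (Finset.univ.filter fun j : Fin N => ¬ j.val % 2 = i).map Function.Embedding.inr
  have hYt : ∀ v ∈ Y true, ∃ j, v = .inr j ∧ j.val % 2 = i := by
    intro v hv
    simp only [Y, if_true, Finset.mem_map, Finset.mem_sdiff, Finset.mem_filter] at hv
    obtain ⟨j, ⟨hj, -⟩, rfl⟩ := hv
    exact ⟨j, rfl, hj.2⟩
  have hYf : ∀ v ∈ Y false, ∃ j, v = .inr j ∧ ¬ j.val % 2 = i := by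
    intro v hv
    simp only [Y, Bool.false_eq_true, if_false, Finset.mem_map, Finset.mem_filter] at hv
    obtain ⟨j, hj, rfl⟩ := hv
    exact ⟨j, rfl, hj.2⟩
  have hYr : ∀ b, ∀ v ∈ Y b, ∃ j, v = .inr j := by
    rintro (_ | _) v hv
    · obtain ⟨j, rfl, -⟩ := hYf v hv
      exact ⟨j, rfl⟩
    · obtain ⟨j, rfl, -⟩ := hYt v hv
      exact ⟨j, rfl⟩
  have hYc : ∀ b, Fintype.card T ≤ (Y b).card := by
    rw [Nat.card_eq_fintype_card] at hN
    rintro (_ | _)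
    · have h1 := card_filter_mod_two_ne N i hi
      rw [Fintype.card_subtype] at h1
      simp only [Y, Bool.false_eq_true, if_false, Finset.card_map]
      omega
    · have h1 := card_filter_mod_two N i hi
      rw [Fintype.card_subtype] at h1
      have h2 := Finset.le_card_sdiff (Finset.univ.map φ)
        (Finset.univ.filter fun j : Fin N => j.val % 2 = i)
      rw [Finset.card_map, Finset.card_univ, Fintype.card_sum, Fintype.card_fin] at h2
      simp only [Y, if_true, Finset.card_map]
      omega
  have hadjY : ∀ u ∈ Y true, ∀ v ∈ Y false, (graphJoin Q (turanPlus φ)).Adj u v := by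
    intro u hu v hv
    obtain ⟨j, rfl, hj⟩ := hYt u hu
    obtain ⟨j', rfl, hj'⟩ := hYf v hv
    rw [graphJoin_adj_inr]
    exact .inl (by rw [turanGraph_adj]; omega)
  have hadjφ : ∀ x, ∀ v ∈ Y false, (graphJoin Q (turanPlus φ)).Adj (.inr (φ x)) v := by
    intro x v hv
    obtain ⟨j', rfl, hj'⟩ := hYf v hv
    rw [graphJoin_adj_inr]
    exact .inl (by rw [turanGraph_adj, hφi]; omega)
  have hpar : ∀ j j', (turanPlus φ').Adj j j' → (∀ x, φ' x ≠ j') → j.val % 2 ≠ j'.val % 2 := by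
    rintro j j' (hjj | ⟨-, x, y, -, -, rfl⟩) hx
    exacts [hjj, absurd rfl (hx y)]
  have hmiss : ∀ a b, L.Adj a b → ∀ u, im (f a) = some u → im (f b) = none →
      missIn (graphJoin Q (turanPlus φ)) u
        (Y (Sum.elim (fun _ => true) (fun j => decide (j.val % 2 = i')) (f b))) ≤ 0 := by
    intro a b hab u hu hb
    have hab' := hf a b hab
    refine (missIn_eq_zero.2 fun v hv => ?_).le
    rcases hcases _ _ hu with ⟨x, -, rfl⟩ | ⟨x, hx, rfl⟩
    · obtain ⟨j, rfl⟩ := hYr _ v hv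
      exact graphJoin_adj_inl_inr _ _
    · rcases hfb : f b with y | j
      · rw [hfb] at hb
        cases hb
      · rw [hx, hfb, graphJoin_adj_inr] at hab'
        rw [hfb] at hb hv
        have h1 := hpar _ _ hab' (himn j hb)
        rw [hφi' x] at h1
        have h2 : decide (j.val % 2 = i') = false := by simpa using fun h => h1 h.symm
        rw [Sum.elim_inr, h2] at hv
        exact hadjφ x v hv
  refine isContained_of_greedy L _ Y 0 ?_
    (fun z => Sum.elim (fun _ => true) (fun j => decide (j.val % 2 = i')) (f z))
    (fun z => Y (Sum.elim (fun _ => true) (fun j => decide (j.val % 2 = i')) (f z)))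
    (fun z => im (f z)) ?_ (fun _ _ _ h => h) ?_ ?_
  · rintro (_ | _) v hv
    · exact (missIn_eq_zero.2 fun y hy => (hadjY y hy v hv).symm).le
    · exact (missIn_eq_zero.2 fun y hy => hadjY v hv y hy).le
  · intro a b v ha hb
    rcases hcases _ _ ha with ⟨x, hx, rfl⟩ | ⟨x, hx, rfl⟩ <;>
      rcases hcases _ _ hb with ⟨y, hy, hxy⟩ | ⟨y, hy, hxy⟩
    · rw [Sum.inl.injEq] at hxy
      exact f.injective (hx.trans ((congrArg Sum.inl (σ.injective hxy)).trans hy.symm))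
    · cases hxy
    · cases hxy
    · rw [Sum.inr.injEq] at hxy
      exact f.injective (hx.trans ((congrArg (fun x => Sum.inr (φ' x))
        (φ.injective hxy)).trans hy.symm))
  · intro z _
    rw [zero_add, one_mul]
    exact hYc _
  · intro a b hab
    have hab' := hf a b hab
    refine ⟨fun u v hu hv => ?_, fun hu hv => ?_, hmiss a b hab,
      fun v hv hu => hmiss b a hab.symm v hu hv⟩
    · rcases hcases _ _ hu with ⟨x, hx, rfl⟩ | ⟨x, hx, rfl⟩ <;>
        rcases hcases _ _ hv with ⟨y, hy, rfl⟩ | ⟨y, hy, rfl⟩ <;> rw [hx, hy] at hab'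
      · rw [graphJoin_adj_inl] at hab' ⊢
        exact σ.map_adj_iff.2 hab'
      · exact graphJoin_adj_inl_inr _ _
      · exact (graphJoin_adj_inl_inr _ _).symm
      · rw [graphJoin_adj_inr] at hab' ⊢
        rcases hab' with h1 | h1
        · rw [turanGraph_adj, hφi', hφi'] at h1
          exact absurd rfl h1
        · right
          rw [map_adj_apply] at h1 ⊢
          exact h1
    · dsimp only at hu hv ⊢
      rcases hfa : f a with x | j
      · rw [hfa] at hu
        cases hu
      rcases hfb : f b with y | j'
      · rw [hfb] at hv
        cases hv
      rw [hfa, hfb, graphJoin_adj_inr] at hab'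
      rw [hfb] at hv
      have h1 := hpar _ _ hab' (himn j' hv)
      simp only [Sum.elim_inr, ne_eq, decide_eq_decide]
      omega

end Transfer

end Ballooning

namespace Ballooning

/-! ### The theorem -/

section Main

variable {W : Type*} {H : SimpleGraph W} {ℓ : H.edgeSet → ℕ}

lemma topCount_eq (n q m : ℕ) (𝓛 : GraphFamily) :
    topCount (q - 1) m (n - (q - 1)) 𝓛 = fNum n q + exFamily (q - 1) 𝓛 + m ^ 2 := by
  rw [topCount, fNum_eq]

lemma mem_FFamily_iff {n q m : ℕ} {𝓛 : GraphFamily} {G : SimpleGraph (Fin n)} :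
    G ∈ FFamily n q m 𝓛 ↔ HasTopShape G (q - 1) m (n - (q - 1)) 𝓛 := Iff.rfl

lemma exists_mem_EXGraph {T : Type*} {L : SimpleGraph T} (hL : L ≠ ⊥) (n : ℕ) :
    ∃ G, G ∈ EXGraph n L := by
  classical
  obtain ⟨G, hG, hsup⟩ := Finset.exists_mem_eq_sup
    (Finset.univ.filter fun G : SimpleGraph (Fin n) => L.Free G)
    ⟨⊥, by simpa using free_bot hL⟩ fun G => G.edgeFinset.card
  refine ⟨G, by simpa using hG, ?_⟩
  rw [← coe_edgeFinset, Set.ncard_coe_finset, ← hsup]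
  unfold extremalNumber
  congr

lemma oddBallooning_ne_bot (hne : H ≠ ⊥) : oddBallooning H ℓ ≠ ⊥ := by
  obtain ⟨a, b, hab⟩ := ne_bot_iff_exists_adj.1 hne
  exact ne_bot_iff_exists_adj.2 ⟨.inl a, .inl b, ballooning_adj_inl.2 hab⟩

/-- Without a complete bipartite graph in the Turán part, all graphs of the family are free. -/
lemma free_of_mem_FFamily_zero {T : Type*} [Finite T] {L : SimpleGraph T} (hq : 1 ≤ qTilde L)
    {n : ℕ} {G : SimpleGraph (Fin n)} (h : G ∈ FFamily n (qTilde L) 0 (BTilde L)) :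
    L.Free G := by
  obtain ⟨Q, hQ, φ, -, ⟨e⟩⟩ := h
  refine free_of_iso e.symm (free_graphJoin hq hQ.1 (c := fun a => decide (a.val % 2 = 0)) ?_)
  rintro a b (hab | ⟨-, x, -⟩)
  · exact turanGraph_ne hab
  · exact isEmptyElim x

lemma free_of_mem_FFamily {T : Type*} [Finite T] {L : SimpleGraph T} {n q m : ℕ}
    {𝓛 : GraphFamily} (hn : 2 * (Nat.card T + 2 * m) ≤ n - (q - 1))
    (huniq : ∀ Q ∈ EXFamily (q - 1) 𝓛, ∀ Q' ∈ EXFamily (q - 1) 𝓛, Nonempty (Q ≃g Q'))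
    {G G' : SimpleGraph (Fin n)} (hG : G ∈ FFamily n q m 𝓛) (hG' : G' ∈ FFamily n q m 𝓛)
    (hfree : L.Free G) : L.Free G' := by
  obtain ⟨Q, hQ, φ, hφ, ⟨e⟩⟩ := hG
  obtain ⟨Q', hQ', φ', hφ', ⟨e'⟩⟩ := hG'
  obtain ⟨σ⟩ := huniq Q' hQ' Q hQ
  exact free_of_iso e'.symm fun h =>
    free_of_iso e hfree (isContained_transfer σ hφ hφ' hn h)

theorem main [Fintype W] (hH : H.IsBipartite) (hne : H ≠ ⊥)
    (hℓ : ∀ e, Odd (ℓ e) ∧ 5 ≤ ℓ e) :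
    ∃ n₀ : ℕ, ∀ n : ℕ, n₀ ≤ n → ∀ q m x : ℕ, q = qTilde (oddBallooning H ℓ) →
      m = kParam (oddBallooning H ℓ) - 1 → x = extremalNumber n (oddBallooning H ℓ) →
      fNum n q + exFamily (q - 1) (BTilde (oddBallooning H ℓ)) ≤ x ∧
      x ≤ fNum n q + exFamily (q - 1) (BTilde (oddBallooning H ℓ)) + m ^ 2 ∧
      (x = fNum n q + exFamily (q - 1) (BTilde (oddBallooning H ℓ)) + m ^ 2 →
        EXGraph n (oddBallooning H ℓ) = {G | G ∈ FFamily n q m (BTilde (oddBallooning H ℓ)) ∧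
          (oddBallooning H ℓ).Free G} ∧
        ((m = 0 ∨ ∀ Q ∈ EXFamily (q - 1) (BTilde (oddBallooning H ℓ)),
            ∀ Q' ∈ EXFamily (q - 1) (BTilde (oddBallooning H ℓ)), Nonempty (Q ≃g Q')) →
          EXGraph n (oddBallooning H ℓ) = FFamily n q m (BTilde (oddBallooning H ℓ)))) := by
  classical
  have hq := one_le_qTilde hH hne hℓ
  obtain ⟨n₁, hn₁⟩ := exists_upper_bound hH hne hℓ
    (p := qTilde (oddBallooning H ℓ) - 1) (by omega)
  refine ⟨n₁ + (qTilde (oddBallooning H ℓ) - 1) + 2 * (Nat.card (BVert H ℓ) +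
    2 * (kParam (oddBallooning H ℓ) - 1)), ?_⟩
  rintro n hn q m x rfl rfl rfl
  have hup : ∀ G : SimpleGraph (Fin n), (oddBallooning H ℓ).Free G → _ := fun G hG =>
    hn₁ G (by rw [Fintype.card_fin]; omega) hG
  simp only [Fintype.card_fin, topCount_eq] at hup
  refine ⟨lower_bound hq (by omega), ?_, fun hx => ?_⟩
  · have h := extremalNumber_le_iff (V := Fin n) (oddBallooning H ℓ)
      (fNum n (qTilde (oddBallooning H ℓ)) +
        exFamily (qTilde (oddBallooning H ℓ) - 1) (BTilde (oddBallooning H ℓ)) +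
        (kParam (oddBallooning H ℓ) - 1) ^ 2)
    rw [Fintype.card_fin] at h
    refine h.2 fun G _ hG => ?_
    have := (hup G hG).1
    rwa [← coe_edgeFinset, Set.ncard_coe_finset] at this
  · have hEX : EXGraph n (oddBallooning H ℓ) = {G | G ∈ FFamily n (qTilde (oddBallooning H ℓ))
        (kParam (oddBallooning H ℓ) - 1) (BTilde (oddBallooning H ℓ)) ∧
        (oddBallooning H ℓ).Free G} := by
      ext G
      constructor
      · rintro ⟨hG, hGc⟩
        exact ⟨(hup G hG).2 (by rw [hGc, hx]), hG⟩
      · rintro ⟨hG, hGf⟩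
        refine ⟨hGf, ?_⟩
        rw [hx, ← topCount_eq]
        exact (mem_FFamily_iff.1 hG).ncard_edgeSet
    refine ⟨hEX, fun hor => ?_⟩
    rw [hEX]
    ext G
    refine ⟨fun h => h.1, fun hG => ⟨hG, ?_⟩⟩
    rcases hor with h0 | huniq
    · rw [h0] at hG
      exact free_of_mem_FFamily_zero hq hG
    -- Some extremal graph exists; by `hEX` it is a free member of the family, and freeness
    -- transfers from it to all members.
    · obtain ⟨G₀, hG₀⟩ := exists_mem_EXGraph (oddBallooning_ne_bot (ℓ := ℓ) hne) n
      rw [hEX] at hG₀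
      refine free_of_mem_FFamily ?_ huniq hG₀.1 hG hG₀.2
      change 2 * (Nat.card (BVert H ℓ) + _) ≤ _
      omega

end Main

end Ballooning

theorem mainTheorem1 {V : Type*} [Fintype V] (H : SimpleGraph V) (hbip : H.IsBipartite)
    (hne : H ≠ ⊥) (t : ℕ) (ht : 5 ≤ t) (ht_odd : Odd t) (ℓ : H.edgeSet → ℕ)
    (hℓ : ∀ e, Odd (ℓ e) ∧ t ≤ ℓ e) :
    ∃ n₀ : ℕ, ∀ n : ℕ, n₀ ≤ n →
      fNum n (qTilde (oddBallooning H ℓ)) +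
          exFamily (qTilde (oddBallooning H ℓ) - 1) (BTilde (oddBallooning H ℓ))
        ≤ extremalNumber n (oddBallooning H ℓ) ∧
      extremalNumber n (oddBallooning H ℓ) ≤
        fNum n (qTilde (oddBallooning H ℓ)) +
          exFamily (qTilde (oddBallooning H ℓ) - 1) (BTilde (oddBallooning H ℓ)) +
          (kParam (oddBallooning H ℓ) - 1) ^ 2 ∧
      (extremalNumber n (oddBallooning H ℓ) =
          fNum n (qTilde (oddBallooning H ℓ)) +
            exFamily (qTilde (oddBallooning H ℓ) - 1) (BTilde (oddBallooning H ℓ)) +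
            (kParam (oddBallooning H ℓ) - 1) ^ 2 →
        EXGraph n (oddBallooning H ℓ) =
            {G | G ∈ FFamily n (qTilde (oddBallooning H ℓ)) (kParam (oddBallooning H ℓ) - 1)
                (BTilde (oddBallooning H ℓ)) ∧ (oddBallooning H ℓ).Free G} ∧
        ((kParam (oddBallooning H ℓ) = 1 ∨
            ∀ Q ∈ EXFamily (qTilde (oddBallooning H ℓ) - 1) (BTilde (oddBallooning H ℓ)),
            ∀ Q' ∈ EXFamily (qTilde (oddBallooning H ℓ) - 1) (BTilde (oddBallooning H ℓ)),
              Nonempty (Q ≃g Q')) →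
          EXGraph n (oddBallooning H ℓ) =
            FFamily n (qTilde (oddBallooning H ℓ)) (kParam (oddBallooning H ℓ) - 1)
              (BTilde (oddBallooning H ℓ)))) := by
  obtain ⟨n₀, h⟩ := Ballooning.main hbip hne fun e => ⟨(hℓ e).1, ht.trans (hℓ e).2⟩
  refine ⟨n₀, fun n hn => ?_⟩
  obtain ⟨h1, h2, h3⟩ := h n hn _ _ _ rfl rfl rfl
  refine ⟨h1, h2, fun hx => ⟨(h3 hx).1, fun hor => (h3 hx).2 (hor.imp_left fun hk => ?_)⟩⟩
  rw [hk]
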